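/- Let $g_{\mathrm{TC}}>0$ and $\omega_z\neq 0$ be real. Consider $n$ qubits, with collective operators $J_w=\frac12\sum_{i=1}^n\sigma_w^{(i)}$ ($w=x,y,z$) and $J_\pm=J_x\pm iJ_y$, and one harmonic oscillator with annihilation operator $a$ and vacuum state $|0\rangle_{\mathrm{osc}}$. Let $H_{\mathrm{TC}}=g_{\mathrm{TC}}(J_+a+J_-a^\dagger)$ be the Tavis–Cummings interaction and $H_z=\omega_zJ_z$ a global $z$ field. For piecewise constant real control functions $c,z$ on $[0,T]$, let $V(t)$ be the unitary solution of $\frac{d}{dt}V(t)=-i\,(c(t)H_{\mathrm{TC}}+z(t)H_z)\,V(t)$, $V(0)=\mathbb I$. We say that $(T,c,z)$ realizes an $n$-qubit unitary $U$ up to a global phase if there is $\alpha\in\mathbb R$ such that $e^{i\alpha}V(T)(|\psi\rangle\otimes|0\rangle_{\mathrm{osc}})=(U|\psi\rangle)\otimes|0\rangle_{\mathrm{osc}}$ for all $|\psi\rangle\in(\mathbb C^2)^{\otimes n}$. **Theorem.** Let $n=2$ or $n=3$. Every $n$-qubit unitary $U$ that commutes with all permutations of the qubits and with $\sum_{j=1}^nZ_j$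 is realized exactly, up to a global phase, by some $(T,c,z)$. Furthermore, for $n=2$, every such $U$ is realized by some $(T,c,z)$ whose total interaction time satisfies $$\tau:=\int_0^T|c(t)|\,dt\ \le\ 3.92\times\frac{2\pi}{g_{\mathrm{TC}}}.$$ -/

import Mathlib

noncomputable section

namespace TavisCummings

/-- Labels of the computational basis of `n` qubits; `0 : Fin 2` is the `+1` eigenstate of `Z`. -/
abbrev Bits (n : ℕ) : Type := Fin n → Fin 2

/-- Operators on `(ℂ²)^{⊗ n}`, as matrices in the computational basis. -/
abbrev QubitOp (n : ℕ) : Type := Matrix (Bits n) (Bits n) ℂ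

/-- The Pauli matrices. -/
def pauliX : Matrix (Fin 2) (Fin 2) ℂ := !![0, 1; 1, 0]

def pauliY : Matrix (Fin 2) (Fin 2) ℂ := !![0, -Complex.I; Complex.I, 0]

def pauliZ : Matrix (Fin 2) (Fin 2) ℂ := !![1, 0; 0, -1]

/-- The one-qubit operator `A` acting on qubit `i`, tensored with the identity on the others. -/
def onQubit {n : ℕ} (i : Fin n) (A : Matrix (Fin 2) (Fin 2) ℂ) : QubitOp n :=
  Matrix.of fun s t => if ∀ k, k ≠ i → s k = t k then A (s i) (t i) else 0

/-- The total Pauli operator `∑ⱼ Zⱼ`. -/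
def sumZ (n : ℕ) : QubitOp n := ∑ i, onQubit i pauliZ

/-- Collective angular momentum operators `J_w = (1/2) ∑ᵢ σ_w⁽ⁱ⁾` and `J_± = J_x ± i J_y`. -/
def Jx (n : ℕ) : QubitOp n := (1 / 2 : ℂ) • ∑ i, onQubit i pauliX

def Jy (n : ℕ) : QubitOp n := (1 / 2 : ℂ) • ∑ i, onQubit i pauliY

def Jz (n : ℕ) : QubitOp n := (1 / 2 : ℂ) • ∑ i, onQubit i pauliZ

def Jplus (n : ℕ) : QubitOp n := Jx n + Complex.I • Jy n

def Jminus (n : ℕ) : QubitOp n := Jx n - Complex.I • Jy n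

/-- The operator permuting the `n` tensor factors, `|s₁ … sₙ⟩ ↦ |s_{π⁻¹ 1} … s_{π⁻¹ n}⟩`. -/
def permOp {n : ℕ} (π : Equiv.Perm (Fin n)) : QubitOp n :=
  Matrix.of fun s t => if s = fun k => t (π.symm k) then 1 else 0

/-- Permutational invariance: commuting with every permutation of the qubits. -/
def PermInvariant {n : ℕ} (U : QubitOp n) : Prop :=
  ∀ π : Equiv.Perm (Fin n), Commute U (permOp π)

/-- The joint Hilbert space `(ℂ²)^{⊗ n} ⊗ ℓ²(ℕ)` of the qubits and the oscillator, in the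
orthonormal basis `|s⟩ ⊗ |k⟩`. -/
abbrev JointSpace (n : ℕ) : Type := lp (fun _ : Bits n × ℕ => ℂ) 2

/-- Finite linear combinations of the basis vectors `|s⟩ ⊗ |k⟩`: an invariant core of all the
(unbounded) Hamiltonians considered, on which each of them is essentially self-adjoint. -/
abbrev Core (n : ℕ) : Type := Bits n × ℕ →₀ ℂ

/-- The inclusion of the core in the joint Hilbert space. -/
def Core.toJoint (n : ℕ) : Core n →ₗ[ℂ] JointSpace n :=
  Finsupp.linearCombination ℂ fun b => lp.single 2 b (1 : ℂ)

/-- `A ⊗ 1` for a qubit operator `A`. -/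
def qubitPart {n : ℕ} (A : QubitOp n) : Module.End ℂ (Core n) :=
  Finsupp.linearCombination ℂ fun b => ∑ s, Finsupp.single (s, b.2) (A s b.1)

/-- `1 ⊗ a`, with the annihilation operator `a |k⟩ = √k |k-1⟩` (in particular `a |0⟩ = 0`). -/
def annihilation (n : ℕ) : Module.End ℂ (Core n) :=
  Finsupp.linearCombination ℂ fun b => Finsupp.single (b.1, b.2 - 1) ((Real.sqrt b.2 : ℝ) : ℂ)

/-- `1 ⊗ a†`, with the creation operator `a† |k⟩ = √(k+1) |k+1⟩`. -/
def creation (n : ℕ) : Module.End ℂ (Core n) :=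
  Finsupp.linearCombination ℂ fun b =>
    Finsupp.single (b.1, b.2 + 1) ((Real.sqrt (b.2 + 1) : ℝ) : ℂ)

/-- The Tavis-Cummings interaction `H_TC = g (J₊ a + J₋ a†)`. -/
def HTC (n : ℕ) (g : ℝ) : Module.End ℂ (Core n) :=
  (g : ℂ) • (qubitPart (Jplus n) * annihilation n + qubitPart (Jminus n) * creation n)

/-- The global `z` field `H_z = ω J_z`. -/
def HZ (n : ℕ) (ω : ℝ) : Module.End ℂ (Core n) :=
  (ω : ℂ) • qubitPart (Jz n)

/-- The Hamiltonian `c H_TC + z H_z` for given values of the two controls. -/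
def hamiltonian (n : ℕ) (g ω c z : ℝ) : Module.End ℂ (Core n) :=
  (c : ℂ) • HTC n g + (z : ℂ) • HZ n ω

/-- `f` is constant on every subinterval of `[0, T]` that avoids the breakpoints in `S`. -/
def ConstantOff (T : ℝ) (S : Finset ℝ) (f : ℝ → ℝ) : Prop :=
  ∀ s t : ℝ, 0 ≤ s → s ≤ t → t ≤ T → (∀ b ∈ S, b ∉ Set.Icc s t) → f s = f t

/-- The unitaries `V t`, `0 ≤ t ≤ T`, solve the Schrödinger equation
`dV/dt = -i (c(t) H_TC + z(t) H_z) V`, `V 0 = 1`, with piecewise constant controls `c`, `z`.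
`V` is strongly continuous, preserves the core, and the differential equation holds strongly on
the core at all times that are not breakpoints of the controls. -/
structure IsEvolution (n : ℕ) (g ω T : ℝ) (c z : ℝ → ℝ)
    (V : ℝ → JointSpace n ≃ₗᵢ[ℂ] JointSpace n) : Prop where
  initial : ∀ ψ, V 0 ψ = ψ
  continuousOn : ∀ ψ, ContinuousOn (fun t => V t ψ) (Set.Icc 0 T)
  schrodinger : ∃ S : Finset ℝ, ConstantOff T S c ∧ ConstantOff T S z ∧
    ∀ t ∈ Set.Ioo 0 T, t ∉ S → ∀ ψ : Core n, ∃ φ : Core n,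
      V t (Core.toJoint n ψ) = Core.toJoint n φ ∧
      HasDerivAt (fun s => V s (Core.toJoint n ψ))
        (Core.toJoint n (-Complex.I • hamiltonian n g ω (c t) (z t) φ)) t

/-- The vector `ψ ⊗ |0⟩`, with the oscillator in the vacuum state. -/
def withVacuum {n : ℕ} (ψ : Bits n → ℂ) : JointSpace n :=
  ∑ s, lp.single 2 (s, 0) (ψ s)

/-- The qubit operator `U` is realized, exactly and up to a global phase, by the Tavis-Cummings
interaction and a global `z` field with the oscillator initially (and finally) in the vacuum, with
total interaction time `∫₀ᵀ |c(t)| dt = τ`. -/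
def RealizableInTime {n : ℕ} (g ω : ℝ) (U : QubitOp n) (τ : ℝ) : Prop :=
  ∃ (T : ℝ) (c z : ℝ → ℝ) (V : ℝ → JointSpace n ≃ₗᵢ[ℂ] JointSpace n),
    0 ≤ T ∧ IsEvolution n g ω T c z V ∧
    (∃ α : ℝ, ∀ ψ : Bits n → ℂ,
      Complex.exp (α * Complex.I) • V T (withVacuum ψ) = withVacuum (U.mulVec ψ)) ∧
    ∫ t in (0 : ℝ)..T, |c t| = τ

end TavisCummings

end

/-!
Both the interaction and the `z` field conserve the number of excitations, the number of qubits in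
the state `0` plus the number of photons. The joint space is therefore a Hilbert sum of
finite-dimensional sectors, and the evolution under constant controls is a block-diagonal unitary of
`ℓ²`, with exponentials of finite matrices as blocks (`evolution`). A ladder of collective states
(`IsLadder`), combined with `0, 1, 2, …` photons, spans an invariant subspace on which the interaction
is a tridiagonal matrix (`hamiltonian_ladder_interaction`); such a subspace is a sector below. A pulse
conjugated by rotations about `z` is a pulse with an arbitrary phase (`phasedPulse`), at no cost in
interaction time. A permutation-invariant unitary which commutes with `∑ Z_j` acts by a phase on the
first vector of each sector. The global phase and a final rotation about `z` provide the phases of the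
one-dimensional sectors, which the interaction does not affect, so it remains to control the phases of
the others.

For two qubits there are one sector with two levels and one with three. A `2π` pulse of the
three-level sector is the identity there, and an equatorial rotation of the two-level sector, by an
angle of which seven multiples exceed a full turn; seven such pulses take the two-level sector from
its first vector to any state (`exists_seven_rotations`). The proof uses a symmetric sequence of
rotations, for which the wanted amplitude becomes the value of a quadratic form; on each level set of
the form there is a one-parameter family of candidates, and continuity selects one which is reached by
three rotations. Four `π` pulses of the three-level sector are reflections there, and their product
gives its first vector any phase (`exists_four_reflections`). Their effect on the two-level sector is
a known rotation, which the preceding `2π` pulses compensate in advance. Altogether this takes the time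
of `18` pulses by `π`, which is `18 π / (√6 g)` and so at most `3.92 * (2 π / g)`.

For three qubits the coupled sectors have two, two, three and four levels. Phased pulses act on them
simultaneously, and generate a subgroup of the product of four unitary groups (`pulseGroup`). Together
with the central unitaries it has the whole Lie algebra as its tangent space
(`span_tangentSpace_eq_top`). Indeed the complexified tangent space contains `E = ∑ w e` and
`F = ∑ w f`, the raising and the lowering half of the interaction, with the couplings `w` and the
simple root vectors `e`, `f`. The bracket with `[E, F]` has on the root vectors `e` the eigenvalues
`2`; `6`; `2, 8`; `-2, 4, 10` in the four sectors, so it separates them but for the value `2`, and that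
pair is separated by the coroot of the root vector with eigenvalue `8`. A subgroup with full tangent
space is open (`isOpen_of_tangentSpace`), hence also closed, and contains all continuous paths
starting at `1`. This argument needs no theory of Lie groups beyond the inverse function theorem, and
does not presuppose that the subgroup is closed. Finally, commutators do not see the central factors,
and the commutator of a diagonal unitary with an exchange of basis vectors has prescribed phases on
the first vectors of the sectors (`exists_pulses_phases`).
-/

noncomputable section

namespace TavisCummings

open Filter Topology

/-! ### Block-diagonal unitaries on `ℓ²` -/

section Block

variable {ι : Type*} (κ : ι → ℕ) [∀ N, Fintype {b : ι // κ b = N}]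

/-- Families of matrices indexed by the fibres of `κ`: the coefficients of the operators on `ℓ²(ι)`
that are block-diagonal for the partition of `ι` into the fibres of `κ`. -/
abbrev BlockMatrix : Type _ := ∀ N, Matrix {b : ι // κ b = N} {b : ι // κ b = N} ℂ

variable {κ}

/-- The action of a block-diagonal matrix on functions. -/
def blockApply (u : BlockMatrix κ) (f : ι → ℂ) (b : ι) : ℂ :=
  (u (κ b)).mulVec (fun x => f x.1) ⟨b, rfl⟩

theorem blockApply_fiber (u : BlockMatrix κ) (f : ι → ℂ) {N : ℕ} (b : {b : ι // κ b = N}) :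
    blockApply u f b.1 = (u N).mulVec (fun x => f x.1) b := by
  obtain ⟨b, rfl⟩ := b
  rfl

theorem sum_norm_sq_mulVec {m : Type*} [Fintype m] [DecidableEq m] {U : Matrix m m ℂ}
    (hU : U ∈ Matrix.unitaryGroup m ℂ) (v : m → ℂ) :
    ∑ i, ‖U.mulVec v i‖ ^ 2 = ∑ i, ‖v i‖ ^ 2 := by
  have key : ∀ w : m → ℂ, ((∑ i, ‖w i‖ ^ 2 : ℝ) : ℂ) = star w ⬝ᵥ w := by
    intro w
    simp [dotProduct, ← Complex.conj_mul']
  have h : star (U.mulVec v) ⬝ᵥ U.mulVec v = star v ⬝ᵥ v := by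
    rw [Matrix.star_mulVec, Matrix.dotProduct_mulVec, Matrix.vecMul_vecMul]
    have : U.conjTranspose * U = 1 := Matrix.mem_unitaryGroup_iff'.1 hU
    rw [this, Matrix.vecMul_one]
  rw [← key, ← key] at h
  exact_mod_cast h

theorem hasSum_lp (f : lp (fun _ : ι => ℂ) 2) : HasSum (fun b => ‖f b‖ ^ 2) (‖f‖ ^ 2) := by
  have := lp.hasSum_norm (p := 2) (by norm_num) f
  simpa using this

theorem blockApply_mul (u v : BlockMatrix κ) (f : ι → ℂ) :
    blockApply u (blockApply v f) = blockApply (u * v) f := by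
  funext b
  simp only [blockApply, Pi.mul_apply]
  rw [← Matrix.mulVec_mulVec]
  congr 1
  funext x
  exact blockApply_fiber v f x

theorem blockApply_one [DecidableEq ι] (f : ι → ℂ) : blockApply (1 : BlockMatrix κ) f = f := by
  funext b
  simp [blockApply]

variable {u : BlockMatrix κ}

/-- All blocks are unitary. -/
def BlockUnitary [DecidableEq ι] (u : BlockMatrix κ) : Prop :=
  ∀ N, u N ∈ Matrix.unitaryGroup {b : ι // κ b = N} ℂ

variable [DecidableEq ι]

theorem hasSum_blockApply (hu : BlockUnitary u) {f : ι → ℂ} {a : ℝ}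
    (hf : HasSum (fun b => ‖f b‖ ^ 2) a) : HasSum (fun b => ‖blockApply u f b‖ ^ 2) a := by
  rw [← (Equiv.sigmaFiberEquiv κ).hasSum_iff] at hf ⊢
  have hfib : ∀ N, ∑ b : {b : ι // κ b = N}, ‖blockApply u f b.1‖ ^ 2
      = ∑ b : {b : ι // κ b = N}, ‖f b.1‖ ^ 2 := by
    intro N
    simp_rw [blockApply_fiber]
    exact sum_norm_sq_mulVec (hu N) _
  have h1 := hf.sigma (fun N => hasSum_fintype _)
  have hs : Summable ((fun b => ‖blockApply u f b‖ ^ 2) ∘ (Equiv.sigmaFiberEquiv κ)) := by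
    rw [summable_sigma_of_nonneg (fun _ => by simp only [Function.comp]; positivity)]
    refine ⟨fun N => (hasSum_fintype _).summable, ?_⟩
    refine h1.summable.congr fun N => ?_
    rw [tsum_fintype]
    exact (hfib N).symm
  have h2 := hs.hasSum.sigma (fun N => hasSum_fintype _)
  have h3 : (fun N => ∑ b : {b : ι // κ b = N},
      ((fun b => ‖f b‖ ^ 2) ∘ (Equiv.sigmaFiberEquiv κ)) ⟨N, b⟩) = _ :=
    funext fun N => (hfib N).symm
  rw [h3] at h1
  rw [h1.unique h2]
  exact hs.hasSum

theorem memℓp_blockApply (hu : BlockUnitary u) (f : lp (fun _ : ι => ℂ) 2) :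
    Memℓp (blockApply u f) 2 := by
  refine memℓp_gen ?_
  simpa using (hasSum_blockApply hu (hasSum_lp f)).summable

theorem blockUnitary_star (hu : BlockUnitary u) : BlockUnitary (star u) := fun N =>
  Unitary.star_mem (hu N)

/-- The unitary operator on `ℓ²(ι)` with the given unitary blocks. -/
def blockOp (u : BlockMatrix κ) (hu : BlockUnitary u) :
    lp (fun _ : ι => ℂ) 2 ≃ₗᵢ[ℂ] lp (fun _ : ι => ℂ) 2 where
  toFun f := ⟨blockApply u f, memℓp_blockApply hu f⟩
  invFun f := ⟨blockApply (star u) f, memℓp_blockApply (blockUnitary_star hu) f⟩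
  map_add' f g := by
    ext b
    simp only [blockApply, lp.coeFn_add, Pi.add_apply]
    rw [← Pi.add_apply, ← Matrix.mulVec_add]
    rfl
  map_smul' c f := by
    ext b
    simp only [blockApply, lp.coeFn_smul, Pi.smul_apply, RingHom.id_apply]
    rw [← Pi.smul_apply, ← Matrix.mulVec_smul]
    rfl
  left_inv f := by
    ext b
    have : star u * u = 1 := funext fun N => (hu N).1
    change blockApply (star u) (blockApply u f) b = f b
    rw [blockApply_mul, this, blockApply_one]
  right_inv f := by
    ext b
    have : u * star u = 1 := funext fun N => (hu N).2
    change blockApply u (blockApply (star u) f) b = f b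
    rw [blockApply_mul, this, blockApply_one]
  norm_map' f := by
    have h := hasSum_lp (⟨blockApply u f, memℓp_blockApply hu f⟩ : lp (fun _ : ι => ℂ) 2)
    have h2 := h.unique (hasSum_blockApply hu (hasSum_lp f))
    exact (sq_eq_sq₀ (norm_nonneg _) (norm_nonneg _)).1 h2

theorem blockOp_apply (hu : BlockUnitary u) (f : lp (fun _ : ι => ℂ) 2) (b : ι) :
    blockOp u hu f b = blockApply u f b := rfl

theorem blockOp_single (hu : BlockUnitary u) {N : ℕ} (b : {b : ι // κ b = N}) :
    blockOp u hu (lp.single 2 b.1 1) = ∑ b' : {b : ι // κ b = N}, u N b' b • lp.single 2 b'.1 1 := by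
  classical
  ext c
  rw [blockOp_apply, lp.coeFn_sum, Finset.sum_apply]
  simp only [lp.coeFn_smul, Pi.smul_apply, lp.single_apply]
  by_cases hc : κ c = N
  · subst hc
    rw [Finset.sum_eq_single ⟨c, rfl⟩]
    · simp only [blockApply, Matrix.mulVec, dotProduct]
      rw [Finset.sum_eq_single b]
      · simp
      · intro x _ hx
        rw [lp.single_apply_ne]
        · simp
        · exact fun h => hx (Subtype.ext h)
      · simp
    · intro x _ hx
      rw [Pi.single_apply, if_neg]
      · simp
      · exact fun h => hx (Subtype.ext h.symm)
    · simp
  · rw [Finset.sum_eq_zero]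
    · simp only [blockApply, Matrix.mulVec, dotProduct]
      refine Finset.sum_eq_zero fun x _ => ?_
      rw [lp.single_apply_ne]
      · simp
      · intro h
        exact hc (by rw [← x.2, h, b.2])
    · intro x _
      rw [Pi.single_apply, if_neg]
      · simp
      · intro h
        exact hc (by rw [h, x.2])

end Block

/-! ### The unitary group generated by a block-diagonal symmetric operator -/

section Evolution

variable {ι : Type*} [DecidableEq ι]

/-- The inclusion of the finitely supported functions in `ℓ²`. -/
def coreInclusion : (ι →₀ ℂ) →ₗ[ℂ] lp (fun _ : ι => ℂ) 2 :=
  Finsupp.linearCombination ℂ fun b => lp.single 2 b (1 : ℂ)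

theorem coreInclusion_single (b : ι) (c : ℂ) :
    coreInclusion (Finsupp.single b c) = c • lp.single 2 b 1 := by
  simp [coreInclusion]

/-- An operator on finitely supported functions which is symmetric and preserves the fibres
of `κ`. -/
structure IsBlockSymmetric (κ : ι → ℕ) (H : Module.End ℂ (ι →₀ ℂ)) : Prop where
  symm : ∀ a b, H (Finsupp.single a 1) b = star (H (Finsupp.single b 1) a)
  fiber : ∀ a b, κ b ≠ κ a → H (Finsupp.single a 1) b = 0

variable {κ : ι → ℕ} {H : Module.End ℂ (ι →₀ ℂ)}

theorem inner_coreInclusion_single (a : ι) (χ : ι →₀ ℂ) :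
    inner ℂ (coreInclusion (Finsupp.single a (1 : ℂ))) (coreInclusion χ) = χ a := by
  rw [coreInclusion_single, one_smul]
  induction χ using Finsupp.induction_linear with
  | zero => simp
  | add f g hf hg => rw [map_add, inner_add_right, hf, hg]; rfl
  | single b c =>
    rw [coreInclusion_single, inner_smul_right, lp.inner_single_left, lp.single_apply,
      Finsupp.single_apply]
    by_cases h : b = a
    · subst h; simp
    · rw [if_neg h, Pi.single_eq_of_ne (Ne.symm h)]; simp

theorem inner_apply_coreInclusion (hH : IsBlockSymmetric κ H) (φ χ : ι →₀ ℂ) :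
    inner ℂ (coreInclusion (H φ)) (coreInclusion χ)
      = inner ℂ (coreInclusion φ) (coreInclusion (H χ)) := by
  induction φ using Finsupp.induction_linear with
  | zero => simp
  | add f g hf hg => simp only [map_add, inner_add_left, hf, hg]
  | single a c =>
    have h1 : Finsupp.single a c = c • Finsupp.single a (1 : ℂ) := by simp
    rw [h1]
    simp only [map_smul, inner_smul_left]
    congr 1
    induction χ using Finsupp.induction_linear with
    | zero => simp
    | add f g hf hg => simp only [map_add, inner_add_right, hf, hg]
    | single b d =>
      have h1 : Finsupp.single b d = d • Finsupp.single b (1 : ℂ) := by simp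
      rw [h1]
      simp only [map_smul, inner_smul_right]
      congr 1
      rw [inner_coreInclusion_single, ← inner_conj_symm, inner_coreInclusion_single]
      exact (hH.symm b a).symm

variable [∀ N, Fintype {b : ι // κ b = N}]

/-- The block of `H` on a fibre. -/
def fiberMatrix (κ : ι → ℕ) (H : Module.End ℂ (ι →₀ ℂ)) (N : ℕ) :
    Matrix {b : ι // κ b = N} {b : ι // κ b = N} ℂ :=
  Matrix.of fun b' b => H (Finsupp.single b.1 1) b'.1

/-- The blocks of `exp (-i t H)`. -/
def evolutionBlock (κ : ι → ℕ) [∀ N, Fintype {b : ι // κ b = N}] (H : Module.End ℂ (ι →₀ ℂ))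
    (t : ℝ) : BlockMatrix κ :=
  fun N => NormedSpace.exp (t • (-Complex.I • fiberMatrix κ H N))

open scoped Matrix.Norms.L2Operator in
theorem blockUnitary_evolutionBlock (hH : IsBlockSymmetric κ H) (t : ℝ) :
    BlockUnitary (evolutionBlock κ H t) := by
  intro N
  let _ : NormedAlgebra ℚ (Matrix {b : ι // κ b = N} {b : ι // κ b = N} ℂ) :=
    NormedAlgebra.restrictScalars ℚ ℂ _
  refine NormedSpace.exp_mem_unitary_of_mem_skewAdjoint (𝔸 := Matrix _ _ ℂ) ?_
  rw [skewAdjoint.mem_iff]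
  ext a b
  have := hH.symm a.1 b.1
  simp [fiberMatrix, this, Matrix.star_apply]

open scoped Matrix.Norms.Operator in
theorem hasDerivAt_evolutionBlock (N : ℕ) (a b : {b : ι // κ b = N}) (t : ℝ) :
    HasDerivAt (fun s => evolutionBlock κ H s N a b)
      (-Complex.I * ∑ c, H (Finsupp.single c.1 1) a.1 * evolutionBlock κ H t N c b) t := by
  have h := hasDerivAt_exp_smul_const' (𝕂 := ℝ) (-Complex.I • fiberMatrix κ H N) t
  have h2 := ((LinearMap.toContinuousLinearMap (Matrix.entryLinearMap ℝ ℂ a b)).hasFDerivAt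
    |>.comp_hasDerivAt t h)
  refine h2.congr_deriv ?_
  change ((-Complex.I • fiberMatrix κ H N) * evolutionBlock κ H t N) a b = _
  rw [Matrix.smul_mul, Matrix.smul_apply, Matrix.mul_apply, smul_eq_mul]
  rfl

/-- The unitary operator `exp (-i t H)`. -/
def evolution (hH : IsBlockSymmetric κ H) (t : ℝ) :
    lp (fun _ : ι => ℂ) 2 ≃ₗᵢ[ℂ] lp (fun _ : ι => ℂ) 2 :=
  blockOp (evolutionBlock κ H t) (blockUnitary_evolutionBlock hH t)

theorem evolution_zero (hH : IsBlockSymmetric κ H) (f : lp (fun _ : ι => ℂ) 2) :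
    evolution hH 0 f = f := by
  ext b
  have : evolutionBlock κ H 0 = 1 := by
    funext N
    simp [evolutionBlock]
  rw [evolution, blockOp_apply, this, blockApply_one]

theorem apply_single_eq_sum (hH : IsBlockSymmetric κ H) {N : ℕ} (a : {b : ι // κ b = N}) :
    H (Finsupp.single a.1 1)
      = ∑ c : {b : ι // κ b = N}, Finsupp.single c.1 (H (Finsupp.single a.1 1) c.1) := by
  ext b
  rw [Finsupp.finsetSum_apply]
  by_cases hb : κ b = N
  · rw [Finset.sum_eq_single ⟨b, hb⟩]
    · simp
    · intro c _ hc
      rw [Finsupp.single_apply, if_neg]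
      exact fun h => hc (Subtype.ext h)
    · simp
  · rw [hH.fiber _ _ (by rwa [a.2]), Finset.sum_eq_zero]
    intro c _
    rw [Finsupp.single_apply, if_neg]
    rintro rfl
    exact hb c.2

/-- On finitely supported vectors `exp (-i t H)` stays finitely supported and solves the
Schrödinger equation. -/
theorem hasDerivAt_evolution (hH : IsBlockSymmetric κ H) (t : ℝ) (ψ : ι →₀ ℂ) :
    ∃ φ : ι →₀ ℂ, evolution hH t (coreInclusion ψ) = coreInclusion φ ∧
      HasDerivAt (fun s => evolution hH s (coreInclusion ψ))
        (coreInclusion (-Complex.I • H φ)) t := by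
  induction ψ using Finsupp.induction_linear with
  | zero => exact ⟨0, by simp, by simpa using hasDerivAt_const t _⟩
  | add f g hf hg =>
    obtain ⟨φ, h1, h2⟩ := hf
    obtain ⟨χ, h3, h4⟩ := hg
    refine ⟨φ + χ, by simp [h1, h3], ?_⟩
    simp only [map_add, smul_add]
    exact h2.fun_add h4
  | single b c =>
    let B : {x : ι // κ x = κ b} := ⟨b, rfl⟩
    have key : ∀ s, evolution hH s (coreInclusion (Finsupp.single b c)) =
        c • ∑ a, evolutionBlock κ H s (κ b) a B • lp.single 2 a.1 1 := by
      intro s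
      rw [coreInclusion_single, map_smul, evolution, blockOp_single _ B]
    refine ⟨c • ∑ a, Finsupp.single a.1 (evolutionBlock κ H t (κ b) a B), ?_, ?_⟩
    · rw [key, map_smul, map_sum]
      simp_rw [coreInclusion_single]
    · simp_rw [key]
      have h := (HasDerivAt.fun_sum fun a (_ : a ∈ Finset.univ) =>
        (hasDerivAt_evolutionBlock (H := H) (κ b) a B t).smul_const
          (lp.single 2 a.1 (1 : ℂ) : lp (fun _ : ι => ℂ) 2)).const_smul c
      refine h.congr_deriv ?_
      rw [map_smul H, map_smul coreInclusion, map_smul coreInclusion, smul_comm (-Complex.I)]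
      congr 1
      rw [map_sum, map_sum]
      have : ∀ a : {x : ι // κ x = κ b}, coreInclusion
          (H (Finsupp.single a.1 (evolutionBlock κ H t (κ b) a B))) =
          ∑ x : {x : ι // κ x = κ b}, (evolutionBlock κ H t (κ b) a B *
            H (Finsupp.single a.1 1) x.1) • lp.single 2 x.1 1 := by
        intro a
        have h1 : Finsupp.single a.1 (evolutionBlock κ H t (κ b) a B)
          = evolutionBlock κ H t (κ b) a B • Finsupp.single a.1 (1 : ℂ) := by simp
        rw [h1, map_smul, map_smul, apply_single_eq_sum hH a, map_sum, Finset.smul_sum]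
        simp_rw [coreInclusion_single, smul_smul]
        refine Finset.sum_congr rfl fun x _ => ?_
        rw [← apply_single_eq_sum hH a]
      simp_rw [this]
      rw [Finset.sum_comm, Finset.smul_sum]
      refine Finset.sum_congr rfl fun x _ => ?_
      rw [← Finset.sum_smul, smul_smul]
      congr 2
      exact Finset.sum_congr rfl fun _ _ => mul_comm _ _

theorem exists_coreInclusion_near (f : lp (fun _ : ι => ℂ) 2) {ε : ℝ} (hε : 0 < ε) :
    ∃ ψ : ι →₀ ℂ, dist f (coreInclusion ψ) < ε := by
  have h := (lp.hasSum_single (p := 2) (by norm_num) f)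
  obtain ⟨s, hs⟩ := (Metric.tendsto_atTop.1 h ε hε)
  refine ⟨∑ i ∈ s, Finsupp.single i (f i), ?_⟩
  rw [dist_comm]
  convert hs s le_rfl using 2
  rw [map_sum]
  refine Finset.sum_congr rfl fun i _ => ?_
  rw [coreInclusion_single, ← lp.single_smul]
  simp

theorem continuous_evolution (hH : IsBlockSymmetric κ H) (f : lp (fun _ : ι => ℂ) 2) :
    Continuous fun t => evolution hH t f := by
  refine continuous_of_uniform_approx_of_continuous fun u hu => ?_
  obtain ⟨ε, hε, hεu⟩ := Metric.mem_uniformity_dist.1 hu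
  obtain ⟨ψ, hψ⟩ := exists_coreInclusion_near f hε
  refine ⟨fun t => evolution hH t (coreInclusion ψ), ?_, fun t => hεu ?_⟩
  · refine continuous_iff_continuousAt.2 fun t => ?_
    obtain ⟨_, _, h⟩ := hasDerivAt_evolution hH t ψ
    exact h.continuousAt
  · rwa [LinearIsometryEquiv.dist_map]

/-- Uniqueness of the finitely supported solutions of the Schrödinger equation. -/
theorem eq_evolution_of_hasDerivAt (hH : IsBlockSymmetric κ H)
    {y : ℝ → lp (fun _ : ι => ℂ) 2}
    (hy : ∀ t, ∃ φ : ι →₀ ℂ, y t = coreInclusion φ ∧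
      HasDerivAt y (coreInclusion (-Complex.I • H φ)) t) (t : ℝ) :
    y t = evolution hH t (y 0) := by
  obtain ⟨ψ, hψ, -⟩ := hy 0
  let D : ℝ → lp (fun _ : ι => ℂ) 2 := fun t => y t - evolution hH t (y 0)
  have hD : ∀ t, ∃ φ : ι →₀ ℂ, D t = coreInclusion φ ∧
      HasDerivAt D (coreInclusion (-Complex.I • H φ)) t := by
    intro t
    obtain ⟨φ, h1, h2⟩ := hy t
    obtain ⟨χ, h3, h4⟩ := hasDerivAt_evolution hH t ψ
    rw [← hψ] at h3 h4
    refine ⟨φ - χ, by simp [D, h1, h3], ?_⟩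
    rw [map_sub, smul_sub, map_sub]
    exact h2.fun_sub h4
  have hI : ∀ t, HasDerivAt (fun s => inner ℂ (D s) (D s)) 0 t := by
    intro t
    obtain ⟨φ, h1, h2⟩ := hD t
    refine (h2.inner ℂ h2).congr_deriv ?_
    rw [h1]
    simp only [map_smul, inner_smul_left, inner_smul_right, inner_apply_coreInclusion hH]
    simp
  have hc := is_const_of_deriv_eq_zero (fun t => (hI t).differentiableAt) (fun t => (hI t).deriv) t 0
  have h0 : D 0 = 0 := by simp [D, evolution_zero]
  simp only [h0, inner_zero_left, inner_self_eq_zero] at hc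
  exact sub_eq_zero.1 hc

/-- If `L` intertwines a matrix `M` with `H`, it intertwines the solutions of `x' = -i M x` with
`exp (-i t H)`. -/
theorem evolution_of_intertwining (hH : IsBlockSymmetric κ H) {m : Type*} [Fintype m]
    {M : Matrix m m ℂ} {L : (m → ℂ) →ₗ[ℂ] (ι →₀ ℂ)} (hL : ∀ x, H (L x) = L (M.mulVec x))
    {x : ℝ → m → ℂ} (hx : ∀ t, HasDerivAt x (-Complex.I • M.mulVec (x t)) t) (t : ℝ) :
    evolution hH t (coreInclusion (L (x 0))) = coreInclusion (L (x t)) := by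
  refine (eq_evolution_of_hasDerivAt hH (y := fun t => coreInclusion (L (x t))) (fun t => ?_) t).symm
  refine ⟨L (x t), rfl, ?_⟩
  have h := (LinearMap.toContinuousLinearMap ((coreInclusion ∘ₗ L).restrictScalars ℝ)).hasFDerivAt
    |>.comp_hasDerivAt t (hx t)
  refine h.congr_deriv ?_
  simp [hL]

end Evolution

/-! ### The Tavis-Cummings Hamiltonian on the core -/

/-- The one-qubit raising operator. -/
def raise : Matrix (Fin 2) (Fin 2) ℂ := !![0, 1; 0, 0]

/-- The one-qubit lowering operator. -/
def lower : Matrix (Fin 2) (Fin 2) ℂ := !![0, 0; 1, 0]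

theorem Jplus_eq (n : ℕ) : Jplus n = ∑ i, onQubit i raise := by
  ext s t
  simp only [Jplus, Jx, Jy, Matrix.add_apply, Matrix.smul_apply, Matrix.sum_apply, onQubit,
    Matrix.of_apply, smul_eq_mul, Finset.mul_sum, ← Finset.sum_add_distrib]
  refine Finset.sum_congr rfl fun i _ => ?_
  split_ifs
  · generalize s i = a
    generalize t i = b
    fin_cases a <;> fin_cases b <;> simp [pauliX, pauliY, raise] <;> ring_nf <;>
      norm_num
  · simp

theorem Jminus_eq (n : ℕ) : Jminus n = ∑ i, onQubit i lower := by
  ext s t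
  simp only [Jminus, Jx, Jy, Matrix.sub_apply, Matrix.smul_apply, Matrix.sum_apply, onQubit,
    Matrix.of_apply, smul_eq_mul, Finset.mul_sum, ← Finset.sum_sub_distrib]
  refine Finset.sum_congr rfl fun i _ => ?_
  split_ifs
  · generalize s i = a
    generalize t i = b
    fin_cases a <;> fin_cases b <;> simp [pauliX, pauliY, lower] <;> ring_nf <;>
      norm_num
  · simp

theorem Jplus_apply_eq_star (n : ℕ) (s t : Bits n) : Jplus n s t = star (Jminus n t s) := by
  simp only [Jplus_eq, Jminus_eq, Matrix.sum_apply, onQubit, Matrix.of_apply, star_sum]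
  refine Finset.sum_congr rfl fun i _ => ?_
  have : (∀ k, k ≠ i → s k = t k) ↔ (∀ k, k ≠ i → t k = s k) :=
    forall₂_congr fun _ _ => eq_comm
  simp only [this]
  split_ifs
  · generalize s i = a
    generalize t i = b
    fin_cases a <;> fin_cases b <;> simp [raise, lower]
  · simp

/-- The number of qubits in the `+1` eigenstate of `Z`. -/
def upCount {n : ℕ} (s : Bits n) : ℕ := ∑ i, if s i = 0 then 1 else 0

/-- The total number of excitations, a conserved quantity. -/
def excitations {n : ℕ} (b : Bits n × ℕ) : ℕ := upCount b.1 + b.2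

theorem upCount_of_Jminus {n : ℕ} {s t : Bits n} (h : Jminus n s t ≠ 0) :
    upCount t = upCount s + 1 := by
  simp only [Jminus_eq, Matrix.sum_apply, onQubit, Matrix.of_apply] at h
  obtain ⟨i, -, hi⟩ := Finset.exists_ne_zero_of_sum_ne_zero h
  split_ifs at hi with hk
  · have h1 : s i = 1 ∧ t i = 0 := by
      revert hi
      generalize s i = a
      generalize t i = b
      fin_cases a <;> fin_cases b <;> simp [lower]
    unfold upCount
    rw [← Finset.add_sum_erase _ _ (Finset.mem_univ i), ← Finset.add_sum_erase _ (fun j =>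
      if s j = 0 then 1 else 0) (Finset.mem_univ i), h1.1, h1.2, add_comm]
    simp only [if_true, one_ne_zero, if_false, zero_add]
    congr 1
    refine Finset.sum_congr rfl fun j hj => ?_
    rw [hk j (Finset.ne_of_mem_erase hj)]
  · exact absurd rfl hi

theorem Jz_apply (n : ℕ) (s t : Bits n) :
    Jz n s t = if s = t then ((1 / 2 : ℂ) * ∑ i, if s i = 0 then 1 else -1) else 0 := by
  simp only [Jz, Matrix.smul_apply, Matrix.sum_apply, onQubit, Matrix.of_apply, smul_eq_mul]
  split_ifs with h
  · subst h
    congr 1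
    refine Finset.sum_congr rfl fun i _ => ?_
    simp only [implies_true, if_true]
    generalize s i = a
    fin_cases a <;> simp [pauliZ]
  · rw [Finset.sum_eq_zero, mul_zero]
    intro i _
    split_ifs with hk
    · have : s i ≠ t i := fun hi => h (funext fun k => by
        by_cases hki : k = i
        · rw [hki, hi]
        · exact hk k hki)
      revert this
      generalize s i = a
      generalize t i = b
      fin_cases a <;> fin_cases b <;> simp [pauliZ]
    · rfl

instance {n : ℕ} (N : ℕ) : Finite {b : Bits n × ℕ // excitations b = N} := by
  refine Finite.of_injective (β := Bits n × Fin (N + 1))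
    (fun b => (b.1.1, ⟨b.1.2, by have := b.2; unfold excitations at this; omega⟩)) ?_
  rintro ⟨⟨a, k⟩, h⟩ ⟨⟨b, l⟩, h'⟩ hab
  simp at hab
  simp [hab]

instance {n : ℕ} (N : ℕ) : Fintype {b : Bits n × ℕ // excitations b = N} := Fintype.ofFinite _

/-- The vector `v ⊗ |k⟩` of the core. -/
def ket {n : ℕ} (v : Bits n → ℂ) (k : ℕ) : Core n := ∑ s, Finsupp.single (s, k) (v s)

theorem ket_add {n : ℕ} (v w : Bits n → ℂ) (k : ℕ) : ket (v + w) k = ket v k + ket w k := by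
  simp [ket, Finset.sum_add_distrib]

theorem ket_smul {n : ℕ} (c : ℂ) (v : Bits n → ℂ) (k : ℕ) : ket (c • v) k = c • ket v k := by
  simp [ket, Finset.smul_sum]

theorem ket_zero {n : ℕ} (k : ℕ) : ket (0 : Bits n → ℂ) k = 0 := by
  simp [ket]

theorem ket_single {n : ℕ} (s : Bits n) (k : ℕ) : ket (Pi.single s 1) k = Finsupp.single (s, k) 1 := by
  unfold ket
  rw [Finset.sum_eq_single s]
  · simp
  · intro t _ ht
    simp [Pi.single_eq_of_ne ht]
  · simp

theorem ket_apply {n : ℕ} (v : Bits n → ℂ) (k : ℕ) (b : Bits n × ℕ) :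
    ket v k b = if b.2 = k then v b.1 else 0 := by
  unfold ket
  rw [Finsupp.finsetSum_apply, Finset.sum_eq_single b.1]
  · rw [Finsupp.single_apply]
    simp [Prod.ext_iff, eq_comm]
  · intro t _ ht
    rw [Finsupp.single_apply, if_neg]
    rintro rfl
    exact ht rfl
  · simp

theorem qubitPart_ket {n : ℕ} (A : QubitOp n) (v : Bits n → ℂ) (k : ℕ) :
    qubitPart A (ket v k) = ket (A.mulVec v) k := by
  simp only [ket, qubitPart, map_sum, Finsupp.linearCombination_single, Finset.smul_sum,
    Matrix.mulVec, dotProduct, Finsupp.single_finsetSum]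
  rw [Finset.sum_comm]
  simp [mul_comm]

theorem annihilation_ket {n : ℕ} (v : Bits n → ℂ) (k : ℕ) :
    annihilation n (ket v k) = ((Real.sqrt k : ℝ) : ℂ) • ket v (k - 1) := by
  simp [ket, annihilation, Finset.smul_sum, mul_comm]

theorem creation_ket {n : ℕ} (v : Bits n → ℂ) (k : ℕ) :
    creation n (ket v k) = ((Real.sqrt (k + 1) : ℝ) : ℂ) • ket v (k + 1) := by
  simp [ket, creation, Finset.smul_sum, mul_comm]

theorem hamiltonian_ket {n : ℕ} (g ω c z : ℝ) (v : Bits n → ℂ) (k : ℕ) :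
    hamiltonian n g ω c z (ket v k) =
      ((c * g * Real.sqrt k : ℝ) : ℂ) • ket ((Jplus n).mulVec v) (k - 1) +
      ((c * g * Real.sqrt (k + 1) : ℝ) : ℂ) • ket ((Jminus n).mulVec v) (k + 1) +
      ((z * ω : ℝ) : ℂ) • ket ((Jz n).mulVec v) k := by
  simp only [hamiltonian, HTC, HZ, LinearMap.add_apply, LinearMap.smul_apply, Module.End.mul_apply,
    annihilation_ket, creation_ket, map_smul, qubitPart_ket, smul_add, smul_smul]
  push_cast
  simp only [mul_assoc]

theorem hamiltonian_single_apply {n : ℕ} (g ω c z : ℝ) (a b : Bits n × ℕ) :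
    hamiltonian n g ω c z (Finsupp.single a 1) b =
      (if b.2 + 1 = a.2 then ((c * g * Real.sqrt a.2 : ℝ) : ℂ) * Jplus n b.1 a.1 else 0) +
      (if b.2 = a.2 + 1 then ((c * g * Real.sqrt b.2 : ℝ) : ℂ) * Jminus n b.1 a.1 else 0) +
      (if b.2 = a.2 then ((z * ω : ℝ) : ℂ) * Jz n b.1 a.1 else 0) := by
  obtain ⟨s, k⟩ := a
  rw [← ket_single, hamiltonian_ket]
  simp only [Finsupp.add_apply, Finsupp.smul_apply, ket_apply, smul_eq_mul, mul_ite, mul_zero,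
    Matrix.mulVec_single_one, Matrix.col_apply]
  congr 2
  · rcases k with _ | k
    · simp
    · simp
  · split_ifs with h
    · rw [h]; push_cast; rfl
    · rfl

theorem isBlockSymmetric_hamiltonian (n : ℕ) (g ω c z : ℝ) :
    IsBlockSymmetric excitations (hamiltonian n g ω c z) where
  symm a b := by
    have hz : Jz n b.1 a.1 = star (Jz n a.1 b.1) := by
      simp only [Jz_apply]
      by_cases h : b.1 = a.1
      · rw [if_pos h, if_pos h.symm, h]
        simp [apply_ite (starRingEnd ℂ)]
      · rw [if_neg h, if_neg (Ne.symm h)]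
        simp
    simp only [hamiltonian_single_apply, star_add, apply_ite star, star_mul', star_zero,
      hz, Jplus_apply_eq_star, Complex.star_def, Complex.conj_ofReal]
    rw [add_comm (ite _ _ _)]
    simp only [eq_comm, Complex.conj_conj]
  fiber a b h := by
    simp only [hamiltonian_single_apply]
    have h1 : b.2 + 1 = a.2 → Jplus n b.1 a.1 = 0 := by
      intro hk
      by_contra hJ
      rw [Jplus_apply_eq_star] at hJ
      have := upCount_of_Jminus (star_ne_zero.1 hJ)
      unfold excitations at h
      omega
    have h2 : b.2 = a.2 + 1 → Jminus n b.1 a.1 = 0 := by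
      intro hk
      by_contra hJ
      have := upCount_of_Jminus hJ
      unfold excitations at h
      omega
    have h3 : b.2 = a.2 → Jz n b.1 a.1 = 0 := by
      intro hk
      rw [Jz_apply, if_neg]
      intro hs
      exact h (by rw [excitations, excitations, hs, hk])
    split_ifs <;> simp_all

/-! ### Piecewise constant controls -/

/-- The unitary `exp (-i t (c H_TC + z H_z))`. -/
def propagator (n : ℕ) (g ω c z t : ℝ) : JointSpace n ≃ₗᵢ[ℂ] JointSpace n :=
  evolution (isBlockSymmetric_hamiltonian n g ω c z) t

/-- `V` is the evolution operator at the final time of some piecewise constant controls with total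
interaction time `τ`. Preservation of the core at the final time, which may be a breakpoint, is
recorded because it is needed to continue the evolution. -/
def Reachable {n : ℕ} (g ω : ℝ) (V : JointSpace n ≃ₗᵢ[ℂ] JointSpace n) (τ : ℝ) : Prop :=
  ∃ (T : ℝ) (c z : ℝ → ℝ) (W : ℝ → JointSpace n ≃ₗᵢ[ℂ] JointSpace n),
    0 ≤ T ∧ IsEvolution n g ω T c z W ∧ W T = V ∧
    (∀ ψ : Core n, ∃ φ : Core n, V (Core.toJoint n ψ) = Core.toJoint n φ) ∧
    IntervalIntegrable c MeasureTheory.volume 0 T ∧ ∫ t in (0 : ℝ)..T, |c t| = τ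

theorem Reachable.refl {n : ℕ} (g ω : ℝ) :
    Reachable g ω (LinearIsometryEquiv.refl ℂ (JointSpace n)) 0 := by
  refine ⟨0, 0, 0, fun _ => LinearIsometryEquiv.refl ℂ _, le_rfl, ⟨fun _ => rfl, ?_, ∅, ?_, ?_, ?_⟩,
    rfl, fun ψ => ⟨ψ, rfl⟩, by simp, by simp⟩
  · exact fun _ => continuousOn_const
  · exact fun _ _ _ _ _ _ => rfl
  · exact fun _ _ _ _ _ _ => rfl
  · intro t ht
    simp at ht

theorem ConstantOff.extend {T t a : ℝ} {S : Finset ℝ} {f : ℝ → ℝ} (hf : ConstantOff T S f) :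
    ConstantOff (T + t) (insert T S) (fun s => if s ≤ T then f s else a) := by
  intro r s hr hrs _ hb
  have hT := hb T (Finset.mem_insert_self _ _)
  rw [Set.mem_Icc, not_and_or, not_le, not_le] at hT
  rcases hT with h | h
  · simp only [if_neg h.not_ge, if_neg (h.trans_le hrs).not_ge]
  · simp only [if_pos h.le, if_pos (hrs.trans h.le)]
    exact hf r s hr hrs h.le fun b hbS => hb b (Finset.mem_insert_of_mem hbS)

/-- Extending an evolution by constant controls. -/
theorem IsEvolution.extend {n : ℕ} {g ω T : ℝ} {c z : ℝ → ℝ}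
    {W : ℝ → JointSpace n ≃ₗᵢ[ℂ] JointSpace n} (hW : IsEvolution n g ω T c z W) (hT : 0 ≤ T)
    (hcore : ∀ ψ : Core n, ∃ φ : Core n, W T (Core.toJoint n ψ) = Core.toJoint n φ)
    (c₀ z₀ : ℝ) {t : ℝ} (ht : 0 ≤ t) :
    IsEvolution n g ω (T + t) (fun s => if s ≤ T then c s else c₀)
      (fun s => if s ≤ T then z s else z₀)
      (fun s => if s ≤ T then W s else (W T).trans (propagator n g ω c₀ z₀ (s - T))) where
  initial ψ := by
    simp only [if_pos hT]
    exact hW.initial ψ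
  continuousOn ψ := by
    have hsplit : Set.Icc 0 (T + t) = Set.Icc 0 T ∪ Set.Icc T (T + t) :=
      (Set.Icc_union_Icc_eq_Icc hT (by linarith)).symm
    rw [hsplit]
    refine ContinuousOn.union_of_isClosed ?_ ?_ isClosed_Icc isClosed_Icc
    · refine (hW.continuousOn ψ).congr fun s hs => ?_
      simp only [if_pos hs.2]
    · have h : Continuous fun s => propagator n g ω c₀ z₀ (s - T) (W T ψ) :=
        (continuous_evolution (isBlockSymmetric_hamiltonian n g ω c₀ z₀) (W T ψ)).comp
          (continuous_id.sub continuous_const)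
      refine h.continuousOn.congr fun s hs => ?_
      rcases hs.1.eq_or_lt with h | h
      · subst h
        simp [propagator, evolution_zero]
      · simp only [if_neg h.not_ge]
        rfl
  schrodinger := by
    obtain ⟨S, hc, hz, hS⟩ := hW.schrodinger
    refine ⟨insert T S, hc.extend, hz.extend, fun s hs hsS ψ => ?_⟩
    rw [Finset.mem_insert, not_or] at hsS
    rcases lt_or_gt_of_ne hsS.1 with h | h
    · obtain ⟨φ, h1, h2⟩ := hS s ⟨hs.1, h⟩ hsS.2 ψ
      simp only [if_pos h.le]
      refine ⟨φ, h1, h2.congr_of_eventuallyEq ?_⟩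
      filter_upwards [Iio_mem_nhds h] with r hr
      simp only [if_pos (le_of_lt (Set.mem_Iio.1 hr))]
    · obtain ⟨χ, hχ⟩ := hcore ψ
      obtain ⟨φ, h1, h2⟩ :=
        hasDerivAt_evolution (isBlockSymmetric_hamiltonian n g ω c₀ z₀) (s - T) χ
      simp only [if_neg h.not_ge]
      refine ⟨φ, ?_, ?_⟩
      · rw [LinearIsometryEquiv.trans_apply, hχ]
        exact h1
      · refine (HasDerivAt.comp_sub_const s T h2).congr_of_eventuallyEq ?_
        filter_upwards [Ioi_mem_nhds h] with r hr
        simp only [if_neg (not_le_of_gt (Set.mem_Ioi.1 hr)), LinearIsometryEquiv.trans_apply, hχ]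
        rfl

theorem Reachable.propagator {n : ℕ} {g ω : ℝ} {V : JointSpace n ≃ₗᵢ[ℂ] JointSpace n} {τ : ℝ}
    (hV : Reachable g ω V τ) (c₀ z₀ : ℝ) {t : ℝ} (ht : 0 ≤ t) :
    Reachable g ω (V.trans (propagator n g ω c₀ z₀ t)) (τ + t * |c₀|) := by
  obtain ⟨T, c, z, W, hT, hW, rfl, hcore, hint, rfl⟩ := hV
  have h1 : Set.EqOn (fun s => if s ≤ T then c s else c₀) c (Set.uIoc 0 T) := by
    intro s hs
    rw [Set.uIoc_of_le hT] at hs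
    simp only [if_pos hs.2]
  have h2 : Set.EqOn (fun s => if s ≤ T then c s else c₀) (fun _ => c₀) (Set.uIoc T (T + t)) := by
    intro s hs
    rw [Set.uIoc_of_le (by linarith)] at hs
    simp only [if_neg (not_le_of_gt hs.1)]
  have i1 : IntervalIntegrable (fun s => if s ≤ T then c s else c₀) MeasureTheory.volume 0 T :=
    hint.congr h1.symm
  have i2 : IntervalIntegrable (fun s => if s ≤ T then c s else c₀) MeasureTheory.volume T (T + t) :=
    (intervalIntegrable_const (c := c₀)).congr h2.symm
  refine ⟨T + t, _, _, _, by linarith, hW.extend hT hcore c₀ z₀ ht, ?_, ?_, i1.trans i2, ?_⟩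
  · rcases ht.eq_or_lt with h | h
    · subst h
      ext1 f
      simp [TavisCummings.propagator, evolution_zero]
    · simp [h]
  · intro ψ
    obtain ⟨χ, hχ⟩ := hcore ψ
    obtain ⟨φ, h, -⟩ := hasDerivAt_evolution (isBlockSymmetric_hamiltonian n g ω c₀ z₀) t χ
    refine ⟨φ, ?_⟩
    rw [LinearIsometryEquiv.trans_apply, hχ]
    exact h
  · rw [← intervalIntegral.integral_add_adjacent_intervals i1.abs i2.abs]
    congr 1
    · refine intervalIntegral.integral_congr_ae (Eventually.of_forall fun s hs => ?_)
      have := h1 hs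
      simp only at this
      rw [this]
    · rw [intervalIntegral.integral_congr_ae (g := fun _ => |c₀|)
        (Eventually.of_forall fun s hs => ?_)]
      · simp
      · have := h2 hs
        simp only at this
        rw [this]

theorem withVacuum_eq {n : ℕ} (ψ : Bits n → ℂ) : withVacuum ψ = Core.toJoint n (ket ψ 0) := by
  unfold withVacuum ket
  rw [map_sum]
  refine Finset.sum_congr rfl fun s _ => ?_
  refine Eq.trans ?_ (coreInclusion_single (s, 0) (ψ s)).symm
  rw [← lp.single_smul]
  simp

theorem RealizableInTime.of_reachable {n : ℕ} {g ω : ℝ} {U : QubitOp n}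
    {V : JointSpace n ≃ₗᵢ[ℂ] JointSpace n} {τ : ℝ} (hV : Reachable g ω V τ) (α : ℝ)
    (h : ∀ ψ : Bits n → ℂ, Complex.exp (α * Complex.I) • V (Core.toJoint n (ket ψ 0)) =
      Core.toJoint n (ket (U.mulVec ψ) 0)) : RealizableInTime g ω U τ := by
  obtain ⟨T, c, z, W, hT, hW, rfl, -, -, hτ⟩ := hV
  refine ⟨T, c, z, W, hT, hW, ⟨α, fun ψ => ?_⟩, hτ⟩
  rw [withVacuum_eq, withVacuum_eq]
  exact h ψ

/-! ### Ladders of collective states -/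

/-- A string of qubit states `v₀, v₁, …, v_{d-1}` (continued by zero) which carries a
representation of the collective angular momentum: `J_-` and `J_+` move along it with coefficients
`α`, and `J_z v_j = (m - j) v_j`. -/
structure IsLadder {n : ℕ} (d : ℕ) (v : ℕ → Bits n → ℂ) (α : ℕ → ℝ) (m : ℝ) : Prop where
  zero : ∀ j, d ≤ j → v j = 0
  down : ∀ j, (Jminus n).mulVec (v j) = (α j : ℂ) • v (j + 1)
  up : ∀ j, j + 1 < d → (Jplus n).mulVec (v (j + 1)) = (α j : ℂ) • v j
  weight : ∀ j, (Jz n).mulVec (v j) = ((m - j : ℝ) : ℂ) • v j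

/-- The embedding of `ℂ^d` in the sector of the core spanned by the states `v_j ⊗ |j⟩`. -/
def sectorMap {n : ℕ} (d : ℕ) (v : ℕ → Bits n → ℂ) : (Fin d → ℂ) →ₗ[ℂ] Core n :=
  Fintype.linearCombination ℂ fun j : Fin d => ket (v j) j

/-- The interaction with phase `φ` in a sector, as a tridiagonal matrix with off-diagonal entries
`w j * exp (± i φ)`. -/
def sectorMatrix (d : ℕ) (w : ℕ → ℝ) (φ : ℝ) : Matrix (Fin d) (Fin d) ℂ :=
  Matrix.of fun i j =>
    (if (i : ℕ) = j + 1 then (w j : ℂ) * Complex.exp (φ * Complex.I) else 0) +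
    (if (j : ℕ) = i + 1 then (w i : ℂ) * Complex.exp (-(φ * Complex.I)) else 0)

/-- The couplings of the Tavis-Cummings interaction in the sector of a ladder: the emission of
the `(j+1)`-st photon contributes `√(j+1)`. -/
def coupling (α : ℕ → ℝ) (j : ℕ) : ℝ := α j * Real.sqrt (j + 1)

theorem sectorMap_eq {n : ℕ} (d : ℕ) (v : ℕ → Bits n → ℂ) (x : Fin d → ℂ) :
    sectorMap d v x = ∑ j : Fin d, x j • ket (v j) j := by
  simp [sectorMap, Fintype.linearCombination_apply]

theorem sectorMap_mulVec {n : ℕ} (d : ℕ) (v : ℕ → Bits n → ℂ) (M : Matrix (Fin d) (Fin d) ℂ)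
    (x : Fin d → ℂ) :
    sectorMap d v (M.mulVec x) = ∑ j : Fin d, x j • ∑ i : Fin d, M i j • ket (v i) i := by
  rw [sectorMap_eq]
  simp only [Matrix.mulVec, dotProduct, Finset.sum_smul, Finset.smul_sum]
  rw [Finset.sum_comm]
  simp [smul_smul, mul_comm]

theorem hamiltonian_ladder_interaction {n d : ℕ} {v : ℕ → Bits n → ℂ} {α : ℕ → ℝ} {m : ℝ}
    (h : IsLadder d v α m) (g ω : ℝ) (x : Fin d → ℂ) :
    hamiltonian n g ω 1 0 (sectorMap d v x) =
      sectorMap d v (((g : ℂ) • sectorMatrix d (coupling α) 0).mulVec x) := by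
  rw [sectorMap_mulVec, sectorMap_eq, map_sum]
  refine Finset.sum_congr rfl fun j _ => ?_
  rw [map_smul]
  congr 1
  simp only [Matrix.smul_apply, sectorMatrix, Matrix.of_apply, Complex.ofReal_zero, zero_mul, neg_zero,
    Complex.exp_zero, mul_one, smul_eq_mul, mul_add, add_smul, Finset.sum_add_distrib, mul_ite,
    mul_zero, ite_smul, zero_smul]
  have e1 : (∑ i : Fin d, if (i : ℕ) = j + 1 then ((g : ℂ) * (coupling α j : ℂ)) • ket (v i) i else 0)
      = ((g : ℂ) * (coupling α j : ℂ)) • ket (v (j + 1)) (j + 1) := by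
    rw [Fin.sum_univ_eq_sum_range (fun i => if i = (j : ℕ) + 1 then
      ((g : ℂ) * (coupling α j : ℂ)) • ket (v i) i else 0), Finset.sum_ite_eq']
    split_ifs with hj
    · rfl
    · rw [h.zero _ (by simpa using hj), ket_zero, smul_zero]
  have e2 : (∑ i : Fin d, if (j : ℕ) = i + 1 then ((g : ℂ) * (coupling α i : ℂ)) • ket (v i) i else 0)
      = ((g * Real.sqrt j : ℝ) : ℂ) • ket ((Jplus n).mulVec (v j)) (j - 1) := by
    obtain ⟨j, hj⟩ := j
    rcases j with _ | j
    · simp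
    · rw [h.up j hj]
      simp only [Nat.add_right_cancel_iff]
      rw [Fin.sum_univ_eq_sum_range (fun i => if j = i then
        ((g : ℂ) * (coupling α i : ℂ)) • ket (v i) i else 0), Finset.sum_ite_eq,
        if_pos (by simp; omega)]
      simp only [Nat.add_sub_cancel, ket_smul, smul_smul, coupling]
      push_cast
      congr 1
      ring
  rw [e1, e2, hamiltonian_ket, h.down]
  simp only [ket_smul, smul_smul, coupling]
  push_cast
  simp only [zero_mul, zero_smul, add_zero, one_mul]
  rw [add_comm]
  congr 2
  ring

/-- The phases of the `z` rotation by the angle `ζ` in a sector. -/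
def zPhases (d : ℕ) (m ζ : ℝ) (x : Fin d → ℂ) : Fin d → ℂ :=
  fun j => Complex.exp (-((ζ * (m - (j : ℕ)) : ℝ) * Complex.I)) * x j

/-- The rotation `exp (-i ζ J_z)`. -/
def zRotation (n : ℕ) (g ω ζ : ℝ) : JointSpace n ≃ₗᵢ[ℂ] JointSpace n :=
  propagator n g ω 0 (ζ / ω) 1

theorem zRotation_sectorMap {n d : ℕ} {v : ℕ → Bits n → ℂ} {α : ℕ → ℝ} {m : ℝ}
    (h : IsLadder d v α m) (g : ℝ) {ω : ℝ} (hω : ω ≠ 0) (ζ : ℝ) (x : Fin d → ℂ) :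
    zRotation n g ω ζ (Core.toJoint n (sectorMap d v x)) =
      Core.toJoint n (sectorMap d v (zPhases d m ζ x)) := by
  have hL : ∀ x, hamiltonian n g ω 0 (ζ / ω) (sectorMap d v x) =
      sectorMap d v ((Matrix.diagonal fun j : Fin d => ((ζ * (m - (j : ℕ)) : ℝ) : ℂ)).mulVec x) := by
    intro x
    rw [sectorMap_eq, sectorMap_eq, map_sum]
    refine Finset.sum_congr rfl fun j _ => ?_
    rw [map_smul, hamiltonian_ket, h.weight, Matrix.mulVec_diagonal, div_mul_cancel₀ _ hω]
    simp only [ket_smul, smul_smul]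
    push_cast
    simp only [zero_mul, zero_smul, zero_add, smul_smul]
    congr 1
    ring
  have h0 : zPhases d m 0 x = x := by
    funext j
    simp [zPhases]
  have := evolution_of_intertwining (isBlockSymmetric_hamiltonian n g ω 0 (ζ / ω)) hL
    (x := fun t => zPhases d m (ζ * t) x) (fun t => ?_) 1
  · rw [mul_zero, mul_one, h0] at this
    exact this
  · rw [hasDerivAt_pi]
    intro j
    have h1 : HasDerivAt (fun t : ℝ => -(((ζ * t) * (m - (j : ℕ)) : ℝ) * Complex.I))
        (-((ζ * (m - (j : ℕ)) : ℝ) * Complex.I)) t := by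
      have := ((((hasDerivAt_id t).const_mul ζ).mul_const (m - (j : ℕ))).ofReal_comp.mul_const
        Complex.I).fun_neg
      simpa using this
    refine (h1.cexp.mul_const (x j)).congr_deriv ?_
    simp only [Pi.smul_apply, Matrix.mulVec_diagonal, zPhases, smul_eq_mul]
    push_cast
    ring

/-- A pulse of the interaction of duration `t`, conjugated by `z` rotations. -/
def phasedPulse (n : ℕ) (g ω φ t : ℝ) : JointSpace n ≃ₗᵢ[ℂ] JointSpace n :=
  ((zRotation n g ω (-φ)).trans (propagator n g ω 1 0 t)).trans (zRotation n g ω φ)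

theorem zPhases_neg_add (d : ℕ) (m ζ : ℝ) (x : Fin d → ℂ) :
    zPhases d m ζ (zPhases d m (-ζ) x) = x := by
  funext j
  simp only [zPhases]
  rw [← mul_assoc, ← Complex.exp_add]
  simp

theorem phasedPulse_sectorMap {n d : ℕ} {v : ℕ → Bits n → ℂ} {α : ℕ → ℝ} {m : ℝ}
    (h : IsLadder d v α m) {g ω : ℝ} (hω : ω ≠ 0) (φ : ℝ) {x : ℝ → Fin d → ℂ}
    (hx : ∀ t, HasDerivAt x
      (-Complex.I • ((g : ℂ) • sectorMatrix d (coupling α) φ).mulVec (x t)) t) (t : ℝ) :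
    phasedPulse n g ω φ t (Core.toJoint n (sectorMap d v (x 0))) =
      Core.toJoint n (sectorMap d v (x t)) := by
  rw [phasedPulse, LinearIsometryEquiv.trans_apply, LinearIsometryEquiv.trans_apply,
    zRotation_sectorMap h g hω]
  have := evolution_of_intertwining (isBlockSymmetric_hamiltonian n g ω 1 0)
    (hamiltonian_ladder_interaction h g ω) (x := fun t => zPhases d m (-φ) (x t)) (fun t => ?_) t
  · change zRotation n g ω φ (evolution _ t (coreInclusion _)) = _
    rw [this]
    refine (zRotation_sectorMap h g hω φ _).trans ?_
    rw [zPhases_neg_add]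
  · rw [hasDerivAt_pi]
    intro i
    refine (((hasDerivAt_pi.1 (hx t) i)).const_mul _).congr_deriv ?_
    simp only [Pi.smul_apply, Matrix.smul_mulVec, smul_eq_mul]
    rw [mul_left_comm, mul_left_comm _ (g : ℂ)]
    congr 2
    simp only [Matrix.mulVec, dotProduct, Finset.mul_sum, zPhases, sectorMatrix, Matrix.of_apply]
    refine Finset.sum_congr rfl fun j _ => ?_
    rw [← mul_assoc, ← mul_assoc]
    congr 1
    simp only [Complex.ofReal_zero, zero_mul, neg_zero, Complex.exp_zero, mul_one, mul_add, add_mul,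
      mul_ite, ite_mul, mul_zero]
    congr 1
    · split_ifs with hij
      · rw [mul_left_comm, ← Complex.exp_add, hij]
        congr 2
        push_cast
        ring
      · rfl
    · split_ifs with hij
      · rw [mul_left_comm, ← Complex.exp_add, hij]
        congr 2
        push_cast
        ring
      · rfl

theorem Reachable.zRotation {n : ℕ} {g ω : ℝ} {V : JointSpace n ≃ₗᵢ[ℂ] JointSpace n} {τ : ℝ}
    (hV : Reachable g ω V τ) (ζ : ℝ) : Reachable g ω (V.trans (zRotation n g ω ζ)) τ := by
  have h := hV.propagator 0 (ζ / ω) zero_le_one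
  rwa [abs_zero, mul_zero, add_zero] at h

theorem trans_phasedPulse {n : ℕ} {g ω : ℝ} (V : JointSpace n ≃ₗᵢ[ℂ] JointSpace n) (φ t : ℝ) :
    V.trans (phasedPulse n g ω φ t) = ((V.trans (zRotation n g ω (-φ))).trans
      (propagator n g ω 1 0 t)).trans (zRotation n g ω φ) := by
  rw [phasedPulse, LinearIsometryEquiv.trans_assoc, LinearIsometryEquiv.trans_assoc]

theorem Reachable.phasedPulse {n : ℕ} {g ω : ℝ} {V : JointSpace n ≃ₗᵢ[ℂ] JointSpace n} {τ : ℝ}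
    (hV : Reachable g ω V τ) (φ : ℝ) {t : ℝ} (ht : 0 ≤ t) :
    Reachable g ω (V.trans (phasedPulse n g ω φ t)) (τ + t) := by
  rw [trans_phasedPulse]
  have h := ((hV.zRotation (-φ)).propagator 1 0 ht).zRotation φ
  rw [abs_one, mul_one] at h
  exact h

/-! ### Equatorial rotations of a qubit -/

/-- The action on `ℂ²` of the matrix of `SU(2)` with first column `(α, β)`. -/
def su2 (α β : ℂ) (p : ℂ × ℂ) : ℂ × ℂ :=
  (α * p.1 - star β * p.2, β * p.1 + star α * p.2)

/-- The equatorial rotation `c - i s (cos φ X + sin φ Y)`. -/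
def equatorial (c s φ : ℝ) (p : ℂ × ℂ) : ℂ × ℂ :=
  su2 c (-Complex.I * s * Complex.exp (φ * Complex.I)) p

/-- The `z` rotation, normalised to fix the first basis vector. -/
def azimuth (η : ℝ) (p : ℂ × ℂ) : ℂ × ℂ := (p.1, Complex.exp (η * Complex.I) * p.2)

theorem su2_su2 (α β γ δ : ℂ) (p : ℂ × ℂ) :
    su2 α β (su2 γ δ p) = su2 (α * γ - star β * δ) (β * γ + star α * δ) p := by
  ext <;> simp [su2] <;> ring

theorem star_exp_mul_I (φ : ℝ) :
    star (Complex.exp (φ * Complex.I)) = Complex.exp (-(φ * Complex.I)) := by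
  rw [Complex.star_def, ← Complex.exp_conj]
  simp

theorem exp_mul_exp_neg (φ : ℝ) :
    Complex.exp (φ * Complex.I) * Complex.exp (-(φ * Complex.I)) = 1 := by
  rw [← Complex.exp_add, add_neg_cancel, Complex.exp_zero]

theorem star_neg_I_mul_exp (s φ : ℝ) : star (-Complex.I * s * Complex.exp (φ * Complex.I)) =
    Complex.I * s * Complex.exp (-(φ * Complex.I)) := by
  rw [star_mul', star_mul', star_exp_mul_I, star_neg]
  simp

theorem equatorial_azimuth (c s φ η : ℝ) (p : ℂ × ℂ) :
    equatorial c s (φ + η) (azimuth η p) = azimuth η (equatorial c s φ p) := by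
  have h := exp_mul_exp_neg η
  ext
  · simp only [equatorial, su2, azimuth, star_neg_I_mul_exp]
    simp only [Complex.ofReal_add, add_mul, neg_add, Complex.exp_add]
    linear_combination (-Complex.I * s * Complex.exp (-(φ * Complex.I)) * p.2) * h
  · simp only [equatorial, su2, azimuth, Complex.ofReal_add, add_mul, Complex.exp_add]
    ring

theorem azimuth_one_zero (η : ℝ) : azimuth η (1, 0) = (1, 0) := by
  simp [azimuth]

theorem normSq_su2 {α β : ℂ} (h : Complex.normSq α + Complex.normSq β = 1) (p : ℂ × ℂ) :
    Complex.normSq (su2 α β p).1 + Complex.normSq (su2 α β p).2 =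
      Complex.normSq p.1 + Complex.normSq p.2 := by
  simp only [su2, Complex.normSq_apply, Complex.star_def] at h ⊢
  simp only [Complex.sub_re, Complex.mul_re, Complex.conj_re, Complex.conj_im, Complex.sub_im,
    Complex.mul_im, Complex.add_re, Complex.add_im]
  linear_combination (p.1.re * p.1.re + p.1.im * p.1.im + p.2.re * p.2.re + p.2.im * p.2.im) * h

theorem normSq_equatorial {c s : ℝ} (hcs : c ^ 2 + s ^ 2 = 1) (φ : ℝ) (p : ℂ × ℂ) :
    Complex.normSq (equatorial c s φ p).1 + Complex.normSq (equatorial c s φ p).2 =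
      Complex.normSq p.1 + Complex.normSq p.2 := by
  refine normSq_su2 ?_ p
  rw [Complex.normSq_mul, Complex.normSq_mul, Complex.normSq_neg, Complex.normSq_I,
    Complex.normSq_ofReal, Complex.normSq_ofReal, Complex.normSq_eq_norm_sq (Complex.exp _),
    Complex.norm_exp_ofReal_mul_I]
  linarith

theorem exists_phase {z w : ℂ} (h : Complex.normSq z = Complex.normSq w) :
    ∃ η : ℝ, Complex.exp (η * Complex.I) * z = w := by
  have hn : ‖z‖ = ‖w‖ := by
    rw [Complex.normSq_eq_norm_sq, Complex.normSq_eq_norm_sq] at h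
    exact (sq_eq_sq₀ (norm_nonneg _) (norm_nonneg _)).1 h
  refine ⟨Complex.arg w - Complex.arg z, ?_⟩
  have hz := Complex.norm_mul_exp_arg_mul_I z
  have hw := Complex.norm_mul_exp_arg_mul_I w
  have he : Complex.exp ((Complex.arg w - Complex.arg z : ℝ) * Complex.I) *
      Complex.exp (Complex.arg z * Complex.I) = Complex.exp (Complex.arg w * Complex.I) := by
    rw [← Complex.exp_add]
    congr 1
    push_cast
    ring
  rw [← hn] at hw
  linear_combination hw - Complex.exp ((Complex.arg w - Complex.arg z : ℝ) * Complex.I) * hz +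
    ‖z‖ * he

theorem exists_azimuth {x y y' : ℂ}
    (h : Complex.normSq x + Complex.normSq y = Complex.normSq x + Complex.normSq y') :
    ∃ η : ℝ, azimuth η (x, y) = (x, y') := by
  obtain ⟨η, hη⟩ := exists_phase (add_left_cancel h)
  exact ⟨η, by rw [azimuth, hη]⟩

section Reach

variable {c s : ℝ}

/-- Two equal equatorial rotations take the pole to the states whose first amplitude lies on a
circle. -/
theorem exists_two_rotations (hcs : c ^ 2 + s ^ 2 = 1) {x y : ℂ}
    (hxy : Complex.normSq x + Complex.normSq y = 1) (hx : ‖x - c ^ 2‖ = s ^ 2) :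
    ∃ φ₁ φ₂ : ℝ, equatorial c s φ₂ (equatorial c s φ₁ (1, 0)) = (x, y) := by
  obtain ⟨δ, hδ⟩ := exists_phase (z := (-s ^ 2 : ℂ)) (w := x - c ^ 2) (by
    rw [Complex.normSq_eq_norm_sq, Complex.normSq_eq_norm_sq, hx]
    simp)
  have h1 : (equatorial c s 0 (equatorial c s δ (1, 0))).1 = x := by
    simp [equatorial, su2]
    linear_combination hδ + s ^ 2 * Complex.exp (δ * Complex.I) * Complex.I_mul_I
  set y₀ := (equatorial c s 0 (equatorial c s δ (1, 0))).2 with hy₀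
  have h2 := (normSq_equatorial hcs 0 (equatorial c s δ (1, 0))).trans (normSq_equatorial hcs δ (1, 0))
  rw [h1, ← hy₀] at h2
  obtain ⟨η, hη⟩ := exists_azimuth (x := x) (y := y₀) (y' := y) (by rw [h2, hxy]; simp)
  refine ⟨δ + η, 0 + η, ?_⟩
  rw [← azimuth_one_zero η, equatorial_azimuth, equatorial_azimuth, ← hη]
  congr 1
  exact Prod.ext h1 rfl

theorem equatorial_inverse (hcs : c ^ 2 + s ^ 2 = 1) (φ : ℝ) (p : ℂ × ℂ) :
    equatorial c s φ (equatorial c (-s) φ p) = p := by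
  have h : ((c : ℂ) ^ 2 + (s : ℂ) ^ 2) = 1 := by exact_mod_cast hcs
  have h' := exp_mul_exp_neg φ
  ext
  · simp only [equatorial, su2, star_neg_I_mul_exp]
    simp only [Complex.star_def, Complex.conj_ofReal, Complex.ofReal_neg]
    linear_combination p.1 * h - (s : ℂ) ^ 2 * p.1 * Complex.exp (φ * Complex.I) *
      Complex.exp (-(φ * Complex.I)) * Complex.I_mul_I + (s : ℂ) ^ 2 * p.1 * h'
  · simp only [equatorial, su2, star_neg_I_mul_exp]
    simp only [Complex.star_def, Complex.conj_ofReal, Complex.ofReal_neg]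
    linear_combination p.2 * h - (s : ℂ) ^ 2 * p.2 * Complex.exp (φ * Complex.I) *
      Complex.exp (-(φ * Complex.I)) * Complex.I_mul_I + (s : ℂ) ^ 2 * p.2 * h'

/-- Three equal equatorial rotations reach the states for which the following equation holds: it says
that undoing a suitable last rotation leads to the circle of states reached by two rotations. -/
theorem exists_three_rotations (hcs : c ^ 2 + s ^ 2 = 1) (hs : 0 < s) {a b : ℂ}
    (hab : Complex.normSq a + Complex.normSq b = 1) (h : c * ‖a - c‖ = s ^ 2 + s * ‖b‖) :
    ∃ φ₁ φ₂ φ₃ : ℝ,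
      equatorial c s φ₃ (equatorial c s φ₂ (equatorial c s φ₁ (1, 0))) = (a, b) := by
  have hpos : 0 < c * ‖a - c‖ := by rw [h]; positivity
  have hne : (‖a - c‖ : ℂ) ≠ 0 := by
    intro h0
    rw [Complex.ofReal_eq_zero] at h0
    simp [h0] at hpos
  -- the last rotation is chosen to move the amplitude `c * a` straight towards `c ^ 2`
  obtain ⟨θ, hθ⟩ := exists_phase (z := Complex.I * b) (w := -(‖b‖ * ((a - c) / ‖a - c‖))) (by
    simp only [Complex.normSq_eq_norm_sq, norm_neg, norm_mul, norm_div, Complex.norm_real,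
      Complex.norm_I, norm_norm]
    rw [div_self (by exact_mod_cast hne)]
    ring)
  set q := equatorial c (-s) (-θ) (a, b) with hq
  have hq1 : q.1 = c * a + s * (Complex.exp (θ * Complex.I) * (Complex.I * b)) := by
    simp only [hq, equatorial, su2, star_neg_I_mul_exp]
    simp only [Complex.ofReal_neg, neg_mul, neg_neg]
    ring
  have hq2 : q.1 - c ^ 2 = s ^ 2 * ((a - c) / ‖a - c‖) := by
    have h' : (c : ℂ) * ‖a - c‖ = s ^ 2 + s * ‖b‖ := by exact_mod_cast h
    rw [hq1, hθ]
    field_simp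
    linear_combination (a - c) * h'
  obtain ⟨φ₁, φ₂, h12⟩ := exists_two_rotations hcs (x := q.1) (y := q.2) (by
    rw [hq, normSq_equatorial (by simpa using hcs), hab]) (by
    rw [hq2, norm_mul, norm_div, Complex.norm_real, norm_norm, div_self (by exact_mod_cast hne)]
    simp)
  refine ⟨φ₁, φ₂, -θ, ?_⟩
  rw [h12, Prod.mk.eta, hq, equatorial_inverse hcs]

/-- A symmetric sequence of seven rotations takes the pole to a prescribed state, provided that
the first amplitude of that state is represented by a suitable quadratic form. -/
theorem exists_seven_rotations_of (hcs : c ^ 2 + s ^ 2 = 1) (hs : 0 < s) {X Y a w : ℂ}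
    (hXY : Complex.normSq X + Complex.normSq Y = 1)
    (haw : Complex.normSq a + Complex.normSq w = 1) (h : c * ‖a - c‖ = s ^ 2 + s * ‖w‖)
    (hX : c * (a ^ 2 - w ^ 2) - 2 * s * a * w = X) :
    ∃ φ : Fin 7 → ℝ, (List.ofFn φ).foldl (fun p φ => equatorial c s φ p) (1, 0) = (X, Y) := by
  obtain ⟨φ₁, φ₂, φ₃, h3⟩ := exists_three_rotations hcs hs (a := a) (b := -Complex.I * star w)
    (by simpa using haw) (by simpa using h)
  -- the matrix of three rotations, and its transpose, obtained from the reversed sequence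
  have key : ∀ p, equatorial c s φ₃ (equatorial c s φ₂ (equatorial c s φ₁ p)) =
      su2 a (-Complex.I * star w) p := by
    intro p
    simp only [equatorial, su2_su2] at h3 ⊢
    have e1 := congrArg Prod.fst h3
    have e2 := congrArg Prod.snd h3
    simp only [su2, mul_one, mul_zero, sub_zero, add_zero] at e1 e2
    rw [← e1, ← e2]
  have keyT : equatorial c s (-φ₁) (equatorial c s (-φ₂) (equatorial c s (-φ₃) (1, 0))) =
      (a, -star (-Complex.I * star w)) := by
    simp only [equatorial, su2_su2] at h3 ⊢
    have e1 := congrArg Prod.fst h3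
    have e2 := congrArg Prod.snd h3
    simp only [su2, mul_one, mul_zero, sub_zero, add_zero] at e1 e2
    have hT : ∀ φ : ℝ, -Complex.I * s * Complex.exp ((-φ : ℝ) * Complex.I) =
        -star (-Complex.I * s * Complex.exp (φ * Complex.I)) := by
      intro φ
      rw [star_neg_I_mul_exp, Complex.ofReal_neg, neg_mul (φ : ℂ)]
      ring
    have hc : star (c : ℂ) = c := Complex.conj_ofReal c
    simp only [hT]
    rw [← e1, ← e2]
    simp only [su2, star_neg, star_star, star_sub, star_add, star_mul', mul_one, mul_zero,
      sub_zero, add_zero, hc]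
    ext
    · simp only []
      ring
    · simp only []
      ring
  let m := equatorial c s 0 (a, -star (-Complex.I * star w))
  have hfirst : (equatorial c s φ₃ (equatorial c s φ₂ (equatorial c s φ₁ m))).1 = X := by
    rw [key, ← hX]
    simp [m, equatorial, su2]
    linear_combination (2 * s * a * w + c * w ^ 2) * Complex.I_mul_I
  set f : ℂ × ℂ := equatorial c s φ₃ (equatorial c s φ₂ (equatorial c s φ₁ m)) with hf
  have hnorm : Complex.normSq f.1 + Complex.normSq f.2 = 1 := by
    rw [hf, normSq_equatorial hcs, normSq_equatorial hcs, normSq_equatorial hcs]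
    simp only [m]
    rw [normSq_equatorial hcs]
    simpa using haw
  obtain ⟨η, hη⟩ := exists_azimuth (x := X) (y := f.2) (y' := Y) (by
    rw [← hfirst, hnorm, hfirst, hXY])
  refine ⟨![-φ₃ + η, -φ₂ + η, -φ₁ + η, 0 + η, φ₁ + η, φ₂ + η, φ₃ + η], ?_⟩
  simp only [List.ofFn_succ, List.ofFn_zero, List.foldl_cons, List.foldl_nil]
  rw [← azimuth_one_zero η]
  change equatorial c s (φ₃ + η) (equatorial c s (φ₂ + η) (equatorial c s (φ₁ + η)
    (equatorial c s (0 + η) (equatorial c s (-φ₁ + η) (equatorial c s (-φ₂ + η)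
    (equatorial c s (-φ₃ + η) (azimuth η (1, 0)))))))) = _
  simp only [equatorial_azimuth]
  rw [keyT, ← hη, ← hfirst]

end Reach

/-! ### Seven rotations reach every state -/

/-- The estimate behind `distance_estimate`, with the trigonometric constants replaced by decimals. -/
theorem quadratic_lower_bound {M t : ℝ} (hM : 1 ≤ M) (hMt : M ^ 2 + t ^ 2 ≤ 2) :
    0.02 ≤ -0.46234 + 0.83726 * M + 0.50459 * t - 0.28117 * M ^ 2 - 0.53222 * (M * t) := by
  have h1 : 0 ≤ (M - 1) * (2 - M ^ 2 - t ^ 2) := mul_nonneg (by linarith) (by linarith)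
  have hM2 : M ≤ 3 / 2 := by nlinarith
  have ht : t ≤ 1 := by nlinarith
  have ht' : -1 ≤ t := by nlinarith
  by_cases ht0 : t ≤ 0
  · nlinarith
  · rcases le_or_gt M 1.21 with h | h
    · nlinarith [sq_nonneg (t - 1), sq_nonneg (M - t), sq_nonneg (t - 0.8), sq_nonneg (M - 1.2),
        mul_nonneg (sub_nonneg.2 hM) (sub_nonneg.2 h)]
    · nlinarith [sq_nonneg (t - 1), sq_nonneg (M - t), sq_nonneg (t - 0.7), sq_nonneg (M - 1.22)]

theorem mul_lt_and_lt {x y a a' b b' : ℝ} (ha : 0 ≤ a) (hb : 0 ≤ b) (hx : a < x) (hx' : x < a')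
    (hy : b < y) (hy' : y < b') : a * b < x * y ∧ x * y < a' * b' :=
  ⟨mul_lt_mul'' hx hy ha hb, mul_lt_mul'' hx' hy' (ha.trans hx.le) (hb.trans hy.le)⟩

/-- The half angle of the rotation by a `2π` pulse, up to a sign: `2 (π/√3 - π/2) = 2π/√3 - π`. -/
theorem half_angle_bounds :
    0.9703 < Real.cos (Real.pi * (1 / Real.sqrt 3 - 1 / 2)) ∧
    Real.cos (Real.pi * (1 / Real.sqrt 3 - 1 / 2)) < 0.9709 ∧
    0.2404 < Real.sin (Real.pi * (1 / Real.sqrt 3 - 1 / 2)) ∧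
    Real.sin (Real.pi * (1 / Real.sqrt 3 - 1 / 2)) < 0.2408 := by
  set x := Real.pi * (1 / Real.sqrt 3 - 1 / 2) with hx
  have h3 : Real.sqrt 3 * Real.sqrt 3 = 3 := Real.mul_self_sqrt (by norm_num)
  have h3l : 1.73205 < Real.sqrt 3 := Real.lt_sqrt_of_sq_lt (by norm_num)
  have h3u : Real.sqrt 3 < 1.73206 := (Real.sqrt_lt' (by norm_num)).2 (by norm_num)
  have hinv : 1 / Real.sqrt 3 = Real.sqrt 3 / 3 := by
    field_simp
    nlinarith
  have p1 := Real.pi_gt_d4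
  have p2 := Real.pi_lt_d4
  have hxb := mul_lt_and_lt (by norm_num) (by norm_num) p1 p2
    (show 0.07735 < Real.sqrt 3 / 3 - 1 / 2 by linarith)
    (show Real.sqrt 3 / 3 - 1 / 2 < 0.077354 by linarith)
  rw [← hinv, ← hx] at hxb
  have xl : 0.2429 < x := by linarith [hxb.1]
  have xu : x < 0.2431 := by linarith [hxb.2]
  have hx1 : |x| ≤ 1 := by rw [abs_le]; constructor <;> linarith
  have hc := abs_le.1 (Real.cos_bound hx1)
  have hs := abs_le.1 (Real.sin_bound hx1)
  rw [abs_of_pos (by linarith : 0 < x)] at hc hs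
  have low : ∀ k : ℕ, k ≠ 0 → 0.2429 ^ k < x ^ k := fun k hk =>
    pow_lt_pow_left₀ xl (by norm_num) hk
  have up : ∀ k : ℕ, k ≠ 0 → x ^ k < 0.2431 ^ k := fun k hk =>
    pow_lt_pow_left₀ xu (by linarith) hk
  have x2 := low 2 (by norm_num)
  have x2' := up 2 (by norm_num)
  have x3 := low 3 (by norm_num)
  have x3' := up 3 (by norm_num)
  have x4 := up 4 (by norm_num)
  have x5 := up 5 (by norm_num)
  norm_num at x2 x2' x3 x3' x4 x5
  have s1 : 0.2404 < Real.sin x := by linarith [hs.1]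
  have s2 : Real.sin x < 0.2408 := by linarith [hs.2]
  have c0 : 0 < Real.cos x := by linarith [hc.1]
  refine ⟨?_, by linarith [hc.2], s1, s2⟩
  nlinarith only [Real.sin_sq_add_cos_sq x, s1, s2, c0]

section Seven

variable {C S : ℝ}

theorem rotation_bounds (hCS : C ^ 2 + S ^ 2 = 1) (hC : 0.9703 < C) (hC' : C < 0.9709)
    (hS : 0.2404 < S) (hS' : S < 0.2408) :
    0.8840 < C ^ 2 - S ^ 2 ∧ C ^ 2 - S ^ 2 < 0.8845 ∧ 0.4665 < 2 * C * S ∧ 2 * C * S < 0.4677 := by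
  have h1 := mul_lt_and_lt (by norm_num) (by norm_num) hS hS' hS hS'
  have h2 := mul_lt_and_lt (by norm_num) (by norm_num) hC hC' hS hS'
  refine ⟨?_, ?_, ?_, ?_⟩ <;> nlinarith only [h1.1, h1.2, h2.1, h2.2, hCS]

/-- The candidate at parameter `0` is not too far from `c` to be reached by three rotations; here
`c = C² - S²` and `s = 2 C S` are the cosine and the sine of the half angle of each rotation. -/
theorem distance_estimate (hCS : C ^ 2 + S ^ 2 = 1) (hC : 0.9703 < C) (hC' : C < 0.9709)
    (hS : 0.2404 < S) (hS' : S < 0.2408) {M t : ℝ} (hM : 1 ≤ M) (hMt : M ^ 2 + t ^ 2 ≤ 2) :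
    2 * (C ^ 2 - S ^ 2) ^ 2 - (2 * C * S) ^ 2 ≤
      (C ^ 2 - S ^ 2) ^ 3 * ((C + S) * M + (C - S) * t) +
      (1 - (1 + 2 * C * S * (M ^ 2 - 1) + (C ^ 2 - S ^ 2) * (M * t)) / 2) *
        (1 + 2 * (2 * C * S) ^ 3) := by
  have hF := quadratic_lower_bound hM hMt
  have hM2 : M ≤ 1.42 := by nlinarith only [hM, hMt, sq_nonneg t]
  have ht : |t| ≤ 1 := by rw [abs_le]; constructor <;> nlinarith only [hM, hMt]
  obtain ⟨s, hs⟩ : ∃ s, s = 2 * C * S := ⟨_, rfl⟩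
  obtain ⟨c, hc⟩ : ∃ c, c = C ^ 2 - S ^ 2 := ⟨_, rfl⟩
  have hcs : c ^ 2 = 1 - s ^ 2 := by
    rw [hs, hc]
    linear_combination (C ^ 2 + S ^ 2 + 1) * hCS
  obtain ⟨c1, c2, s1, s2⟩ := rotation_bounds hCS hC hC' hS hS'
  rw [← hs] at s1 s2
  rw [← hc] at c1 c2
  rw [← hs, ← hc]
  have clow : (0.8840 : ℝ) ^ 3 < c ^ 3 := pow_lt_pow_left₀ c1 (by norm_num) (by norm_num)
  have cup : c ^ 3 < (0.8845 : ℝ) ^ 3 := pow_lt_pow_left₀ c2 (by linarith) (by norm_num)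
  have slow : ∀ k : ℕ, k ≠ 0 → 0.4665 ^ k < s ^ k := fun k hk =>
    pow_lt_pow_left₀ s1 (by norm_num) hk
  have sup : ∀ k : ℕ, k ≠ 0 → s ^ k < 0.4677 ^ k := fun k hk =>
    pow_lt_pow_left₀ s2 (by linarith) hk
  have ss1 := slow 2 (by norm_num)
  have ss2 := sup 2 (by norm_num)
  have sss1 := slow 3 (by norm_num)
  have sss2 := sup 3 (by norm_num)
  have ssss1 := slow 4 (by norm_num)
  have ssss2 := sup 4 (by norm_num)
  have t1 := abs_le.1 ht
  have m1 := mul_lt_and_lt (by norm_num) (by norm_num) clow cup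
    (show 1.2107 < C + S by linarith) (show C + S < 1.2117 by linarith)
  have m2 := mul_lt_and_lt (by norm_num) (by norm_num) clow cup
    (show 0.7295 < C - S by linarith) (show C - S < 0.7305 by linarith)
  have m3 := mul_lt_and_lt (by norm_num) (by norm_num) sss1 sss2 c1 c2
  norm_num at ss1 ss2 sss1 sss2 ssss1 ssss2 m1 m2 m3
  have A1 : |c ^ 3 * (C + S) - 0.83726| ≤ 0.002 := by
    rw [abs_le]; constructor <;> linarith [m1.1, m1.2]
  have A2 : |c ^ 3 * (C - S) - 0.50459| ≤ 0.002 := by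
    rw [abs_le]; constructor <;> linarith [m2.1, m2.2]
  have A4 : |c / 2 + s ^ 3 * c - 0.53222| ≤ 0.001 := by
    rw [abs_le]; constructor <;> linarith [m3.1, m3.2]
  have A3 : |s / 2 + s ^ 4 - 0.28117| ≤ 0.001 := by
    rw [abs_le]; constructor <;> linarith
  have A0 : |s ^ 3 + s ^ 4 - 3 / 2 + s / 2 + 3 * s ^ 2 + 0.46234| ≤ 0.004 := by
    rw [abs_le]; constructor <;> linarith
  have bound : ∀ {x y e B : ℝ}, |x| ≤ e → |y| ≤ B → -(e * B) ≤ x * y := by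
    intro x y e B hx hy
    have := mul_le_mul hx hy (abs_nonneg _) ((abs_nonneg _).trans hx)
    rw [← abs_mul] at this
    exact (abs_le.1 this).1
  have b1 := bound A1 (show |M| ≤ 1.42 by rw [abs_le]; constructor <;> linarith)
  have b2 := bound A2 ht
  have b3 := bound A3 (show |(-M ^ 2)| ≤ 2 by rw [abs_le]; constructor <;> nlinarith only [hM, hMt, sq_nonneg t])
  have b4 := bound A4 (show |-(M * t)| ≤ 1 by
    rw [abs_le]
    constructor <;> nlinarith only [hMt, sq_nonneg (M - t), sq_nonneg (M + t)])
  have b0 := (abs_le.1 A0).1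
  nlinarith only [b0, b1, b2, b3, b4, hF, hcs]

/-- If the rotation angle is close to that of a `2π` pulse, every state is reached from the pole by
seven rotations: their total angle slightly exceeds a full turn. -/
theorem exists_seven_rotations (hCS : C ^ 2 + S ^ 2 = 1) (hC : 0.9703 < C) (hC' : C < 0.9709)
    (hS : 0.2404 < S) (hS' : S < 0.2408) {X Y : ℂ}
    (hXY : Complex.normSq X + Complex.normSq Y = 1) :
    ∃ φ : Fin 7 → ℝ, (List.ofFn φ).foldl
      (fun p φ => equatorial (C ^ 2 - S ^ 2) (2 * C * S) φ p) (1, 0) = (X, Y) := by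
  obtain ⟨s, hs⟩ : ∃ s, s = 2 * C * S := ⟨_, rfl⟩
  obtain ⟨c, hc⟩ : ∃ c, c = C ^ 2 - S ^ 2 := ⟨_, rfl⟩
  have hcs : c ^ 2 + s ^ 2 = 1 := by
    rw [hs, hc]
    linear_combination (C ^ 2 + S ^ 2 + 1) * hCS
  obtain ⟨c1, -, s1, s2⟩ := rotation_bounds hCS hC hC' hS hS'
  rw [← hs] at s1 s2
  rw [← hc] at c1
  have hX : Complex.normSq X ≤ 1 := by linarith [Complex.normSq_nonneg Y]
  set r := Real.sqrt (1 - Complex.normSq X) with hr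
  have hr2 : r ^ 2 = 1 - Complex.normSq X := Real.sq_sqrt (by linarith)
  have hr0 : 0 ≤ r := Real.sqrt_nonneg _
  set M := Real.sqrt (1 + r) with hMdef
  have hM2 : M ^ 2 = 1 + r := Real.sq_sqrt (by linarith)
  have hM : 1 ≤ M := Real.one_le_sqrt.2 (by linarith)
  have hMC : (M : ℂ) ≠ 0 := by exact_mod_cast (by linarith : M ≠ 0)
  set k := X / M with hk
  have hMk : M * k = X := by rw [hk]; field_simp
  have hk2 : Complex.normSq k = 2 - M ^ 2 := by
    have h : M ^ 2 * Complex.normSq k = Complex.normSq X := by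
      rw [← hMk, Complex.normSq_mul, Complex.normSq_ofReal]
      ring
    have h2 : Complex.normSq X = M ^ 2 * (2 - M ^ 2) := by
      rw [hM2]
      linear_combination hr2
    rw [h2] at h
    exact mul_left_cancel₀ (by positivity) h
  -- `u = (m + X / m) / 2` and `v = (m - X / m) / 2` with `|m| = M` solve `u² - v² = X` on the
  -- unit sphere; `(a, w)` is obtained from `(u, v)` by a rotation diagonalising the quadratic form
  let a : ℝ → ℂ := fun μ => (C + S) / 2 * (M * Complex.exp (μ * Complex.I)) +
    (C - S) / 2 * (k * Complex.exp (-(μ * Complex.I)))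
  let w : ℝ → ℂ := fun μ => (C - S) / 2 * (M * Complex.exp (μ * Complex.I)) -
    (C + S) / 2 * (k * Complex.exp (-(μ * Complex.I)))
  have hCSC : (C : ℂ) ^ 2 + (S : ℂ) ^ 2 = 1 := by exact_mod_cast hCS
  have hparallelogram : ∀ p q : ℂ,
      Complex.normSq ((C + S) / 2 * p + (C - S) / 2 * q) +
        Complex.normSq ((C - S) / 2 * p - (C + S) / 2 * q) =
      (Complex.normSq p + Complex.normSq q) / 2 := by
    intro p q
    have e1 : ((C + S) / 2 : ℂ) = (((C + S) / 2 : ℝ) : ℂ) := by push_cast; rfl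
    have e2 : ((C - S) / 2 : ℂ) = (((C - S) / 2 : ℝ) : ℂ) := by push_cast; rfl
    rw [e1, e2]
    simp only [Complex.normSq_apply, Complex.add_re, Complex.add_im, Complex.sub_re, Complex.sub_im,
      Complex.re_ofReal_mul, Complex.im_ofReal_mul]
    linear_combination ((p.re * p.re + p.im * p.im + (q.re * q.re + q.im * q.im)) / 2) * hCS
  have haw : ∀ μ, Complex.normSq (a μ) + Complex.normSq (w μ) = 1 := by
    intro μ
    have hn : ∀ θ : ℝ, Complex.normSq (Complex.exp (θ * Complex.I)) = 1 := by
      intro θ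
      rw [Complex.normSq_eq_norm_sq, Complex.norm_exp_ofReal_mul_I, one_pow]
    have hn' := hn (-μ)
    rw [Complex.ofReal_neg, neg_mul] at hn'
    simp only [a, w]
    rw [hparallelogram, Complex.normSq_mul, Complex.normSq_mul, hn, hn', hk2, Complex.normSq_ofReal]
    ring
  have hq : ∀ μ, c * (a μ ^ 2 - w μ ^ 2) - 2 * s * a μ * w μ = X := by
    intro μ
    have he := exp_mul_exp_neg μ
    have hsC : (s : ℂ) = 2 * C * S := by rw [hs]; push_cast; rfl
    have hcC : (c : ℂ) = C ^ 2 - S ^ 2 := by rw [hc]; push_cast; rfl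
    rw [← hMk, hsC, hcC]
    simp only [a, w]
    linear_combination (M * k * (C ^ 2 + S ^ 2) ^ 2) * he + M * k * (C ^ 2 + S ^ 2 + 1) * hCSC
  let e : ℝ → ℝ := fun μ => c * ‖a μ - c‖ - s * ‖w μ‖
  have hcont : Continuous e := by
    simp only [e, a, w]
    fun_prop
  have ha0 : a 0 = (C + S) / 2 * M + (C - S) / 2 * k := by simp [a]
  have hw0 : ∀ μ, Complex.normSq (w μ) = 1 - Complex.normSq (a μ) := fun μ => by
    linarith [haw μ]
  have hre : (a 0).re = (C + S) / 2 * M + (C - S) / 2 * k.re := by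
    rw [ha0]
    simp
  have hkre : k.re ^ 2 ≤ Complex.normSq k := by
    rw [Complex.normSq_apply]
    nlinarith only [sq_nonneg k.im]
  have hlow : e 0 ≤ s ^ 2 := by
    have hest := distance_estimate hCS hC hC' hS hS' hM (t := k.re) (by linarith)
    have hna : Complex.normSq (a 0) = (1 + s * (M ^ 2 - 1) + c * (M * k.re)) / 2 := by
      have h1 : Complex.normSq (a 0) = ((C + S) / 2) ^ 2 * M ^ 2 +
          ((C - S) / 2) ^ 2 * Complex.normSq k + 2 * ((C + S) / 2) * ((C - S) / 2) * M * k.re := by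
        rw [Complex.normSq_apply, Complex.normSq_apply, hre, ha0]
        simp
        ring
      rw [h1, hk2, hs, hc]
      linear_combination hCS / 2
    have hd : ‖a 0 - c‖ ^ 2 = Complex.normSq (a 0) - 2 * c * (a 0).re + c ^ 2 := by
      rw [← Complex.normSq_eq_norm_sq, Complex.normSq_apply, Complex.normSq_apply]
      simp
      ring
    have hw : ‖w 0‖ ^ 2 = 1 - Complex.normSq (a 0) := by
      rw [← Complex.normSq_eq_norm_sq, hw0]
    have hw1 : ‖w 0‖ ^ 2 ≤ ‖w 0‖ := by
      have : ‖w 0‖ ^ 2 ≤ 1 := by rw [hw]; linarith [Complex.normSq_nonneg (a 0)]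
      nlinarith only [norm_nonneg (w 0), this]
    have hsq : (c * ‖a 0 - c‖) ^ 2 ≤ (s ^ 2 + s * ‖w 0‖) ^ 2 := by
      rw [← hs, ← hc, ← hna, ← hw] at hest
      rw [mul_pow, hd]
      have hs3 : 0 ≤ s ^ 3 := by positivity
      have h4 := mul_le_mul_of_nonneg_left hw1 hs3
      have hc2 : c ^ 2 = 1 - s ^ 2 := by linarith
      have hgoal : (s ^ 2 + s * ‖w 0‖) ^ 2 - c ^ 2 * (Complex.normSq (a 0) - 2 * c * (a 0).re + c ^ 2)
          = 2 * (s ^ 3 * ‖w 0‖ - s ^ 3 * ‖w 0‖ ^ 2) +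
          (c ^ 3 * ((C + S) * M + (C - S) * k.re) + ‖w 0‖ ^ 2 * (1 + 2 * s ^ 3) -
            (2 * c ^ 2 - s ^ 2)) := by
        have : Complex.normSq (a 0) = 1 - ‖w 0‖ ^ 2 := by linarith
        rw [this, hre]
        linear_combination (‖w 0‖ ^ 2 + s ^ 2 - c ^ 2 + 1 - 1) * hcs
      linarith
    have := abs_le_of_sq_le_sq hsq (by positivity)
    simp only [e]
    linarith [(abs_le.1 this).2]
  have hhigh : s ^ 2 ≤ e Real.pi := by
    have hpi : a Real.pi = -a 0 := by
      simp only [a, Complex.exp_neg, Complex.exp_pi_mul_I]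
      simp
      ring
    have hpos : 0 ≤ (a 0).re := by
      rw [hre]
      have hk1 : -1 ≤ k.re := by nlinarith only [hkre, hk2, hM]
      have h1 : 0 ≤ (C - S) / 2 * (k.re + 1) := mul_nonneg (by linarith) (by linarith)
      have h2 : 0 ≤ (C + S) / 2 * (M - 1) := mul_nonneg (by linarith) (by linarith)
      linarith
    have h1 : c ≤ ‖a Real.pi - c‖ := by
      have := Complex.abs_re_le_norm (a Real.pi - c)
      rw [hpi] at this ⊢
      simp only [Complex.sub_re, Complex.neg_re, Complex.ofReal_re] at this
      have h2 := neg_le_abs (-(a 0).re - c)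
      linarith
    have h2 : ‖w Real.pi‖ ≤ 1 := by
      have : ‖w Real.pi‖ ^ 2 ≤ 1 := by
        rw [← Complex.normSq_eq_norm_sq]
        linarith [haw Real.pi, Complex.normSq_nonneg (a Real.pi)]
      nlinarith only [norm_nonneg (w Real.pi), this]
    have h3 := mul_le_mul_of_nonneg_left h1 (by linarith : 0 ≤ c)
    have h4 := mul_le_mul_of_nonneg_left h2 (by linarith : 0 ≤ s)
    simp only [e]
    nlinarith only [h3, h4, s1, s2, hcs]
  obtain ⟨μ, hμ⟩ := mem_range_of_exists_le_of_exists_ge hcont ⟨0, hlow⟩ ⟨Real.pi, hhigh⟩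
  rw [← hs, ← hc]
  refine exists_seven_rotations_of hcs (by linarith) hXY (haw μ) ?_ (hq μ)
  simp only [e] at hμ
  linarith

end Seven

/-! ### Four reflections of a qutrit -/

/-- The action of a `π` pulse of phase `f / 2` on the amplitudes of the two outer states of a sector
with three levels: a reflection. -/
def reflection (f : ℝ) (q : ℂ × ℂ) : ℂ × ℂ :=
  (1 / 3 * q.1 - (2 * Real.sqrt 2 / 3 : ℝ) * Complex.exp (-(f * Complex.I)) * q.2,
    -(2 * Real.sqrt 2 / 3 : ℝ) * Complex.exp (f * Complex.I) * q.1 - 1 / 3 * q.2)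

/-- Any phase of the first state is produced by four reflections. -/
theorem exists_four_reflections (ν : ℝ) : ∃ f₁ f₂ f₃ f₄ : ℝ,
    reflection f₄ (reflection f₃ (reflection f₂ (reflection f₁ (1, 0)))) =
      (Complex.exp (ν * Complex.I) * Complex.exp (ν * Complex.I), 0) := by
  -- `δ` is chosen so that `1 + 8 exp (i δ)` is a real multiple of `exp (i ν)`
  set δ := ν + Real.arcsin (Real.sin ν / 8) with hδ
  set E := Complex.exp (ν * Complex.I) with hE
  set E' := Complex.exp (-(ν * Complex.I)) with hE'
  set z := Complex.exp (δ * Complex.I) with hz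
  set z' := Complex.exp (-(δ * Complex.I)) with hz'
  have hEE : E * E' = 1 := exp_mul_exp_neg ν
  have hzz : z * z' = 1 := exp_mul_exp_neg δ
  obtain ⟨ρ, hρ⟩ : ∃ ρ : ℝ, (1 + 8 * z) / 9 = ρ * E := by
    have him : ((1 + 8 * z) * E').im = 0 := by
      have h1 : (1 + 8 * z) * E' = Complex.exp ((-ν : ℝ) * Complex.I) +
          (8 : ℝ) * Complex.exp ((Real.arcsin (Real.sin ν / 8) : ℝ) * Complex.I) := by
        rw [add_mul, mul_assoc, hz, hE', ← Complex.exp_add, hδ]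
        push_cast
        rw [one_mul, neg_mul]
        congr 3
        ring
      rw [h1, Complex.add_im, Complex.im_ofReal_mul, Complex.exp_ofReal_mul_I_im,
        Complex.exp_ofReal_mul_I_im, Real.sin_neg, Real.sin_arcsin]
      · ring
      · linarith [Real.neg_one_le_sin ν]
      · linarith [Real.sin_le_one ν]
    refine ⟨((1 + 8 * z) * E').re / 9, ?_⟩
    have h2 : ((((1 + 8 * z) * E').re : ℝ) : ℂ) = (1 + 8 * z) * E' :=
      Complex.ext (by simp) (by simpa using him.symm)
    rw [Complex.ofReal_div, h2]
    push_cast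
    linear_combination (-(1 + 8 * z) / 9) * hEE
  have hρ' : (1 + 8 * z') / 9 = ρ * E' := by
    have h := congrArg star hρ
    rw [star_mul', hE, star_exp_mul_I, star_div₀, star_add, star_mul', hz, star_exp_mul_I] at h
    simpa using h
  have e3 : Complex.exp ((δ - 2 * ν + Real.pi : ℝ) * Complex.I) = -(z * (E' * E')) := by
    rw [hz, hE', ← Complex.exp_add, ← Complex.exp_add, ← Complex.exp_add_pi_mul_I]
    congr 1
    push_cast
    ring
  have e3' : Complex.exp (-((δ - 2 * ν + Real.pi : ℝ) * Complex.I)) = -(z' * (E * E)) := by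
    rw [hz', hE, ← Complex.exp_add, ← Complex.exp_add, ← Complex.exp_sub_pi_mul_I]
    congr 1
    push_cast
    ring
  have e4 : Complex.exp ((-2 * ν + Real.pi : ℝ) * Complex.I) = -(E' * E') := by
    rw [hE', ← Complex.exp_add, ← Complex.exp_add_pi_mul_I]
    congr 1
    push_cast
    ring
  have e4' : Complex.exp (-((-2 * ν + Real.pi : ℝ) * Complex.I)) = -(E * E) := by
    rw [hE, ← Complex.exp_add, ← Complex.exp_sub_pi_mul_I]
    congr 1
    push_cast
    ring
  obtain ⟨k, hk⟩ : ∃ k : ℂ, k = (2 * Real.sqrt 2 / 3 : ℝ) := ⟨_, rfl⟩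
  have hk2 : k * k = 8 / 9 := by
    have h2 : Real.sqrt 2 * Real.sqrt 2 = 2 := Real.mul_self_sqrt (by norm_num)
    rw [hk, ← Complex.ofReal_mul]
    have : 2 * Real.sqrt 2 / 3 * (2 * Real.sqrt 2 / 3) = 8 / 9 := by linear_combination 4 / 9 * h2
    rw [this]
    push_cast
    rfl
  refine ⟨δ, 0, δ - 2 * ν + Real.pi, -2 * ν + Real.pi, ?_⟩
  have q2 : reflection 0 (reflection δ (1, 0)) = (ρ * E, k * (z - 1) / 3) := by
    simp only [reflection, ← hk, ← hz, Complex.ofReal_zero, zero_mul, neg_zero, Complex.exp_zero]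
    ext
    · linear_combination hρ + z * hk2
    · simp only []
      ring
  have q3 : reflection (δ - 2 * ν + Real.pi) (ρ * E, k * (z - 1) / 3) =
      (ρ * E / 3 + 8 / 27 * (1 - z') * E ^ 2, k * (z * E' * ρ - (z - 1) / 9)) := by
    simp only [reflection, ← hk, e3, e3']
    ext
    · linear_combination z' * E ^ 2 * (z - 1) / 3 * hk2 + 8 / 27 * E ^ 2 * hzz
    · linear_combination k * z * E' * ρ * hEE
  rw [q2, q3]
  simp only [reflection, ← hk, e4, e4']
  ext
  · linear_combination E ^ 2 * (z * E' * ρ - (z - 1) / 9) * hk2 + 8 / 9 * z * ρ * E * hEE +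
      ρ * E * hρ - ρ ^ 2 * E ^ 2 * hEE - E ^ 2 * ((1 + 8 * z') / 9) * hρ - E ^ 2 * ρ * E * hρ' +
      64 / 81 * E ^ 2 * hzz
  · linear_combination k * ρ * E' / 3 * hEE + 8 / 27 * k * (1 - z') * (E * E' + 1) * hEE -
      k / 3 * (1 - z) * hρ' - 8 / 27 * k * hzz

/-! ### Collective operators on basis states -/

theorem Jminus_mulVec_single {n : ℕ} (s : Bits n) :
    (Jminus n).mulVec (Pi.single s 1) =
      ∑ i, if s i = 0 then Pi.single (Function.update s i 1) (1 : ℂ) else 0 := by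
  ext t
  rw [Matrix.mulVec_single_one, Matrix.col_apply, Jminus_eq, Matrix.sum_apply, Finset.sum_apply]
  refine Finset.sum_congr rfl fun i _ => ?_
  have hiff : t = Function.update s i 1 ↔ (∀ k, k ≠ i → t k = s k) ∧ t i = 1 := by
    constructor
    · rintro rfl
      exact ⟨fun k hk => Function.update_of_ne hk _ _, Function.update_self _ _ _⟩
    · rintro ⟨h1, h2⟩
      funext k
      by_cases hk : k = i
      · subst hk; rw [h2, Function.update_self]
      · rw [h1 k hk, Function.update_of_ne hk]
  rw [apply_ite (fun f : Bits n → ℂ => f t)]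
  simp only [onQubit, Matrix.of_apply, Pi.single_apply, hiff, Pi.zero_apply]
  generalize s i = a
  generalize t i = b
  by_cases h : ∀ k, k ≠ i → t k = s k
  · simp only [eq_true h, true_and, if_true]
    fin_cases a <;> fin_cases b <;> simp [lower]
  · simp [h]

theorem Jplus_mulVec_single {n : ℕ} (s : Bits n) :
    (Jplus n).mulVec (Pi.single s 1) =
      ∑ i, if s i = 1 then Pi.single (Function.update s i 0) (1 : ℂ) else 0 := by
  ext t
  rw [Matrix.mulVec_single_one, Matrix.col_apply, Jplus_eq, Matrix.sum_apply, Finset.sum_apply]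
  refine Finset.sum_congr rfl fun i _ => ?_
  have hiff : t = Function.update s i 0 ↔ (∀ k, k ≠ i → t k = s k) ∧ t i = 0 := by
    constructor
    · rintro rfl
      exact ⟨fun k hk => Function.update_of_ne hk _ _, Function.update_self _ _ _⟩
    · rintro ⟨h1, h2⟩
      funext k
      by_cases hk : k = i
      · subst hk; rw [h2, Function.update_self]
      · rw [h1 k hk, Function.update_of_ne hk]
  rw [apply_ite (fun f : Bits n → ℂ => f t)]
  simp only [onQubit, Matrix.of_apply, Pi.single_apply, hiff, Pi.zero_apply]
  generalize s i = a
  generalize t i = b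
  by_cases h : ∀ k, k ≠ i → t k = s k
  · simp only [eq_true h, true_and, if_true]
    fin_cases a <;> fin_cases b <;> simp [raise]
  · simp [h]

theorem Jz_mulVec_single {n : ℕ} (s : Bits n) :
    (Jz n).mulVec (Pi.single s 1) =
      ((1 / 2 : ℂ) * ∑ i, if s i = 0 then 1 else -1) • Pi.single s (1 : ℂ) := by
  ext t
  rw [Matrix.mulVec_single_one, Matrix.col_apply, Jz_apply, Pi.smul_apply, Pi.single_apply]
  split_ifs with h
  · rw [h]; simp
  · simp

theorem IsLadder.tail {n d : ℕ} {v : ℕ → Bits n → ℂ} {α : ℕ → ℝ} {m : ℝ}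
    (h : IsLadder (d + 1) v α m) :
    IsLadder d (fun j => v (j + 1)) (fun j => α (j + 1)) (m - 1) where
  zero j hj := h.zero _ (by omega)
  down j := h.down (j + 1)
  up j hj := h.up (j + 1) (by omega)
  weight j := by
    rw [h.weight (j + 1)]
    push_cast
    congr 1
    ring

/-! ### Permutation-invariant unitaries -/

theorem PermInvariant.apply_comp {n : ℕ} {U : QubitOp n} (hU : PermInvariant U)
    (π : Equiv.Perm (Fin n)) (s t : Bits n) : U (fun k => s (π k)) (fun k => t (π k)) = U s t := by
  have h := congrFun (congrFun (hU π).eq s) (fun k => t (π k))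
  simp only [Matrix.mul_apply, permOp, Matrix.of_apply] at h
  rw [Finset.sum_eq_single t, Finset.sum_eq_single (fun k => s (π k))] at h
  · simpa using h.symm
  · intro r _ hr
    rw [if_neg, zero_mul]
    rintro rfl
    exact hr (by simp)
  · simp
  · intro r _ hr
    rw [if_neg, mul_zero]
    rintro rfl
    exact hr (by simp)
  · simp

theorem apply_eq_zero_of_commute_sumZ {n : ℕ} {U : QubitOp n} (hU : Commute U (sumZ n))
    {s t : Bits n} (hst : (∑ i, if s i = 0 then (1 : ℂ) else -1) ≠ ∑ i, if t i = 0 then 1 else -1) :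
    U s t = 0 := by
  have hz : sumZ n = Matrix.diagonal fun s => ∑ i, if s i = 0 then (1 : ℂ) else -1 := by
    have : sumZ n = (2 : ℂ) • Jz n := by simp [sumZ, Jz, smul_smul]
    rw [this]
    ext s t
    rw [Matrix.smul_apply, Jz_apply, Matrix.diagonal_apply]
    split_ifs <;> simp
  have h := congrFun (congrFun hU.eq s) t
  rw [hz, Matrix.mul_diagonal, Matrix.diagonal_mul] at h
  have h2 : ((∑ i, if s i = 0 then (1 : ℂ) else -1) - ∑ i, if t i = 0 then 1 else -1) * U s t = 0 := by
    linear_combination -h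
  exact (mul_eq_zero.1 h2).resolve_left (sub_ne_zero.2 hst)

theorem norm_eq_one_of_mulVec_eq_smul {n : ℕ} {U : QubitOp n}
    (hU : U ∈ Matrix.unitaryGroup (Bits n) ℂ) {v : Bits n → ℂ} (hv : v ≠ 0) {u : ℂ}
    (h : U.mulVec v = u • v) : ‖u‖ = 1 := by
  have h1 := sum_norm_sq_mulVec hU v
  rw [h] at h1
  simp only [Pi.smul_apply, norm_smul, mul_pow, ← Finset.mul_sum] at h1
  have h2 : ∑ i, ‖v i‖ ^ 2 ≠ 0 := by
    intro h0
    rw [Finset.sum_eq_zero_iff_of_nonneg (fun _ _ => by positivity)] at h0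
    exact hv (funext fun i => by simpa using h0 i (Finset.mem_univ i))
  have h3 : ‖u‖ ^ 2 = 1 := mul_right_cancel₀ h2 (by rw [h1, one_mul])
  exact (pow_eq_one_iff_of_nonneg (norm_nonneg _) two_ne_zero).1 h3

theorem exists_exp_eq {u : ℂ} (hu : ‖u‖ = 1) : ∃ θ : ℝ, Complex.exp (θ * Complex.I) = u := by
  refine ⟨Complex.arg u, ?_⟩
  have := Complex.norm_mul_exp_arg_mul_I u
  rwa [hu, Complex.ofReal_one, one_mul] at this

/-- A unitary is realized as soon as the evolution has the right effect on vectors spanning the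
qubit space. -/
theorem realizable_of_spanning {n : ℕ} {g ω : ℝ} {U : QubitOp n}
    {V : JointSpace n ≃ₗᵢ[ℂ] JointSpace n} {τ : ℝ} (hV : Reachable g ω V τ) (α : ℝ)
    {s : Set (Bits n → ℂ)} (hs : Submodule.span ℂ s = ⊤)
    (h : ∀ ψ ∈ s, Complex.exp (α * Complex.I) • V (Core.toJoint n (ket ψ 0)) =
      Core.toJoint n (ket (U.mulVec ψ) 0)) : RealizableInTime g ω U τ := by
  refine RealizableInTime.of_reachable hV α fun ψ => ?_
  have hψ : ψ ∈ Submodule.span ℂ s := hs ▸ Submodule.mem_top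
  induction hψ using Submodule.span_induction with
  | mem x hx => exact h x hx
  | zero => simp [ket_zero]
  | add x y _ _ hx hy =>
    rw [ket_add, map_add, map_add, smul_add, hx, hy, Matrix.mulVec_add, ket_add, map_add]
  | smul c x _ hx =>
    rw [ket_smul, map_smul, map_smul, smul_comm, hx, Matrix.mulVec_smul, ket_smul, map_smul]

theorem span_eq_top_of_single {n : ℕ} {s : Set (Bits n → ℂ)}
    (h : ∀ b, Pi.single b 1 ∈ Submodule.span ℂ s) : Submodule.span ℂ s = ⊤ := by
  rw [eq_top_iff, ← (Pi.basisFun ℂ (Bits n)).span_eq, Submodule.span_le]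
  rintro _ ⟨b, rfl⟩
  rw [Pi.basisFun_apply]
  exact h b

/-! ### Pulses in small sectors -/

theorem sectorMap_vacuum {n d : ℕ} (v : ℕ → Bits n → ℂ) (c : ℂ) :
    sectorMap (d + 1) v (Pi.single 0 c) = c • ket (v 0) 0 := by
  rw [sectorMap_eq, Finset.sum_eq_single 0]
  · simp
  · intro j _ hj
    rw [Pi.single_eq_of_ne hj, zero_smul]
  · simp

/-- A pulse in a sector where the interaction has the spectrum `{0, l, -l}`. -/
theorem phasedPulse_of_cube {n d : ℕ} {v : ℕ → Bits n → ℂ} {α : ℕ → ℝ} {m : ℝ}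
    (h : IsLadder d v α m) {g ω : ℝ} (hω : ω ≠ 0) {φ l : ℝ} (hl : l ≠ 0)
    {M : Matrix (Fin d) (Fin d) ℂ} (hM : M = sectorMatrix d (coupling α) φ)
    (hM3 : ∀ x, M.mulVec (M.mulVec (M.mulVec x)) = ((l ^ 2 : ℝ) : ℂ) • M.mulVec x)
    (y : Fin d → ℂ) (t : ℝ) :
    phasedPulse n g ω φ t (Core.toJoint n (sectorMap d v y)) =
      Core.toJoint n (sectorMap d v (y + ((-Complex.I * (Real.sin (l * (g * t)) / l : ℝ)) • M.mulVec y +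
        (((Real.cos (l * (g * t)) - 1) / l ^ 2 : ℝ) : ℂ) • M.mulVec (M.mulVec y)))) := by
  have hx := phasedPulse_sectorMap h hω φ (g := g)
    (x := fun t => y + ((-Complex.I * (Real.sin (l * (g * t)) / l : ℝ)) • M.mulVec y +
        (((Real.cos (l * (g * t)) - 1) / l ^ 2 : ℝ) : ℂ) • M.mulVec (M.mulVec y))) (fun t => ?_) t
  · simpa using hx
  · have h0 : HasDerivAt (fun t => l * (g * t)) (l * g) t := by
      simpa using ((hasDerivAt_id t).const_mul g).const_mul l
    have h1 : HasDerivAt (fun t => -Complex.I * ((Real.sin (l * (g * t)) / l : ℝ) : ℂ))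
        (-Complex.I * ((g * Real.cos (l * (g * t)) : ℝ) : ℂ)) t := by
      refine (HasDerivAt.ofReal_comp ((h0.sin.div_const l).congr_deriv ?_)).const_mul _
      field_simp
    have h2 : HasDerivAt (fun t => (((Real.cos (l * (g * t)) - 1) / l ^ 2 : ℝ) : ℂ))
        ((-g * Real.sin (l * (g * t)) / l : ℝ) : ℂ) t := by
      refine HasDerivAt.ofReal_comp (((h0.cos.sub_const 1).div_const (l ^ 2)).congr_deriv ?_)
      field_simp
    refine (((h1.smul_const (M.mulVec y)).fun_add
      (h2.smul_const (M.mulVec (M.mulVec y)))).const_add y).congr_deriv ?_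
    rw [← hM]
    simp only [Matrix.smul_mulVec, Matrix.mulVec_add, Matrix.mulVec_smul, hM3]
    ext j
    simp only [Pi.add_apply, Pi.smul_apply, smul_eq_mul]
    have hlC : (l : ℂ) ≠ 0 := by exact_mod_cast hl
    push_cast
    generalize Complex.sin (l * (g * t)) = σ
    generalize Complex.cos (l * (g * t)) = γ
    field_simp
    linear_combination (-(g * σ * M.mulVec (M.mulVec y) j)) * Complex.I_mul_I

theorem phasedPulse_singleton {n : ℕ} {v : ℕ → Bits n → ℂ} {α : ℕ → ℝ} {m : ℝ}
    (h : IsLadder 1 v α m) {g ω : ℝ} (hω : ω ≠ 0) (φ t : ℝ) :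
    phasedPulse n g ω φ t (Core.toJoint n (ket (v 0) 0)) = Core.toJoint n (ket (v 0) 0) := by
  have hx := phasedPulse_sectorMap h hω φ (g := g) (x := fun _ => Pi.single 0 1) (fun t => ?_) t
  · simpa [sectorMap_vacuum] using hx
  · have : sectorMatrix 1 (coupling α) φ = 0 := by
      ext i j
      simp [sectorMatrix]
    rw [this, smul_zero, Matrix.zero_mulVec, smul_zero]
    exact hasDerivAt_const t _

theorem zRotation_ket {n d : ℕ} {v : ℕ → Bits n → ℂ} {α : ℕ → ℝ} {m : ℝ}
    (h : IsLadder (d + 1) v α m) (g : ℝ) {ω : ℝ} (hω : ω ≠ 0) (ζ : ℝ) :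
    zRotation n g ω ζ (Core.toJoint n (ket (v 0) 0)) =
      Complex.exp (-((ζ * m : ℝ) * Complex.I)) • Core.toJoint n (ket (v 0) 0) := by
  have := zRotation_sectorMap h g hω ζ (Pi.single 0 1)
  have h2 : zPhases (d + 1) m ζ (Pi.single 0 1) =
      Pi.single 0 (Complex.exp (-((ζ * m : ℝ) * Complex.I))) := by
    funext j
    by_cases hj : j = 0
    · subst hj; simp [zPhases]
    · simp [zPhases, Pi.single_eq_of_ne hj]
  rw [h2, sectorMap_vacuum, sectorMap_vacuum] at this
  simpa using this

/-- The effect of a pulse in a sector with two levels: an equatorial rotation. -/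
theorem phasedPulse_two {n : ℕ} {v : ℕ → Bits n → ℂ} {α : ℕ → ℝ} {m : ℝ}
    (h : IsLadder 2 v α m) {g ω : ℝ} (hω : ω ≠ 0) (hα : α 0 ≠ 0) (φ t : ℝ) (p : ℂ × ℂ) :
    phasedPulse n g ω φ t (Core.toJoint n (sectorMap 2 v ![p.1, p.2])) =
      Core.toJoint n (sectorMap 2 v
        ![(equatorial (Real.cos (α 0 * (g * t))) (Real.sin (α 0 * (g * t))) φ p).1,
          (equatorial (Real.cos (α 0 * (g * t))) (Real.sin (α 0 * (g * t))) φ p).2]) := by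
  have he := exp_mul_exp_neg φ
  set e := Complex.exp (φ * Complex.I) with hee
  set e' := Complex.exp (-(φ * Complex.I)) with hee'
  have hM : !![0, (α 0 : ℂ) * e'; (α 0 : ℂ) * e, 0] = sectorMatrix 2 (coupling α) φ := by
    ext i j
    fin_cases i <;> fin_cases j <;> simp [sectorMatrix, coupling, e, e']
  have hv : ∀ x y : ℂ, (!![0, (α 0 : ℂ) * e'; (α 0 : ℂ) * e, 0]).mulVec ![x, y] =
      ![α 0 * e' * y, α 0 * e * x] := by
    intro x y
    ext i
    fin_cases i <;> simp [Matrix.mulVec, dotProduct]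
  have hx2 : ∀ x : Fin 2 → ℂ, x = ![x 0, x 1] := fun x => by
    ext i
    fin_cases i <;> rfl
  rw [phasedPulse_of_cube h hω hα hM]
  · congr 2
    rw [hv, hv]
    have hα' : (α 0 : ℂ) ≠ 0 := by exact_mod_cast hα
    ext i
    fin_cases i
    · simp only [equatorial, su2, star_neg_I_mul_exp, ← hee', Pi.add_apply, Pi.smul_apply, smul_eq_mul,
        Fin.zero_eta, Matrix.cons_val_zero]
      push_cast
      generalize Complex.sin (α 0 * (g * t)) = σ
      generalize Complex.cos (α 0 * (g * t)) = γ
      field_simp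
      linear_combination (γ - 1) * p.1 * he
    · simp only [equatorial, su2, ← hee, Pi.add_apply, Pi.smul_apply, smul_eq_mul,
        Fin.mk_one, Matrix.cons_val_one, Complex.star_def, Complex.conj_ofReal]
      push_cast
      generalize Complex.sin (α 0 * (g * t)) = σ
      generalize Complex.cos (α 0 * (g * t)) = γ
      field_simp
      linear_combination (γ - 1) * p.2 * he
  · intro x
    rw [hx2 x, hv, hv, hv]
    ext i
    fin_cases i
    · simp
      linear_combination (α 0 : ℂ) ^ 3 * e' * x 1 * he
    · simp
      linear_combination (α 0 : ℂ) ^ 3 * e * x 0 * he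

/-! ### Two qubits -/

/-- The triplet states. -/
def triplet : ℕ → Bits 2 → ℂ
  | 0 => Pi.single ![0, 0] 1
  | 1 => ((1 / Real.sqrt 2 : ℝ) : ℂ) • (Pi.single ![0, 1] 1 + Pi.single ![1, 0] 1)
  | 2 => Pi.single ![1, 1] 1
  | _ => 0

/-- The singlet state, not normalised. -/
def singlet : ℕ → Bits 2 → ℂ
  | 0 => Pi.single ![0, 1] 1 - Pi.single ![1, 0] 1
  | _ => 0

theorem update_zero_two (a b c : Fin 2) : Function.update ![a, b] 0 c = ![c, b] := by
  ext i; fin_cases i <;> rfl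

theorem update_one_two (a b c : Fin 2) : Function.update ![a, b] 1 c = ![a, c] := by
  ext i; fin_cases i <;> rfl

theorem isLadder_triplet : IsLadder 3 triplet (fun _ => Real.sqrt 2) 1 where
  zero j hj := by
    obtain ⟨k, rfl⟩ : ∃ k, j = k + 3 := ⟨j - 3, by omega⟩
    rfl
  down j := by
    have h2 : (Real.sqrt 2 : ℂ) * (Real.sqrt 2 : ℂ) = 2 := by
      exact_mod_cast Real.mul_self_sqrt (by norm_num : (0 : ℝ) ≤ 2)
    have h0 : (Real.sqrt 2 : ℂ) ≠ 0 := by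
      intro h; rw [h] at h2; norm_num at h2
    match j with
    | 0 =>
      simp only [triplet, Jminus_mulVec_single, Fin.sum_univ_two, update_zero_two, update_one_two]
      simp [smul_smul, h0, add_comm]
    | 1 =>
      simp only [triplet, Matrix.mulVec_smul, Matrix.mulVec_add, Jminus_mulVec_single,
        Fin.sum_univ_two, update_zero_two, update_one_two]
      simp only [Matrix.cons_val_zero, Matrix.cons_val_one, if_true, one_ne_zero, if_false, add_zero,
        zero_add]
      rw [← two_smul ℂ, smul_smul]
      congr 1
      push_cast
      field_simp
      linear_combination -h2
    | 2 =>
      simp only [triplet, Jminus_mulVec_single, Fin.sum_univ_two]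
      simp
    | k + 3 => simp [triplet]
  up j hj := by
    have h2 : (Real.sqrt 2 : ℂ) * (Real.sqrt 2 : ℂ) = 2 := by
      exact_mod_cast Real.mul_self_sqrt (by norm_num : (0 : ℝ) ≤ 2)
    have h0 : (Real.sqrt 2 : ℂ) ≠ 0 := by
      intro h; rw [h] at h2; norm_num at h2
    match j with
    | 0 =>
      simp only [triplet, Matrix.mulVec_smul, Matrix.mulVec_add, Jplus_mulVec_single,
        Fin.sum_univ_two, update_zero_two, update_one_two]
      simp only [Matrix.cons_val_zero, Matrix.cons_val_one, if_true, zero_ne_one, if_false, add_zero,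
        zero_add]
      rw [← two_smul ℂ, smul_smul]
      congr 1
      push_cast
      field_simp
      linear_combination -h2
    | 1 =>
      simp only [triplet, Jplus_mulVec_single, Fin.sum_univ_two, update_zero_two, update_one_two]
      simp [smul_smul, h0]
    | k + 2 => omega
  weight j := by
    match j with
    | 0 =>
      simp only [triplet, Jz_mulVec_single, Fin.sum_univ_two]
      norm_num
    | 1 =>
      simp only [triplet, Jz_mulVec_single, Fin.sum_univ_two, Matrix.mulVec_smul, Matrix.mulVec_add]
      norm_num
    | 2 =>
      simp only [triplet, Jz_mulVec_single, Fin.sum_univ_two]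
      norm_num
    | k + 3 => simp [triplet]

theorem isLadder_singlet : IsLadder 1 singlet (fun _ => 0) 0 where
  zero j hj := by
    obtain ⟨k, rfl⟩ : ∃ k, j = k + 1 := ⟨j - 1, by omega⟩
    rfl
  down j := by
    match j with
    | 0 =>
      simp only [singlet, Matrix.mulVec_sub, Jminus_mulVec_single, Fin.sum_univ_two, update_zero_two,
        update_one_two]
      simp
    | k + 1 => simp [singlet]
  up j hj := by omega
  weight j := by
    match j with
    | 0 =>
      simp only [singlet, Jz_mulVec_single, Fin.sum_univ_two, Matrix.mulVec_sub]
      norm_num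
    | k + 1 => simp [singlet]

section Pulses

variable {g ω : ℝ}

/-- The effect of a pulse in the three-level sector of two qubits. -/
theorem phasedPulse_triplet (hω : ω ≠ 0) (φ t : ℝ) (q : ℂ × ℂ)
    (ht : Real.sin (Real.sqrt 6 * (g * t)) = 0) :
    phasedPulse 2 g ω φ t (Core.toJoint 2 (sectorMap 3 triplet ![q.1, 0, q.2])) =
      Core.toJoint 2 (sectorMap 3 triplet
        ![q.1 + (Real.cos (Real.sqrt 6 * (g * t)) - 1) / 2 * (q.1 - (reflection (2 * φ) q).1),
          0, q.2 + (Real.cos (Real.sqrt 6 * (g * t)) - 1) / 2 * (q.2 - (reflection (2 * φ) q).2)]) := by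
  have he := exp_mul_exp_neg φ
  have hf : Complex.exp ((2 * φ : ℝ) * Complex.I) =
      Complex.exp (φ * Complex.I) * Complex.exp (φ * Complex.I) := by
    rw [← Complex.exp_add]
    congr 1
    push_cast
    ring
  have hf' : Complex.exp (-((2 * φ : ℝ) * Complex.I)) =
      Complex.exp (-(φ * Complex.I)) * Complex.exp (-(φ * Complex.I)) := by
    rw [← Complex.exp_add]
    congr 1
    push_cast
    ring
  set e := Complex.exp (φ * Complex.I) with hee
  set e' := Complex.exp (-(φ * Complex.I)) with hee'
  obtain ⟨A, hA⟩ : ∃ A : ℂ, A = (Real.sqrt 2 : ℝ) := ⟨_, rfl⟩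
  have hA2 : A * A = 2 := by
    rw [hA]
    exact_mod_cast Real.mul_self_sqrt (by norm_num : (0 : ℝ) ≤ 2)
  have h6 : Real.sqrt 6 ^ 2 = 6 := Real.sq_sqrt (by norm_num)
  have hM : !![0, A * e', 0; A * e, 0, 2 * e'; 0, 2 * e, 0] =
      sectorMatrix 3 (coupling fun _ => Real.sqrt 2) φ := by
    ext i j
    fin_cases i <;> fin_cases j <;> simp [sectorMatrix, coupling, e, e', hA]
    · rw [one_add_one_eq_two, ← Complex.ofReal_mul, Real.mul_self_sqrt (by norm_num)]
      simp
    · rw [one_add_one_eq_two, ← Complex.ofReal_mul, Real.mul_self_sqrt (by norm_num)]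
      simp
  have hv : ∀ x y z : ℂ, (!![0, A * e', 0; A * e, 0, 2 * e'; 0, 2 * e, 0]).mulVec ![x, y, z] =
      ![A * e' * y, A * e * x + 2 * e' * z, 2 * e * y] := by
    intro x y z
    ext i
    fin_cases i <;> simp [Matrix.mulVec, dotProduct, Fin.sum_univ_three]
  have hx3 : ∀ x : Fin 3 → ℂ, x = ![x 0, x 1, x 2] := fun x => by
    ext i
    fin_cases i <;> rfl
  rw [phasedPulse_of_cube isLadder_triplet hω (Real.sqrt_ne_zero'.2 (by norm_num : (0 : ℝ) < 6)) hM]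
  · congr 2
    rw [hv, hv, ht, h6]
    generalize Real.cos (Real.sqrt 6 * (g * t)) = γ
    ext i
    fin_cases i
    · simp only [reflection, hf']
      simp [← hA]
      linear_combination ((γ - 1) / 6 * q.1 * A * A) * he + ((γ - 1) / 6 * q.1) * hA2
    · simp
    · simp only [reflection, hf]
      simp [← hA]
      linear_combination ((γ - 1) / 6 * q.2 * 4) * he
  · intro x
    rw [hx3 x, hv, hv, hv, h6]
    ext i
    fin_cases i
    · simp
      linear_combination (A ^ 3 * e' * x 1 + 4 * A * e' * x 1) * he + (A * e' * x 1) * hA2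
    · simp
      linear_combination ((A ^ 3 * e * x 0 + 4 * A * e * x 0) + (2 * A ^ 2 * e' + 8 * e') * x 2) * he +
        (A * e * x 0 + 2 * e' * x 2) * hA2
    · simp
      linear_combination (2 * A ^ 2 * e * x 1 + 8 * e * x 1) * he + (2 * e * x 1) * hA2

/-- The state of the sectors of two qubits after the evolution `V` has acted on the vacuum: the
one-dimensional sectors are fixed, and `p`, `q` are the amplitudes in the two others. -/
structure TwoQubitState (V : JointSpace 2 ≃ₗᵢ[ℂ] JointSpace 2) (p q : ℂ × ℂ) : Prop where
  singlet : V (Core.toJoint 2 (ket (singlet 0) 0)) = Core.toJoint 2 (ket (TavisCummings.singlet 0) 0)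
  lowest : V (Core.toJoint 2 (ket (triplet 2) 0)) = Core.toJoint 2 (ket (triplet 2) 0)
  middle : V (Core.toJoint 2 (ket (triplet 1) 0)) =
    Core.toJoint 2 (sectorMap 2 (fun j => triplet (j + 1)) ![p.1, p.2])
  highest : V (Core.toJoint 2 (ket (triplet 0) 0)) =
    Core.toJoint 2 (sectorMap 3 triplet ![q.1, 0, q.2])

theorem twoQubitState_refl :
    TwoQubitState (LinearIsometryEquiv.refl ℂ (JointSpace 2)) (1, 0) (1, 0) where
  singlet := rfl
  lowest := rfl
  middle := by
    have : (![1, 0] : Fin 2 → ℂ) = Pi.single 0 1 := by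
      ext i; fin_cases i <;> rfl
    simp [this, sectorMap_vacuum]
  highest := by
    have : (![1, 0, 0] : Fin 3 → ℂ) = Pi.single 0 1 := by
      ext i; fin_cases i <;> rfl
    simp [this, sectorMap_vacuum]

/-- The action of a pulse which does not populate the middle state of the three-level sector. -/
theorem TwoQubitState.phasedPulse {V : JointSpace 2 ≃ₗᵢ[ℂ] JointSpace 2} {p q : ℂ × ℂ}
    (h : TwoQubitState V p q) (hω : ω ≠ 0) (φ : ℝ) {t : ℝ}
    (ht : Real.sin (Real.sqrt 6 * (g * t)) = 0) :
    TwoQubitState (V.trans (phasedPulse 2 g ω φ t))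
      (equatorial (Real.cos (Real.sqrt 2 * (g * t))) (Real.sin (Real.sqrt 2 * (g * t))) φ p)
      (q.1 + (Real.cos (Real.sqrt 6 * (g * t)) - 1) / 2 * (q.1 - (reflection (2 * φ) q).1),
        q.2 + (Real.cos (Real.sqrt 6 * (g * t)) - 1) / 2 * (q.2 - (reflection (2 * φ) q).2)) where
  singlet := by
    rw [LinearIsometryEquiv.trans_apply, h.singlet, phasedPulse_singleton isLadder_singlet hω]
  lowest := by
    rw [LinearIsometryEquiv.trans_apply, h.lowest]
    exact phasedPulse_singleton isLadder_triplet.tail.tail hω φ t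
  middle := by
    rw [LinearIsometryEquiv.trans_apply, h.middle, phasedPulse_two isLadder_triplet.tail hω (by simp)]
  highest := by
    rw [LinearIsometryEquiv.trans_apply, h.highest, phasedPulse_triplet hω φ t q ht]

/-- The duration of a `π` pulse in the three-level sector. -/
def piTime (g : ℝ) : ℝ := Real.pi / (Real.sqrt 6 * g)

theorem sqrt_six_mul_piTime (hg : 0 < g) : Real.sqrt 6 * (g * piTime g) = Real.pi := by
  have h6 : Real.sqrt 6 ≠ 0 := Real.sqrt_ne_zero'.2 (by norm_num)
  unfold piTime
  field_simp

theorem sqrt_two_mul_piTime (hg : 0 < g) :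
    Real.sqrt 2 * (g * piTime g) = Real.pi / Real.sqrt 3 := by
  have h6 : Real.sqrt 6 = Real.sqrt 2 * Real.sqrt 3 := by
    rw [← Real.sqrt_mul (by norm_num)]
    norm_num
  have h2 : Real.sqrt 2 ≠ 0 := Real.sqrt_ne_zero'.2 (by norm_num)
  have h3 : Real.sqrt 3 ≠ 0 := Real.sqrt_ne_zero'.2 (by norm_num)
  unfold piTime
  rw [h6]
  field_simp

theorem TwoQubitState.pi_pulse {V : JointSpace 2 ≃ₗᵢ[ℂ] JointSpace 2} {p q : ℂ × ℂ}
    (h : TwoQubitState V p q) (hg : 0 < g) (hω : ω ≠ 0) (f : ℝ) :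
    TwoQubitState (V.trans (TavisCummings.phasedPulse 2 g ω (f / 2) (piTime g)))
      (equatorial (Real.cos (Real.pi / Real.sqrt 3)) (Real.sin (Real.pi / Real.sqrt 3)) (f / 2) p)
      (reflection f q) := by
  have h6 := sqrt_six_mul_piTime hg
  have := h.phasedPulse hω (f / 2) (g := g) (t := piTime g) (by rw [h6, Real.sin_pi])
  rw [h6, sqrt_two_mul_piTime hg, mul_div_cancel₀ _ two_ne_zero, Real.cos_pi] at this
  convert this using 1
  ext <;> push_cast <;> ring

theorem TwoQubitState.two_pi_pulse {V : JointSpace 2 ≃ₗᵢ[ℂ] JointSpace 2} {p q : ℂ × ℂ}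
    (h : TwoQubitState V p q) (hg : 0 < g) (hω : ω ≠ 0) (φ : ℝ) :
    TwoQubitState (V.trans (TavisCummings.phasedPulse 2 g ω φ (2 * piTime g)))
      (equatorial (Real.cos (2 * (Real.pi / Real.sqrt 3))) (Real.sin (2 * (Real.pi / Real.sqrt 3))) φ p)
      q := by
  have h6 : Real.sqrt 6 * (g * (2 * piTime g)) = 2 * Real.pi := by
    linear_combination 2 * sqrt_six_mul_piTime hg
  have h2 : Real.sqrt 2 * (g * (2 * piTime g)) = 2 * (Real.pi / Real.sqrt 3) := by
    linear_combination 2 * sqrt_two_mul_piTime hg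
  have := h.phasedPulse hω φ (g := g) (t := 2 * piTime g) (by rw [h6, Real.sin_two_pi])
  rw [h6, h2, Real.cos_two_pi] at this
  convert this using 1
  ext <;> simp

theorem exists_two_pi_pulses (hg : 0 < g) (hω : ω ≠ 0) (l : List ℝ) :
    ∀ {V : JointSpace 2 ≃ₗᵢ[ℂ] JointSpace 2} {τ : ℝ} {p q : ℂ × ℂ}, Reachable g ω V τ →
      TwoQubitState V p q → ∃ V', Reachable g ω V' (τ + l.length * (2 * piTime g)) ∧
        TwoQubitState V' (l.foldl (fun p φ => equatorial (Real.cos (2 * (Real.pi / Real.sqrt 3)))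
          (Real.sin (2 * (Real.pi / Real.sqrt 3))) φ p) p) q := by
  have ht : 0 ≤ 2 * piTime g := by unfold piTime; positivity
  induction l with
  | nil =>
    intro V τ p q hV h
    exact ⟨V, by simpa using hV, h⟩
  | cons φ l ih =>
    intro V τ p q hV h
    obtain ⟨V', h1, h2⟩ := ih (hV.phasedPulse φ ht) (h.two_pi_pulse hg hω φ)
    refine ⟨V', ?_, h2⟩
    convert h1 using 1
    rw [List.length_cons]
    push_cast
    ring

theorem foldl_equatorial_neg (c s : ℝ) (l : List ℝ) (p : ℂ × ℂ) :
    l.foldl (fun p φ => equatorial (-c) (-s) φ p) p =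
      (-1 : ℂ) ^ l.length • l.foldl (fun p φ => equatorial c s φ p) p := by
  induction l using List.reverseRecOn with
  | nil => simp
  | append_singleton l φ ih =>
    rw [List.foldl_concat, List.foldl_concat, ih, List.length_append, List.length_singleton, pow_succ]
    generalize l.foldl (fun p φ => equatorial c s φ p) p = r
    generalize (-1 : ℂ) ^ l.length = ε
    ext
    · simp only [equatorial, su2, star_neg_I_mul_exp, Prod.smul_fst, Prod.smul_snd, smul_eq_mul]
      push_cast
      ring
    · simp only [equatorial, su2, Prod.smul_fst, Prod.smul_snd, smul_eq_mul, Complex.star_def,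
        Complex.conj_ofReal]
      push_cast
      ring

/-- Seven `2π` pulses take the two-level sector to any state. -/
theorem exists_seven_two_pi_rotations {X Y : ℂ} (hXY : Complex.normSq X + Complex.normSq Y = 1) :
    ∃ φ : Fin 7 → ℝ, (List.ofFn φ).foldl (fun p φ =>
      equatorial (Real.cos (2 * (Real.pi / Real.sqrt 3)))
        (Real.sin (2 * (Real.pi / Real.sqrt 3))) φ p) (1, 0) = (X, Y) := by
  obtain ⟨h1, h2, h3, h4⟩ := half_angle_bounds
  set x := Real.pi * (1 / Real.sqrt 3 - 1 / 2) with hx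
  have hx2 : 2 * (Real.pi / Real.sqrt 3) = 2 * x + Real.pi := by rw [hx]; ring
  obtain ⟨φ, hφ⟩ := exists_seven_rotations (Real.cos_sq_add_sin_sq x) h1 h2 h3 h4
    (X := -X) (Y := -Y) (by simpa using hXY)
  refine ⟨φ, ?_⟩
  rw [hx2, Real.cos_add_pi, Real.sin_add_pi, Real.cos_two_mul', Real.sin_two_mul,
    mul_right_comm, foldl_equatorial_neg, hφ, List.length_ofFn]
  ext <;> norm_num

/-- Any pair of phases is produced by seven `2π` pulses followed by four `π` pulses. -/
theorem exists_two_qubit_phases (hg : 0 < g) (hω : ω ≠ 0) (μ ν : ℝ) :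
    ∃ V : JointSpace 2 ≃ₗᵢ[ℂ] JointSpace 2, Reachable g ω V (18 * piTime g) ∧
      TwoQubitState V (Complex.exp (μ * Complex.I), 0)
        (Complex.exp (ν * Complex.I) * Complex.exp (ν * Complex.I), 0) := by
  obtain ⟨f₁, f₂, f₃, f₄, hf⟩ := exists_four_reflections ν
  have ht : 0 ≤ piTime g := by unfold piTime; positivity
  set c := Real.cos (Real.pi / Real.sqrt 3) with hc
  set s := Real.sin (Real.pi / Real.sqrt 3) with hs
  have hcs : c ^ 2 + s ^ 2 = 1 := Real.cos_sq_add_sin_sq _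
  have hcs' : c ^ 2 + (-s) ^ 2 = 1 := by simpa using hcs
  -- the `2π` pulses undo in advance the effect of the `π` pulses on the two-level sector
  let r := equatorial c (-s) (f₁ / 2) (equatorial c (-s) (f₂ / 2) (equatorial c (-s) (f₃ / 2)
    (equatorial c (-s) (f₄ / 2) (Complex.exp (μ * Complex.I), 0))))
  have hr : Complex.normSq r.1 + Complex.normSq r.2 = 1 := by
    simp only [r]
    rw [normSq_equatorial hcs', normSq_equatorial hcs', normSq_equatorial hcs',
      normSq_equatorial hcs', Complex.normSq_eq_norm_sq, Complex.norm_exp_ofReal_mul_I]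
    simp
  obtain ⟨φ, hφ⟩ := exists_seven_two_pi_rotations hr
  obtain ⟨V, hV, hs0⟩ := exists_two_pi_pulses hg hω (List.ofFn φ) (Reachable.refl g ω)
    twoQubitState_refl
  rw [hφ] at hs0
  have h4 := (((hs0.pi_pulse hg hω f₁).pi_pulse hg hω f₂).pi_pulse hg hω f₃).pi_pulse hg hω f₄
  rw [hf, ← hc, ← hs] at h4
  have hr2 : equatorial c s (f₄ / 2) (equatorial c s (f₃ / 2) (equatorial c s (f₂ / 2)
      (equatorial c s (f₁ / 2) (r.1, r.2)))) = (Complex.exp (μ * Complex.I), 0) := by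
    rw [Prod.mk.eta]
    simp only [r, equatorial_inverse hcs]
  rw [hr2] at h4
  refine ⟨_, ?_, h4⟩
  have := (((hV.phasedPulse (f₁ / 2) ht).phasedPulse (f₂ / 2) ht).phasedPulse (f₃ / 2) ht).phasedPulse
    (f₄ / 2) ht
  convert this using 1
  rw [List.length_ofFn]
  push_cast
  ring

end Pulses

theorem bits_two_cases (s : Bits 2) : s = ![0, 0] ∨ s = ![0, 1] ∨ s = ![1, 0] ∨ s = ![1, 1] := by
  have : s = ![s 0, s 1] := by ext i; fin_cases i <;> rfl
  rw [this]
  generalize s 0 = a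
  generalize s 1 = b
  fin_cases a <;> fin_cases b <;> simp

theorem span_two_qubits : Submodule.span ℂ {triplet 0, triplet 1, triplet 2, singlet 0} = ⊤ := by
  refine span_eq_top_of_single fun b => ?_
  set P := Submodule.span ℂ {triplet 0, triplet 1, triplet 2, singlet 0} with hP
  have m0 : triplet 0 ∈ P := Submodule.subset_span (by simp)
  have m1 : triplet 1 ∈ P := Submodule.subset_span (by simp)
  have m2 : triplet 2 ∈ P := Submodule.subset_span (by simp)
  have m3 : singlet 0 ∈ P := Submodule.subset_span (by simp)
  have m4 : Pi.single ![0, 1] 1 + Pi.single ![1, 0] 1 ∈ P := by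
    have h := P.smul_mem (Real.sqrt 2 : ℂ) m1
    have h0 : (Real.sqrt 2 : ℂ) ≠ 0 := by
      exact_mod_cast Real.sqrt_ne_zero'.2 (by norm_num : (0 : ℝ) < 2)
    simpa [triplet, smul_smul, h0] using h
  rcases bits_two_cases b with rfl | rfl | rfl | rfl
  · exact m0
  · have : (Pi.single ![0, 1] 1 : Bits 2 → ℂ) = (1 / 2 : ℂ) • (Pi.single ![0, 1] 1 +
        Pi.single ![1, 0] 1) + (1 / 2 : ℂ) • singlet 0 := by
      simp only [singlet]
      module
    rw [this]
    exact P.add_mem (P.smul_mem _ m4) (P.smul_mem _ m3)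
  · have : (Pi.single ![1, 0] 1 : Bits 2 → ℂ) = (1 / 2 : ℂ) • (Pi.single ![0, 1] 1 +
        Pi.single ![1, 0] 1) - (1 / 2 : ℂ) • singlet 0 := by
      simp only [singlet]
      module
    rw [this]
    exact P.sub_mem (P.smul_mem _ m4) (P.smul_mem _ m3)
  · exact m2

/-- A permutation-invariant operator on two qubits which commutes with `∑ Z_j` is diagonal in the
basis of triplet and singlet states. -/
theorem two_qubit_eigenvalues {U : QubitOp 2} (hperm : PermInvariant U) (hZ : Commute U (sumZ 2)) :
    ∃ u₀ u₁ u₂ u₃ : ℂ, U.mulVec (triplet 0) = u₀ • triplet 0 ∧ U.mulVec (triplet 1) = u₁ • triplet 1 ∧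
      U.mulVec (triplet 2) = u₂ • triplet 2 ∧ U.mulVec (singlet 0) = u₃ • singlet 0 := by
  have hswap := hperm.apply_comp (Equiv.swap 0 1)
  have hs : ∀ a b : Fin 2, (fun k => ![a, b] (Equiv.swap (0 : Fin 2) 1 k)) = ![b, a] := by
    intro a b
    ext k
    fin_cases k <;> simp
  have e1 := hswap ![0, 1] ![0, 1]
  have e2 := hswap ![0, 1] ![1, 0]
  rw [hs] at e1 e2
  rw [hs] at e2
  have hz : ∀ a b c d : Fin 2, (![a, b] : Bits 2) ≠ ![c, d] → ¬ (a = d ∧ b = c) →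
      U ![a, b] ![c, d] = 0 := by
    intro a b c d h1 h2
    refine apply_eq_zero_of_commute_sumZ hZ ?_
    revert h1 h2
    fin_cases a <;> fin_cases b <;> fin_cases c <;> fin_cases d <;>
      simp [Fin.sum_univ_two] <;> norm_num
  have hcol : ∀ s t : Bits 2, U.mulVec (Pi.single s 1) t = U t s := by
    intro s t
    rw [Matrix.mulVec_single_one, Matrix.col_apply]
  refine ⟨U ![0, 0] ![0, 0], U ![0, 1] ![0, 1] + U ![0, 1] ![1, 0], U ![1, 1] ![1, 1],
    U ![0, 1] ![0, 1] - U ![0, 1] ![1, 0], ?_, ?_, ?_, ?_⟩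
  · ext t
    simp only [triplet, hcol, Pi.smul_apply, smul_eq_mul]
    rcases bits_two_cases t with rfl | rfl | rfl | rfl
    · simp
    all_goals
      rw [hz _ _ _ _ (by simp) (by simp), Pi.single_eq_of_ne (by simp), mul_zero]
  · ext t
    simp only [triplet, hcol, Pi.smul_apply, smul_eq_mul, Matrix.mulVec_smul, Matrix.mulVec_add,
      Pi.add_apply]
    rcases bits_two_cases t with rfl | rfl | rfl | rfl
    · simp [hz]
    · simp
      ring
    · simp
      rw [e1, e2]
      ring
    · simp [hz]
  · ext t
    simp only [triplet, hcol, Pi.smul_apply, smul_eq_mul]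
    rcases bits_two_cases t with rfl | rfl | rfl | rfl
    rotate_left 3
    · simp
    all_goals
      rw [hz _ _ _ _ (by simp) (by simp), Pi.single_eq_of_ne (by simp), mul_zero]
  · ext t
    simp only [singlet, hcol, Pi.smul_apply, smul_eq_mul, Matrix.mulVec_sub, Pi.sub_apply]
    rcases bits_two_cases t with rfl | rfl | rfl | rfl
    · simp [hz]
    · simp
    · simp
      rw [e1, e2]
    · simp [hz]

theorem realizable_two_qubits {g ω : ℝ} (hg : 0 < g) (hω : ω ≠ 0) {U : QubitOp 2}
    (hU : U ∈ Matrix.unitaryGroup (Bits 2) ℂ) (hperm : PermInvariant U)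
    (hZ : Commute U (sumZ 2)) : RealizableInTime g ω U (18 * piTime g) := by
  obtain ⟨u₀, u₁, u₂, u₃, h₀, h₁, h₂, h₃⟩ := two_qubit_eigenvalues hperm hZ
  have hne : ∀ (v : Bits 2 → ℂ) (b : Bits 2), v b ≠ 0 → v ≠ 0 := fun v b hb h => hb (by rw [h]; rfl)
  have n₀ := norm_eq_one_of_mulVec_eq_smul hU (hne _ ![0, 0] (by simp [triplet])) h₀
  have n₁ := norm_eq_one_of_mulVec_eq_smul hU (hne _ ![0, 1] (by simp [triplet])) h₁
  have n₂ := norm_eq_one_of_mulVec_eq_smul hU (hne _ ![1, 1] (by simp [triplet])) h₂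
  have n₃ := norm_eq_one_of_mulVec_eq_smul hU (hne _ ![0, 1] (by simp [singlet])) h₃
  obtain ⟨θ₀, rfl⟩ := exists_exp_eq n₀
  obtain ⟨θ₁, rfl⟩ := exists_exp_eq n₁
  obtain ⟨θ₂, rfl⟩ := exists_exp_eq n₂
  obtain ⟨θ₃, rfl⟩ := exists_exp_eq n₃
  -- the global phase fixes the singlet, a final `z` rotation the lowest triplet state
  obtain ⟨V, hV, hs⟩ := exists_two_qubit_phases hg hω (θ₁ - θ₃) ((θ₀ + θ₂ - 2 * θ₃) / 2)
  refine realizable_of_spanning (hV.zRotation (θ₂ - θ₃)) θ₃ span_two_qubits ?_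
  have hs2 : ∀ x : ℂ, (![x, 0] : Fin 2 → ℂ) = Pi.single 0 x := fun x => by
    ext i; fin_cases i <;> rfl
  have hs3 : ∀ x : ℂ, (![x, 0, 0] : Fin 3 → ℂ) = Pi.single 0 x := fun x => by
    ext i; fin_cases i <;> rfl
  simp only [Set.mem_insert_iff, Set.mem_singleton_iff, LinearIsometryEquiv.trans_apply]
  rintro ψ (rfl | rfl | rfl | rfl)
  · rw [hs.highest, h₀, hs3, sectorMap_vacuum, map_smul, map_smul,
      zRotation_ket isLadder_triplet g hω, smul_smul, smul_smul, ket_smul, map_smul]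
    simp only [← Complex.exp_add]
    congr 2
    push_cast
    ring
  · rw [hs.middle, h₁, hs2, sectorMap_vacuum, map_smul, map_smul,
      zRotation_ket isLadder_triplet.tail g hω, smul_smul, smul_smul, ket_smul, map_smul]
    simp only [← Complex.exp_add]
    congr 2
    push_cast
    ring
  · rw [hs.lowest, h₂, zRotation_ket isLadder_triplet.tail.tail g hω, smul_smul, ket_smul, map_smul]
    simp only [← Complex.exp_add]
    congr 2
    push_cast
    ring
  · rw [hs.singlet, h₃, zRotation_ket isLadder_singlet g hω, smul_smul, ket_smul, map_smul]
    simp only [← Complex.exp_add]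
    congr 2
    push_cast
    ring

theorem eighteen_mul_piTime_le {g : ℝ} (hg : 0 < g) :
    18 * piTime g ≤ 3.92 * (2 * Real.pi / g) := by
  have h6 : 2.4 ≤ Real.sqrt 6 := Real.le_sqrt_of_sq_le (by norm_num)
  have h : 18 * piTime g = (18 / Real.sqrt 6) * (Real.pi / g) := by
    unfold piTime
    field_simp
  have h' : 3.92 * (2 * Real.pi / g) = 7.84 * (Real.pi / g) := by ring
  rw [h, h']
  refine mul_le_mul_of_nonneg_right ?_ (by positivity)
  rw [div_le_iff₀ (by positivity)]
  nlinarith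

/-! ### Subgroups of a unitary group and their tangent spaces -/

section Tangent

variable {𝔸 : Type*} [NormedRing 𝔸] [NormedAlgebra ℂ 𝔸] [StarRing 𝔸]

/-- The tangent space at `1` of a subgroup of the unitary group: the velocities of the strictly
differentiable curves in the subgroup. -/
def tangentSpace (G : Subgroup (unitary 𝔸)) : Submodule ℝ 𝔸 where
  carrier := {X | ∃ γ : ℝ → unitary 𝔸, (∀ t, γ t ∈ G) ∧ γ 0 = 1 ∧
    HasStrictDerivAt (fun t => (γ t : 𝔸)) X 0}
  zero_mem' := ⟨fun _ => 1, fun _ => one_mem G, rfl, hasStrictDerivAt_const _ _⟩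
  add_mem' := by
    rintro X Y ⟨γ, hγ, h0, hX⟩ ⟨δ, hδ, h0', hY⟩
    refine ⟨fun t => γ t * δ t, fun t => G.mul_mem (hγ t) (hδ t), by simp [h0, h0'], ?_⟩
    refine (hX.mul hY).congr_deriv ?_
    simp [h0, h0']
  smul_mem' := by
    rintro c X ⟨γ, hγ, h0, hX⟩
    refine ⟨fun t => γ (c * t), fun t => hγ _, by simp [h0], ?_⟩
    have h1 : HasStrictDerivAt (fun t : ℝ => c * t) c 0 := by
      simpa using (hasStrictDerivAt_id (0 : ℝ)).const_mul c
    have h2 : HasStrictDerivAt (fun t => (γ t : 𝔸)) X (c * 0) := by rwa [mul_zero]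
    exact h2.scomp 0 h1

theorem conj_mem_tangentSpace {G : Subgroup (unitary 𝔸)} {X : 𝔸} (hX : X ∈ tangentSpace G)
    {u : unitary 𝔸} (hu : u ∈ G) : (u : 𝔸) * X * star (u : 𝔸) ∈ tangentSpace G := by
  obtain ⟨γ, hγ, h0, hX⟩ := hX
  refine ⟨fun t => u * γ t * u⁻¹, fun t => G.mul_mem (G.mul_mem hu (hγ t)) (G.inv_mem hu),
    by simp [h0], ?_⟩
  exact (hX.const_mul (u : 𝔸)).mul_const (star (u : 𝔸))

/-- A linear map into the tangent space is the derivative at `0` of a map into the subgroup: a product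
of curves, one for each coordinate. -/
theorem exists_chart [FiniteDimensional ℂ 𝔸] (G : Subgroup (unitary 𝔸)) (L : 𝔸 →ₗ[ℝ] 𝔸)
    (hL : ∀ A, L A ∈ tangentSpace G) :
    ∃ F : 𝔸 → unitary 𝔸, (∀ A, F A ∈ G) ∧ F 0 = 1 ∧
      ∃ L' : 𝔸 →L[ℝ] 𝔸, (∀ A, L' A = L A) ∧ HasStrictFDerivAt (fun A => (F A : 𝔸)) L' 0 := by
  have : FiniteDimensional ℝ 𝔸 := FiniteDimensional.complexToReal 𝔸
  let b := Module.finBasis ℝ 𝔸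
  have key : ∀ s : Finset (Fin (Module.finrank ℝ 𝔸)), ∃ F : 𝔸 → unitary 𝔸, (∀ A, F A ∈ G) ∧ F 0 = 1 ∧
      ∃ L' : 𝔸 →L[ℝ] 𝔸, (∀ A, L' A = ∑ i ∈ s, b.repr A i • L (b i)) ∧
        HasStrictFDerivAt (fun A => (F A : 𝔸)) L' 0 := by
    intro s
    induction s using Finset.induction_on with
    | empty => exact ⟨fun _ => 1, fun _ => one_mem G, rfl, 0, by simp, hasStrictFDerivAt_const _ _⟩
    | insert i s hi ih =>
      obtain ⟨F, hF, hF0, L', hL', hd⟩ := ih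
      obtain ⟨γ, hγ, hγ0, hγd⟩ := hL (b i)
      let c : 𝔸 →L[ℝ] ℝ := LinearMap.toContinuousLinearMap (b.coord i)
      have hc : HasStrictFDerivAt (fun A => (γ (c A) : 𝔸)) (c.smulRight (L (b i))) 0 := by
        have h1 : HasStrictDerivAt (fun t => (γ t : 𝔸)) (L (b i)) (c 0) := by rwa [map_zero]
        exact (h1.hasStrictFDerivAt.comp (0 : 𝔸) c.hasStrictFDerivAt).congr_fderiv
          (by ext A; simp)
      refine ⟨fun A => γ (c A) * F A, fun A => G.mul_mem (hγ _) (hF A), by simp [hγ0, hF0],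
        c.smulRight (L (b i)) + L', fun A => ?_, ?_⟩
      · rw [Finset.sum_insert hi, ← hL']
        rfl
      · refine (hc.mul' hd).congr_fderiv ?_
        ext A
        simp [hF0, hγ0, add_comm]
  obtain ⟨F, hF, hF0, L', hL', hd⟩ := key Finset.univ
  refine ⟨F, hF, hF0, L', fun A => ?_, hd⟩
  rw [hL']
  conv_rhs => rw [← b.sum_repr A, map_sum]
  simp

/-- A unitary `1 + H` near `1` with `H` self-adjoint is equal to `1`. -/
theorem eq_zero_of_one_add_mem_unitary {H : 𝔸} (hH : star H = H) (hu : 1 + H ∈ unitary 𝔸)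
    (hn : ‖H‖ < 2) : H = 0 := by
  have h1 : star (1 + H) * (1 + H) = 1 := hu.1
  rw [star_add, star_one, hH] at h1
  have h2 : (2 : ℝ) • H = -(H * H) := by
    rw [two_smul]
    have : (1 + H) * (1 + H) = 1 + (H + H + H * H) := by noncomm_ring
    rw [this] at h1
    exact eq_neg_of_add_eq_zero_left (by simpa using h1)
  have h3 : 2 * ‖H‖ ≤ ‖H‖ * ‖H‖ := by
    have := norm_mul_le H H
    rw [← norm_neg, ← h2, norm_smul] at this
    simpa using this
  have h4 : ‖H‖ = 0 := by
    by_contra h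
    have : 0 < ‖H‖ := lt_of_le_of_ne (norm_nonneg _) (Ne.symm h)
    nlinarith
  exact norm_eq_zero.1 h4

variable [StarModule ℂ 𝔸] [ContinuousStar 𝔸]

theorem star_eq_neg_of_mem_tangentSpace {G : Subgroup (unitary 𝔸)} {X : 𝔸}
    (hX : X ∈ tangentSpace G) : star X = -X := by
  obtain ⟨γ, -, h0, hX⟩ := hX
  have h := (hX.star.mul hX).hasDerivAt
  have h1 : ((fun t => star (γ t : 𝔸)) * fun t => (γ t : 𝔸)) = fun _ => 1 := by
    funext t
    simp
  rw [h1, h0] at h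
  have := h.unique (hasDerivAt_const _ _)
  simp only [OneMemClass.coe_one, star_one, mul_one, one_mul] at this
  exact eq_neg_of_add_eq_zero_left this

/-- The tangent space consists of skew-adjoint elements, so it is a real form of its complex span. -/
theorem mem_tangentSpace_of_span_eq_top {G : Subgroup (unitary 𝔸)}
    (h : Submodule.span ℂ (tangentSpace G : Set 𝔸) = ⊤) {K : 𝔸} (hK : star K = -K) :
    K ∈ tangentSpace G := by
  have hdec : ∀ A ∈ Submodule.span ℂ (tangentSpace G : Set 𝔸), ∃ X ∈ tangentSpace G,
      ∃ Y ∈ tangentSpace G, A = X + Complex.I • Y := by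
    intro A hA
    induction hA using Submodule.span_induction with
    | zero => exact ⟨0, zero_mem _, 0, zero_mem _, by simp⟩
    | mem A hA => exact ⟨A, hA, 0, zero_mem _, by simp⟩
    | add A B _ _ hA hB =>
      obtain ⟨X, hX, Y, hY, rfl⟩ := hA
      obtain ⟨X', hX', Y', hY', rfl⟩ := hB
      exact ⟨X + X', add_mem hX hX', Y + Y', add_mem hY hY', by module⟩
    | smul c A _ hA =>
      obtain ⟨X, hX, Y, hY, rfl⟩ := hA
      refine ⟨c.re • X - c.im • Y, sub_mem (Submodule.smul_mem _ _ hX) (Submodule.smul_mem _ _ hY),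
        c.im • X + c.re • Y, add_mem (Submodule.smul_mem _ _ hX) (Submodule.smul_mem _ _ hY), ?_⟩
      have hr : ∀ (r : ℝ) (Z : 𝔸), r • Z = (r : ℂ) • Z := fun r Z => (Complex.coe_smul r Z).symm
      simp only [hr, smul_add, smul_smul]
      have hc := Complex.re_add_im c
      have e1 : c • X = (c.re + c.im * Complex.I : ℂ) • X := by rw [hc]
      have e2 : (c * Complex.I) • Y = ((c.re + c.im * Complex.I) * Complex.I : ℂ) • Y := by rw [hc]
      have e3 : (c.re + c.im * Complex.I : ℂ) * Complex.I = c.re * Complex.I - c.im := by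
        linear_combination (c.im : ℂ) * Complex.I_mul_I
      rw [e1, e2, e3]
      module
  obtain ⟨X, hX, Y, hY, rfl⟩ := hdec K (h ▸ Submodule.mem_top)
  have hX' := star_eq_neg_of_mem_tangentSpace hX
  have hY' := star_eq_neg_of_mem_tangentSpace hY
  rw [star_add, star_smul, hX', hY', Complex.star_def, Complex.conj_I] at hK
  have h0 : (2 : ℂ) • (Complex.I • Y) = 0 := by
    have : (2 : ℂ) • (Complex.I • Y) = (-X + -Complex.I • -Y) - -(X + Complex.I • Y) := by module
    rw [this, hK, sub_self]
  rw [smul_eq_zero_iff_right two_ne_zero] at h0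
  rwa [h0, add_zero]

variable [FiniteDimensional ℂ 𝔸]

/-- The tangent space is a Lie algebra: the bracket is the velocity of a curve of conjugates. -/
theorem bracket_mem_tangentSpace {G : Subgroup (unitary 𝔸)} {X Y : 𝔸} (hX : X ∈ tangentSpace G)
    (hY : Y ∈ tangentSpace G) : X * Y - Y * X ∈ tangentSpace G := by
  have hsX := star_eq_neg_of_mem_tangentSpace hX
  obtain ⟨γ, hγ, h0, hX⟩ := hX
  have : FiniteDimensional ℝ 𝔸 := FiniteDimensional.complexToReal 𝔸
  have hcl : IsClosed (tangentSpace G : Set 𝔸) := Submodule.closed_of_finiteDimensional _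
  have h := ((hX.mul_const Y).mul hX.star).hasDerivAt
  rw [h0] at h
  simp only [OneMemClass.coe_one, star_one, mul_one, one_mul, hsX, mul_neg, ← sub_eq_add_neg] at h
  refine hcl.mem_of_tendsto (hasDerivAt_iff_tendsto_slope.1 h) (Eventually.of_forall fun t => ?_)
  rw [slope_def_module]
  refine (tangentSpace G).smul_mem _ ((tangentSpace G).sub_mem ?_ ?_)
  · exact conj_mem_tangentSpace hY (hγ t)
  · exact conj_mem_tangentSpace hY (hγ 0)

/-- A subgroup of the unitary group whose tangent space contains all skew-adjoint elements is open:
the map `A ↦ F(A) (1 + H(A))`, with `F` a chart of the subgroup and `H(A)` the self-adjoint part of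
`A`, covers a neighbourhood of `1`, and at unitary values the second factor is trivial. -/
theorem isOpen_of_tangentSpace (G : Subgroup (unitary 𝔸))
    (hG : ∀ X : 𝔸, star X = -X → X ∈ tangentSpace G) : IsOpen (G : Set (unitary 𝔸)) := by
  have hfin : FiniteDimensional ℝ 𝔸 := FiniteDimensional.complexToReal 𝔸
  have hcomp : CompleteSpace 𝔸 := FiniteDimensional.complete ℝ 𝔸
  let S : 𝔸 →ₗ[ℝ] 𝔸 :=
    { toFun := star
      map_add' := star_add
      map_smul' := fun c A => by simp }
  obtain ⟨F, hF, hF0, L', hL', hd⟩ := exists_chart G ((1 / 2 : ℝ) • (LinearMap.id - S)) (by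
    intro A
    refine hG _ ?_
    simp only [LinearMap.smul_apply, LinearMap.sub_apply, LinearMap.id_apply, S, LinearMap.coe_mk,
      AddHom.coe_mk, star_smul, star_sub, star_star, star_trivial]
    rw [← smul_neg, neg_sub])
  let H : 𝔸 →L[ℝ] 𝔸 := LinearMap.toContinuousLinearMap ((1 / 2 : ℝ) • (LinearMap.id + S))
  have hH : ∀ A, H A = (1 / 2 : ℝ) • (A + star A) := fun A => rfl
  have hHs : ∀ A, star (H A) = H A := fun A => by
    rw [hH, star_smul, star_add, star_star, star_trivial, add_comm]
  have hΦ : HasStrictFDerivAt (fun A => (F A : 𝔸) * (1 + H A))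
      ((ContinuousLinearEquiv.refl ℝ 𝔸 : 𝔸 ≃L[ℝ] 𝔸) : 𝔸 →L[ℝ] 𝔸) 0 := by
    refine (hd.mul' (H.hasStrictFDerivAt.const_add 1)).congr_fderiv ?_
    ext A
    have h1 : L' A = (1 / 2 : ℝ) • (A - star A) := hL' A
    simp [hF0, h1, hH]
    module
  have hmap := hΦ.map_nhds_eq_of_equiv
  simp only [hF0, map_zero, add_zero, OneMemClass.coe_one, one_mul] at hmap
  have hN : {A : 𝔸 | ‖H A‖ < 2} ∈ 𝓝 (0 : 𝔸) := by
    refine (isOpen_lt (H.continuous.norm) continuous_const).mem_nhds ?_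
    simp
  have himg : (fun A => (F A : 𝔸) * (1 + H A)) '' {A : 𝔸 | ‖H A‖ < 2} ∈ 𝓝 (1 : 𝔸) := by
    rw [← hmap]
    exact image_mem_map hN
  have hmem : (G : Set (unitary 𝔸)) ∈ 𝓝 (1 : unitary 𝔸) := by
    have hcont : Tendsto (fun u : unitary 𝔸 => (u : 𝔸)) (𝓝 1) (𝓝 ((1 : unitary 𝔸) : 𝔸)) :=
      continuous_subtype_val.tendsto 1
    filter_upwards [hcont himg] with u hu
    obtain ⟨A, hA, hAu⟩ := hu
    replace hAu : (F A : 𝔸) * (1 + H A) = u := hAu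
    have h1 : 1 + H A = ((F A)⁻¹ * u : unitary 𝔸) := by
      have : ((F A)⁻¹ * F A : unitary 𝔸) = 1 := inv_mul_cancel _
      have h2 := congrArg (Subtype.val) this
      simp only [Submonoid.coe_mul, OneMemClass.coe_one] at h2 ⊢
      rw [← hAu, ← mul_assoc, h2, one_mul]
    have h2 := eq_zero_of_one_add_mem_unitary (hHs A) (h1 ▸ Subtype.property _) hA
    simp only [h2, add_zero, mul_one] at hAu
    have : F A = u := Subtype.ext hAu
    exact this ▸ hF A
  exact Subgroup.isOpen_of_mem_nhds G hmem

/-- Continuous paths of unitaries starting at `1` stay in a subgroup with full tangent space. -/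
theorem mem_of_continuous_path (G : Subgroup (unitary 𝔸))
    (hG : ∀ X : 𝔸, star X = -X → X ∈ tangentSpace G) {γ : ℝ → unitary 𝔸} (hγ : Continuous γ)
    (h0 : γ 0 = 1) (t : ℝ) : γ t ∈ G := by
  have ho := isOpen_of_tangentSpace G hG
  have hc : IsClopen (γ ⁻¹' (G : Set (unitary 𝔸))) :=
    ⟨(Subgroup.isClosed_of_isOpen G ho).preimage hγ, ho.preimage hγ⟩
  have := hc.eq_univ ⟨0, by simp [h0, one_mem]⟩
  exact (this ▸ Set.mem_univ t : t ∈ γ ⁻¹' (G : Set (unitary 𝔸)))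

theorem bracket_mem_span_tangentSpace {G : Subgroup (unitary 𝔸)} {X Y : 𝔸}
    (hX : X ∈ Submodule.span ℂ (tangentSpace G : Set 𝔸))
    (hY : Y ∈ Submodule.span ℂ (tangentSpace G : Set 𝔸)) :
    X * Y - Y * X ∈ Submodule.span ℂ (tangentSpace G : Set 𝔸) := by
  induction hX using Submodule.span_induction with
  | zero => simp
  | add A B _ _ hA hB =>
    have : (A + B) * Y - Y * (A + B) = (A * Y - Y * A) + (B * Y - Y * B) := by noncomm_ring
    rw [this]
    exact Submodule.add_mem _ hA hB
  | smul c A _ hA =>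
    have : (c • A) * Y - Y * (c • A) = c • (A * Y - Y * A) := by
      rw [smul_mul_assoc, mul_smul_comm, smul_sub]
    rw [this]
    exact Submodule.smul_mem _ _ hA
  | mem A hA =>
    induction hY using Submodule.span_induction with
    | zero => simp
    | add B C _ _ hB hC =>
      have : A * (B + C) - (B + C) * A = (A * B - B * A) + (A * C - C * A) := by noncomm_ring
      rw [this]
      exact Submodule.add_mem _ hB hC
    | smul c B _ hB =>
      have : A * (c • B) - (c • B) * A = c • (A * B - B * A) := by
        rw [smul_mul_assoc, mul_smul_comm, smul_sub]
      rw [this]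
      exact Submodule.smul_mem _ _ hB
    | mem B hB => exact Submodule.subset_span (bracket_mem_tangentSpace hA hB)

end Tangent

/-! ### Generating a sum of matrix algebras by brackets -/

/-- The component of a vector of an invariant subspace along an eigenvalue, for an explicit
decomposition in eigenvectors. -/
theorem eigen_component_mem {V ι : Type*} [AddCommGroup V] [Module ℂ V] {T : Module.End ℂ V}
    {W : Submodule ℂ V} (hW : ∀ x ∈ W, T x ∈ W) (s : Finset ι) {x : ι → V} {ev : ι → ℂ}
    (hx : ∀ k ∈ s, T (x k) = ev k • x k) (hs : ∑ k ∈ s, x k ∈ W) (μ : ℂ) :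
    ∑ k ∈ s with ev k = μ, x k ∈ W := by
  classical
  by_cases hμ : μ ∈ s.image ev
  · let p := Lagrange.basis (s.image ev) id μ
    have hp : ∀ y ∈ W, Polynomial.aeval T p y ∈ W := by
      intro y hy
      induction p using Polynomial.induction_on' with
      | add p q hp hq =>
        rw [map_add, LinearMap.add_apply]
        exact W.add_mem hp hq
      | monomial n a =>
        rw [Polynomial.aeval_monomial, Module.End.mul_apply, Module.algebraMap_end_apply]
        refine W.smul_mem _ ?_
        induction n with
        | zero => simpa using hy
        | succ n ih =>
          rw [pow_succ', Module.End.mul_apply]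
          exact hW _ ih
    have h := hp _ hs
    rw [map_sum] at h
    rw [Finset.sum_filter]
    convert h using 1
    refine Finset.sum_congr rfl fun k hk => ?_
    rw [Module.End.aeval_apply_of_mem_apply_eq_smul (hx k hk)]
    have hk' := Finset.mem_image_of_mem ev hk
    split_ifs with hkμ
    · rw [hkμ]
      have := Lagrange.eval_basis_self (v := id) Function.injective_id.injOn hμ
      simp only [id] at this
      rw [this, one_smul]
    · have := Lagrange.eval_basis_of_ne (v := id) (Ne.symm hkμ) hk'
      simp only [id] at this
      rw [this, zero_smul]
  · rw [Finset.filter_false_of_mem]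
    · simp
    · rintro k hk rfl
      exact hμ (Finset.mem_image_of_mem ev hk)

/-- Root vectors `e k`, `f k` of a Lie algebra of operators, with integer Cartan matrix `c`. -/
structure IsRootSystem {R ι : Type*} [Ring R] [Algebra ℂ R] (e f : ι → R) (c : ι → ι → ℤ) : Prop where
  ef : ∀ k l, k ≠ l → e k * f l - f l * e k = 0
  he : ∀ k l, (e k * f k - f k * e k) * e l - e l * (e k * f k - f k * e k) = (c k l : ℂ) • e l
  hf : ∀ k l, (e k * f k - f k * e k) * f l - f l * (e k * f k - f k * e k) = -((c k l : ℂ) • f l)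

theorem IsRootSystem.symm {R ι : Type*} [Ring R] [Algebra ℂ R] {e f : ι → R} {c : ι → ι → ℤ}
    (h : IsRootSystem e f c) : IsRootSystem f e c where
  ef k l hkl := by rw [← neg_sub, h.ef l k hkl.symm, neg_zero]
  he k l := by
    rw [← neg_sub (e k * f k), neg_mul, mul_neg, ← neg_sub', h.hf, neg_neg]
  hf k l := by
    rw [← neg_sub (e k * f k), neg_mul, mul_neg, ← neg_sub', h.he]

/-- If a bracket-closed space contains `∑ w e` and `∑ w f`, it contains the parts of these sums on
which the bracket with `∑ w² [e, f]` has a given eigenvalue. -/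
theorem IsRootSystem.weight_component_mem {R ι : Type*} [Ring R] [Algebra ℂ R] [Fintype ι]
    {e f : ι → R} {c : ι → ι → ℤ} (h : IsRootSystem e f c) {W : Submodule ℂ R}
    (hW : ∀ x ∈ W, ∀ y ∈ W, x * y - y * x ∈ W) {w : ι → ℂ} {w2 : ι → ℤ} (hw : ∀ k, w k * w k = w2 k)
    (hE : ∑ k, w k • e k ∈ W) (hF : ∑ k, w k • f k ∈ W) (μ : ℤ) :
    ∑ l with ∑ k, w2 k * c k l = μ, w l • e l ∈ W := by
  classical
  set H := ∑ k, (w2 k : ℂ) • (e k * f k - f k * e k) with hH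
  have hHW : H ∈ W := by
    have := hW _ hE _ hF
    convert this using 1
    rw [Finset.sum_mul_sum, Finset.sum_mul_sum,
      Finset.sum_comm (f := fun i j => (w i • f i) * (w j • e j)), ← Finset.sum_sub_distrib]
    refine Finset.sum_congr rfl fun k _ => ?_
    simp only [smul_mul_assoc, mul_smul_comm, smul_smul]
    rw [← Finset.sum_sub_distrib, Finset.sum_eq_single k]
    · rw [hw, smul_sub]
    · intro l _ hl
      rw [mul_comm, ← smul_sub, h.ef k l hl.symm, smul_zero]
    · simp
  have hT := eigen_component_mem (T := LinearMap.mulLeft ℂ H - LinearMap.mulRight ℂ H)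
    (fun x hx => hW H hHW x hx) Finset.univ (x := fun l => w l • e l)
    (ev := fun l => ((∑ k, w2 k * c k l : ℤ) : ℂ)) (fun l _ => ?_) hE μ
  · simpa only [Int.cast_inj] using hT
  · simp only [LinearMap.sub_apply, LinearMap.mulLeft_apply, LinearMap.mulRight_apply, hH,
      Finset.sum_mul, Finset.mul_sum, smul_mul_assoc, mul_smul_comm]
    rw [Finset.smul_sum, ← Finset.sum_sub_distrib]
    push_cast
    rw [Finset.sum_smul]
    refine Finset.sum_congr rfl fun k _ => ?_
    rw [smul_comm, ← smul_sub, ← smul_sub, h.he]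
    module

/-- The product of matrix algebras of sizes `r i + 1`. -/
abbrev BlockAlgebra {κ : Type*} (r : κ → ℕ) : Type _ :=
  (i : κ) → Matrix (Fin (r i + 1)) (Fin (r i + 1)) ℂ

section Units

variable {κ : Type*} [DecidableEq κ] {r : κ → ℕ}

/-- The matrix units of a product of matrix algebras. -/
def matrixUnit (i : κ) (a b : Fin (r i + 1)) : BlockAlgebra r := Pi.single i (Matrix.single a b 1)

theorem matrixUnit_mul (i : κ) (a b c : Fin (r i + 1)) :
    (matrixUnit i a b * matrixUnit i b c : BlockAlgebra r) = matrixUnit i a c := by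
  rw [matrixUnit, matrixUnit, ← Pi.single_mul, Matrix.single_mul_single_same, mul_one]
  rfl

theorem matrixUnit_mul_of_ne {i : κ} {b c : Fin (r i + 1)} (h : b ≠ c) (a e : Fin (r i + 1)) :
    (matrixUnit i a b * matrixUnit i c e : BlockAlgebra r) = 0 := by
  rw [matrixUnit, matrixUnit, ← Pi.single_mul, Matrix.single_mul_single_of_ne _ _ _ _ h, Pi.single_zero]

theorem matrixUnit_mul_eq_ite (i : κ) (a b c e : Fin (r i + 1)) :
    (matrixUnit i a b * matrixUnit i c e : BlockAlgebra r) =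
      if (b : ℕ) = c then matrixUnit i a e else 0 := by
  split_ifs with h
  · rw [Fin.ext h, matrixUnit_mul]
  · exact matrixUnit_mul_of_ne (fun hbc => h (congrArg _ hbc)) a e

theorem matrixUnit_mul_of_block_ne {i j : κ} (h : i ≠ j) (a b : Fin (r i + 1)) (c e : Fin (r j + 1)) :
    (matrixUnit i a b * matrixUnit j c e : BlockAlgebra r) = 0 := by
  funext k
  rw [matrixUnit, matrixUnit, Pi.mul_apply]
  by_cases hk : k = i
  · subst hk
    rw [Pi.single_eq_of_ne h, mul_zero]
    rfl
  · rw [Pi.single_eq_of_ne hk, zero_mul]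
    rfl

theorem eq_sum_matrixUnit [Fintype κ] (A : BlockAlgebra r) :
    A = ∑ i, ∑ a, ∑ b, A i a b • matrixUnit i a b := by
  conv_lhs => rw [← Finset.univ_sum_single A]
  refine Finset.sum_congr rfl fun i _ => ?_
  conv_lhs => rw [Matrix.matrix_eq_sum_single (A i)]
  have h : ∀ M : Matrix (Fin (r i + 1)) (Fin (r i + 1)) ℂ,
      (Pi.single i M : BlockAlgebra r) = LinearMap.single ℂ _ i M := fun M => rfl
  rw [h, map_sum]
  refine Finset.sum_congr rfl fun a _ => ?_
  rw [map_sum]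
  refine Finset.sum_congr rfl fun b _ => ?_
  rw [matrixUnit, h, ← map_smul, Matrix.smul_single, smul_eq_mul, mul_one]

/-- The root vectors of the simple roots: the matrix units above the diagonal. -/
def raisingUnit (k : Σ i, Fin (r i)) : BlockAlgebra r := matrixUnit k.1 k.2.castSucc k.2.succ

/-- The root vectors of the negative simple roots: the matrix units below the diagonal. -/
def loweringUnit (k : Σ i, Fin (r i)) : BlockAlgebra r := matrixUnit k.1 k.2.succ k.2.castSucc

/-- The Cartan matrix of a sum of special linear Lie algebras. -/
def cartan (k l : Σ i, Fin (r i)) : ℤ :=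
  if k.1 = l.1 then
    if (k.2 : ℕ) = l.2 then 2 else if (k.2 : ℕ) = l.2 + 1 ∨ (l.2 : ℕ) = k.2 + 1 then -1 else 0
  else 0

theorem isRootSystem_units : IsRootSystem (raisingUnit (r := r)) loweringUnit cartan where
  ef := by
    rintro ⟨i, k⟩ ⟨j, l⟩ hkl
    by_cases hij : i = j
    · subst hij
      have h : k ≠ l := fun h => hkl (by rw [h])
      rw [raisingUnit, loweringUnit, matrixUnit_mul_of_ne, matrixUnit_mul_of_ne, sub_zero]
      · simpa using h.symm
      · simpa using h
    · rw [raisingUnit, loweringUnit, matrixUnit_mul_of_block_ne hij,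
        matrixUnit_mul_of_block_ne (Ne.symm hij), sub_zero]
  he := by
    rintro ⟨i, k⟩ ⟨j, l⟩
    simp only [raisingUnit, loweringUnit, matrixUnit_mul, cartan]
    by_cases hij : i = j
    · subst hij
      simp only [sub_mul, mul_sub, matrixUnit_mul_eq_ite, Fin.val_castSucc, Fin.val_succ,
        Nat.add_right_cancel_iff]
      rcases eq_or_ne k l with rfl | hkl
      · simp
        module
      · have hne : ¬ (k : ℕ) = l := fun h => hkl (Fin.ext h)
        have hne' : ¬ (l : ℕ) = k := fun h => hne h.symm
        by_cases h1 : (k : ℕ) = l + 1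
        · have h2 : k.castSucc = l.succ := Fin.ext h1
          have h3 : ¬ (k : ℕ) + 1 = l := by omega
          simp [hne, hne', h1.symm, h2, h3]
        · by_cases h2 : (l : ℕ) = k + 1
          · have h3 : l.castSucc = k.succ := Fin.ext h2
            have h4 : ¬ (l : ℕ) + 1 = k := by omega
            simp [hne, hne', h2.symm, h3, h4]
          · have h3 : ¬ (l : ℕ) + 1 = k := fun h => h1 h.symm
            have h4 : ¬ (k : ℕ) + 1 = l := fun h => h2 h.symm
            simp [hne, hne', h1, h2, h3, h4]
    · simp only [sub_mul, mul_sub, matrixUnit_mul_of_block_ne hij,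
        matrixUnit_mul_of_block_ne (Ne.symm hij), if_neg hij]
      simp
  hf := by
    rintro ⟨i, k⟩ ⟨j, l⟩
    simp only [raisingUnit, loweringUnit, matrixUnit_mul, cartan]
    by_cases hij : i = j
    · subst hij
      simp only [sub_mul, mul_sub, matrixUnit_mul_eq_ite, Fin.val_castSucc, Fin.val_succ,
        Nat.add_right_cancel_iff]
      rcases eq_or_ne k l with rfl | hkl
      · simp
        module
      · have hne : ¬ (k : ℕ) = l := fun h => hkl (Fin.ext h)
        have hne' : ¬ (l : ℕ) = k := fun h => hne h.symm
        by_cases h1 : (k : ℕ) = l + 1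
        · have h2 : k.castSucc = l.succ := Fin.ext h1
          simp [hne, hne', h1.symm, h2]
          omega
        · by_cases h2 : (l : ℕ) = k + 1
          · have h3 : l.castSucc = k.succ := Fin.ext h2
            simp [hne, hne', h2.symm, h3]
            omega
          · simp [hne, hne', h1, h2]
    · simp only [sub_mul, mul_sub, matrixUnit_mul_of_block_ne hij,
        matrixUnit_mul_of_block_ne (Ne.symm hij), if_neg hij]
      simp

/-- A bracket-closed space containing the simple root vectors and the identities of the blocks is
everything. -/
theorem eq_top_of_root_vectors [Fintype κ] {W : Submodule ℂ (BlockAlgebra r)}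
    (hW : ∀ x ∈ W, ∀ y ∈ W, x * y - y * x ∈ W) (he : ∀ k, raisingUnit k ∈ W)
    (hf : ∀ k, loweringUnit k ∈ W) (h1 : ∀ i, (Pi.single i 1 : BlockAlgebra r) ∈ W) : W = ⊤ := by
  have hoff : ∀ i, ∀ n : ℕ, ∀ a b : Fin (r i + 1), (b : ℕ) = a + n + 1 →
      matrixUnit i a b ∈ W ∧ matrixUnit i b a ∈ W := by
    intro i n
    induction n with
    | zero =>
      intro a b hab
      obtain ⟨k, rfl⟩ : ∃ k : Fin (r i), k.castSucc = a := ⟨⟨a, by omega⟩, rfl⟩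
      obtain rfl : b = k.succ := Fin.ext (by simpa using hab)
      exact ⟨he ⟨i, k⟩, hf ⟨i, k⟩⟩
    | succ n ih =>
      intro a b hab
      obtain ⟨k, rfl⟩ : ∃ k : Fin (r i), k.succ = b :=
        ⟨⟨b - 1, by omega⟩, Fin.ext (by simp; omega)⟩
      have hk : (k : ℕ) = a + n + 1 := by
        rw [Fin.val_succ] at hab
        omega
      obtain ⟨i1, i2⟩ := ih a k.castSucc (by simpa using hk)
      have hne : a ≠ k.succ := by
        intro h
        rw [h] at hk
        simp at hk
        omega
      constructor
      · have := hW _ i1 _ (he ⟨i, k⟩)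
        rwa [raisingUnit, matrixUnit_mul, matrixUnit_mul_of_ne hne.symm, sub_zero] at this
      · have := hW _ (hf ⟨i, k⟩) _ i2
        rwa [loweringUnit, matrixUnit_mul, matrixUnit_mul_of_ne hne, sub_zero] at this
  have hoff' : ∀ i, ∀ a b : Fin (r i + 1), a ≠ b → matrixUnit i a b ∈ W := by
    intro i a b hab
    rcases lt_or_gt_of_ne (Fin.val_ne_of_ne hab) with h | h
    · exact (hoff i (b - a - 1) a b (by omega)).1
    · exact (hoff i (a - b - 1) b a (by omega)).2
  have hdiag : ∀ i, ∀ a : Fin (r i + 1), matrixUnit i a a ∈ W := by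
    intro i a
    have hd : ∀ b, matrixUnit i a a - matrixUnit i b b ∈ W := by
      intro b
      by_cases hab : a = b
      · subst hab
        simp
      · have := hW _ (hoff' i a b hab) _ (hoff' i b a (Ne.symm hab))
        rwa [matrixUnit_mul, matrixUnit_mul] at this
    have hone : (Pi.single i 1 : BlockAlgebra r) = ∑ b, matrixUnit i b b := by
      have h : ∀ M : Matrix (Fin (r i + 1)) (Fin (r i + 1)) ℂ,
        (Pi.single i M : BlockAlgebra r) = LinearMap.single ℂ _ i M := fun M => rfl
      simp only [matrixUnit]
      simp only [h]
      rw [← map_sum, Matrix.sum_single_one]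
    have hsum : ((r i + 1 : ℕ) : ℂ) • matrixUnit i a a =
        ∑ b, (matrixUnit i a a - matrixUnit i b b) + Pi.single i 1 := by
      rw [Finset.sum_sub_distrib, ← hone, sub_add_cancel, Finset.sum_const, Finset.card_univ,
        Fintype.card_fin, Nat.cast_smul_eq_nsmul]
    have := W.add_mem (W.sum_mem fun b (_ : b ∈ Finset.univ) => hd b) (h1 i)
    rw [← hsum] at this
    exact (W.smul_mem_iff (Nat.cast_ne_zero.2 (Nat.succ_ne_zero _))).1 this
  rw [eq_top_iff]
  intro A _
  rw [eq_sum_matrixUnit A]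
  refine W.sum_mem fun i _ => W.sum_mem fun a _ => W.sum_mem fun b _ => W.smul_mem _ ?_
  by_cases hab : a = b
  · exact hab ▸ hdiag i a
  · exact hoff' i a b hab

end Units

open scoped Matrix.Norms.L2Operator

/-! ### The group generated by simultaneous pulses in several sectors -/

section ControlGroup

variable {κ : Type*} {r : κ → ℕ}

/-- The interaction with phase `φ` in several sectors. -/
def blockInteraction (r : κ → ℕ) (w : κ → ℕ → ℝ) (φ : ℝ) : BlockAlgebra r :=
  fun i => sectorMatrix (r i + 1) (w i) φ

theorem star_blockInteraction (w : κ → ℕ → ℝ) (φ : ℝ) :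
    star blockInteraction r w φ = blockInteraction r w φ := by
  funext i
  ext a b
  have h1 : (starRingEnd ℂ) (Complex.exp (φ * Complex.I)) = Complex.exp (-(φ * Complex.I)) := by
    rw [← Complex.exp_conj]
    simp
  have h2 : (starRingEnd ℂ) (Complex.exp (-(φ * Complex.I))) = Complex.exp (φ * Complex.I) := by
    rw [← h1, Complex.conj_conj]
  simp only [Pi.star_apply, blockInteraction, Matrix.star_apply, sectorMatrix, Matrix.of_apply,
    star_add, Complex.star_def, apply_ite (starRingEnd ℂ), map_mul, Complex.conj_ofReal, h1, h2,
    map_zero]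
  rw [add_comm]

theorem blockInteraction_add_pi (w : κ → ℕ → ℝ) (φ : ℝ) :
    blockInteraction r w (φ + Real.pi) = -blockInteraction r w φ := by
  have h1 : Complex.exp ((φ + Real.pi : ℝ) * Complex.I) = -Complex.exp (φ * Complex.I) := by
    push_cast
    rw [add_mul, Complex.exp_add, Complex.exp_pi_mul_I, mul_neg_one]
  have h2 : Complex.exp (-((φ + Real.pi : ℝ) * Complex.I)) = -Complex.exp (-(φ * Complex.I)) := by
    rw [Complex.exp_neg, h1, Complex.exp_neg, inv_neg]
  funext i
  ext a b
  simp only [blockInteraction, sectorMatrix, Matrix.of_apply, h1, h2, Pi.neg_apply, Matrix.neg_apply]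
  split_ifs <;> ring

variable [Fintype κ]

/-- The simultaneous effect on several sectors of a pulse with phase `φ` and pulse area `t`. -/
def blockPulse (r : κ → ℕ) (w : κ → ℕ → ℝ) (φ t : ℝ) : unitary (BlockAlgebra r) :=
  ⟨NormedSpace.exp (t • (-Complex.I • blockInteraction r w φ)), by
    let : NormedAlgebra ℚ (BlockAlgebra r) := NormedAlgebra.restrictScalars ℚ ℂ _
    refine NormedSpace.exp_mem_unitary_of_mem_skewAdjoint ?_
    rw [skewAdjoint.mem_iff, star_smul, star_smul]
    refine (congrArg _ (congrArg _ (star_blockInteraction w φ))).trans ?_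
    simp⟩

theorem hasStrictDerivAt_blockPulse (r : κ → ℕ) (w : κ → ℕ → ℝ) (φ t : ℝ) :
    HasStrictDerivAt (fun t => (blockPulse r w φ t : BlockAlgebra r))
      ((-Complex.I • blockInteraction r w φ) * (blockPulse r w φ t : BlockAlgebra r)) t :=
  hasStrictDerivAt_exp_smul_const' _ t

theorem blockPulse_zero (w : κ → ℕ → ℝ) (φ : ℝ) :
    blockPulse r w φ 0 = 1 := by
  ext1
  simp [blockPulse]

theorem blockPulse_neg (w : κ → ℕ → ℝ) (φ t : ℝ) :
    blockPulse r w φ (-t) = (blockPulse r w φ t)⁻¹ := by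
  refine eq_inv_of_mul_eq_one_left ?_
  ext1
  simp only [blockPulse, neg_smul, Submonoid.coe_mul, OneMemClass.coe_one]
  let : NormedAlgebra ℚ (BlockAlgebra r) := NormedAlgebra.restrictScalars ℚ ℂ _
  rw [← NormedSpace.exp_add_of_commute]
  · simp
  · exact (Commute.refl _).neg_left

theorem blockPulse_add_pi (w : κ → ℕ → ℝ) (φ t : ℝ) :
    blockPulse r w (φ + Real.pi) t = blockPulse r w φ (-t) := by
  ext1
  simp only [blockPulse, blockInteraction_add_pi]
  congr 1
  module

/-- The group of the simultaneous effects of all sequences of pulses. -/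
def pulseGroup (r : κ → ℕ) (w : κ → ℕ → ℝ) : Subgroup (unitary (BlockAlgebra r)) :=
  Subgroup.closure {u | ∃ φ t, u = blockPulse r w φ t}

theorem sectorMatrix_congr {d : ℕ} {w w' : ℕ → ℝ} (h : ∀ j < d, w j = w' j) (φ : ℝ) :
    sectorMatrix (d + 1) w φ = sectorMatrix (d + 1) w' φ := by
  ext a b
  simp only [sectorMatrix, Matrix.of_apply]
  congr 1
  · split_ifs with hab
    · rw [h b (by omega)]
    · rfl
  · split_ifs with hab
    · rw [h a (by omega)]
    · rfl

/-- The evolution `V` acts as `u` on all ladders with the sizes `r i + 1` and couplings `w i`, and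
fixes the states which are not coupled. -/
structure Implements {n : ℕ} (w : κ → ℕ → ℝ) (V : JointSpace n ≃ₗᵢ[ℂ] JointSpace n)
    (u : BlockAlgebra r) : Prop where
  sector : ∀ (i : κ) (v : ℕ → Bits n → ℂ) (α : ℕ → ℝ) (m : ℝ), IsLadder (r i + 1) v α m →
    (∀ j < r i, coupling α j = w i j) → ∀ x, V (Core.toJoint n (sectorMap (r i + 1) v x)) =
      Core.toJoint n (sectorMap (r i + 1) v ((u i).mulVec x))
  fixed : ∀ (v : ℕ → Bits n → ℂ) (α : ℕ → ℝ) (m : ℝ), IsLadder 1 v α m →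
    V (Core.toJoint n (ket (v 0) 0)) = Core.toJoint n (ket (v 0) 0)

theorem Implements.phasedPulse {n : ℕ} {w : κ → ℕ → ℝ}
    {V : JointSpace n ≃ₗᵢ[ℂ] JointSpace n} {u : BlockAlgebra r} (h : Implements w V u)
    {g ω : ℝ} (hω : ω ≠ 0) (φ t : ℝ) :
    Implements w (V.trans (phasedPulse n g ω φ t)) ((blockPulse r w φ (g * t) : BlockAlgebra r) * u) where
  sector i v α m hv hα x := by
    rw [LinearIsometryEquiv.trans_apply, h.sector i v α m hv hα]
    have hM : sectorMatrix (r i + 1) (coupling α) φ = blockInteraction r w φ i := sectorMatrix_congr hα φ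
    let ev : BlockAlgebra r →ₗ[ℝ] (Fin (r i + 1) → ℂ) :=
      { toFun := fun A => (A i).mulVec ((u i).mulVec x)
        map_add' := fun A B => by rw [Pi.add_apply, Matrix.add_mulVec]
        map_smul' := fun c A => by rw [Pi.smul_apply, Matrix.smul_mulVec, RingHom.id_apply] }
    have hd : ∀ t, HasDerivAt (fun t => ev (blockPulse r w φ (g * t)))
        (-Complex.I • ((g : ℂ) • sectorMatrix (r i + 1) (coupling α) φ).mulVec
          (ev (blockPulse r w φ (g * t)))) t := by
      intro t
      have h0 : HasDerivAt (fun t => g * t) g t := by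
        simpa using (hasDerivAt_id t).const_mul g
      have h1 := (hasStrictDerivAt_blockPulse r w φ (g * t)).hasDerivAt.scomp t h0
      refine ((LinearMap.toContinuousLinearMap ev).hasFDerivAt.comp_hasDerivAt t h1).congr_deriv ?_
      rw [hM]
      change ev (g • ((-Complex.I • blockInteraction r w φ) * _)) = _
      rw [map_smul]
      simp only [ev, LinearMap.coe_mk, AddHom.coe_mk, Pi.mul_apply, ← Matrix.mulVec_mulVec,
        Pi.smul_apply, Matrix.smul_mulVec]
      rw [← Complex.coe_smul, smul_comm]
    have := phasedPulse_sectorMap hv hω φ hd t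
    rw [mul_zero, blockPulse_zero] at this
    simpa [ev] using this
  fixed v α m hv := by
    rw [LinearIsometryEquiv.trans_apply, h.fixed v α m hv, phasedPulse_singleton hv hω]

theorem exists_implements {n : ℕ} {w : κ → ℕ → ℝ} {g ω : ℝ} (hg : 0 < g) (hω : ω ≠ 0)
    {u : unitary (BlockAlgebra r)} (hu : u ∈ pulseGroup r w) :
    ∃ (V : JointSpace n ≃ₗᵢ[ℂ] JointSpace n) (τ : ℝ), Reachable g ω V τ ∧
      Implements w V (u : BlockAlgebra r) := by
  have hstep : ∀ (φ t : ℝ) (u : unitary (BlockAlgebra r)),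
      (∃ (V : JointSpace n ≃ₗᵢ[ℂ] JointSpace n) (τ : ℝ), Reachable g ω V τ ∧
        Implements w V (u : BlockAlgebra r)) →
      ∃ (V : JointSpace n ≃ₗᵢ[ℂ] JointSpace n) (τ : ℝ), Reachable g ω V τ ∧
        Implements w V ((blockPulse r w φ t * u : unitary (BlockAlgebra r)) : BlockAlgebra r) := by
    have hpos : ∀ (φ t : ℝ) (u : unitary (BlockAlgebra r)), 0 ≤ t →
        (∃ (V : JointSpace n ≃ₗᵢ[ℂ] JointSpace n) (τ : ℝ), Reachable g ω V τ ∧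
          Implements w V (u : BlockAlgebra r)) →
        ∃ (V : JointSpace n ≃ₗᵢ[ℂ] JointSpace n) (τ : ℝ), Reachable g ω V τ ∧
          Implements w V ((blockPulse r w φ t * u : unitary (BlockAlgebra r)) : BlockAlgebra r) := by
      rintro φ t u ht ⟨V, τ, hV, hVu⟩
      have := hVu.phasedPulse (g := g) hω φ (t / g)
      rw [mul_div_cancel₀ _ hg.ne'] at this
      exact ⟨_, _, hV.phasedPulse φ (div_nonneg ht hg.le), this⟩
    intro φ t u h
    rcases le_total 0 t with ht | ht
    · exact hpos φ t u ht h
    · have := hpos (φ + Real.pi) (-t) u (neg_nonneg.2 ht) h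
      rwa [blockPulse_add_pi, neg_neg] at this
  induction hu using Subgroup.closure_induction_left with
  | one =>
    refine ⟨_, _, Reachable.refl g ω, ?_, fun _ _ _ _ => rfl⟩
    intro i v α m _ _ x
    simp
  | mul_left y hy z hz ih =>
    obtain ⟨φ, t, rfl⟩ := hy
    exact hstep φ t _ ih
  | inv_mul_cancel y hy z hz ih =>
    obtain ⟨φ, t, rfl⟩ := hy
    rw [← blockPulse_neg]
    exact hstep φ (-t) _ ih

/-- Diagonal unitaries. -/
def diagonalPath (θ : (i : κ) → Fin (r i + 1) → ℝ) (t : ℝ) : unitary (BlockAlgebra r) :=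
  ⟨fun i => Matrix.diagonal fun a => Complex.exp ((t * θ i a : ℝ) * Complex.I), by
    have h : ∀ x : ℝ, star (Complex.exp (x * Complex.I)) * Complex.exp (x * Complex.I) = 1 := by
      intro x
      rw [Complex.star_def, ← Complex.exp_conj, ← Complex.exp_add]
      simp
    rw [Unitary.mem_iff]
    constructor
    · funext i
      simp only [Pi.mul_apply, Pi.star_apply, Matrix.star_eq_conjTranspose,
        Matrix.diagonal_conjTranspose, Matrix.diagonal_mul_diagonal, Pi.one_apply, h,
        Matrix.diagonal_one]
    · funext i
      simp only [Pi.mul_apply, Pi.star_apply, Matrix.star_eq_conjTranspose,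
        Matrix.diagonal_conjTranspose, Matrix.diagonal_mul_diagonal, Pi.one_apply,
        mul_comm _ (star (Complex.exp _)), h, Matrix.diagonal_one]⟩

theorem hasStrictDerivAt_diagonalPath (θ : (i : κ) → Fin (r i + 1) → ℝ) (t : ℝ) :
    HasStrictDerivAt (fun t => (diagonalPath θ t : BlockAlgebra r))
      (fun i => Matrix.diagonal fun a => Complex.exp ((t * θ i a : ℝ) * Complex.I) *
        (θ i a * Complex.I)) t := by
  let D : ((i : κ) → Fin (r i + 1) → ℂ) →ₗ[ℝ] BlockAlgebra r :=
    { toFun := fun x i => Matrix.diagonal (x i)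
      map_add' := fun x y => by
        funext i
        simp
      map_smul' := fun c x => by
        funext i
        simp }
  have h : HasStrictDerivAt (fun t : ℝ => fun (i : κ) (a : Fin (r i + 1)) =>
      Complex.exp ((t * θ i a : ℝ) * Complex.I)) (fun i a =>
        Complex.exp ((t * θ i a : ℝ) * Complex.I) * (θ i a * Complex.I)) t := by
    rw [hasStrictDerivAt_pi]
    intro i
    rw [hasStrictDerivAt_pi]
    intro a
    have h1 : HasStrictDerivAt (fun t : ℝ => ((t * θ i a : ℝ) : ℂ) * Complex.I)
        (θ i a * Complex.I) t := by
      have h2 : HasStrictDerivAt (fun t : ℝ => t • ((θ i a : ℂ) * Complex.I))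
          ((1 : ℝ) • ((θ i a : ℂ) * Complex.I)) t :=
        (hasStrictDerivAt_id t).smul_const _
      rw [one_smul] at h2
      convert h2 using 2 with s
      rw [Complex.real_smul]
      push_cast
      ring
    exact h1.cexp
  exact (LinearMap.toContinuousLinearMap D).hasStrictFDerivAt.comp_hasStrictDerivAt t h

theorem diagonalPath_zero (θ : (i : κ) → Fin (r i + 1) → ℝ) : diagonalPath θ 0 = 1 := by
  ext1
  funext i
  simp [diagonalPath]

theorem continuous_diagonalPath (θ : (i : κ) → Fin (r i + 1) → ℝ) : Continuous (diagonalPath θ) :=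
  continuous_induced_rng.2 (continuous_iff_continuousAt.2 fun t =>
    (hasStrictDerivAt_diagonalPath θ t).hasDerivAt.continuousAt)

/-- The unitaries `1 + (e^{it} - 1) Q` for a projection `Q`. -/
def projectionPath (Q : BlockAlgebra r) (hs : star Q = Q) (hQ : Q * Q = Q) (t : ℝ) :
    unitary (BlockAlgebra r) :=
  ⟨1 + (Complex.exp (t * Complex.I) - 1) • Q, by
    have h : star (Complex.exp (t * Complex.I)) * Complex.exp (t * Complex.I) = 1 := by
      rw [Complex.star_def, ← Complex.exp_conj, ← Complex.exp_add]
      simp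
    rw [Unitary.mem_iff]
    have e1 : (star (Complex.exp (t * Complex.I)) - 1) * (Complex.exp (t * Complex.I) - 1) =
        (1 - star (Complex.exp (t * Complex.I))) + (1 - Complex.exp (t * Complex.I)) := by
      linear_combination h
    have e2 : ∀ x y : ℂ, (1 + x • Q) * (1 + y • Q) = 1 + (x + y + x * y) • Q := by
      intro x y
      simp only [add_mul, mul_add, one_mul, mul_one, smul_mul_assoc, mul_smul_comm, hQ]
      module
    have e3 : ∀ x : ℂ, x = 0 → (1 + x • Q : BlockAlgebra r) = 1 := by
      rintro x rfl
      simp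
    rw [star_add, star_one, star_smul, hs, star_sub, star_one, e2, e2]
    exact ⟨e3 _ (by linear_combination e1), e3 _ (by linear_combination e1)⟩⟩

theorem continuous_projectionPath (Q : BlockAlgebra r) (hs : star Q = Q) (hQ : Q * Q = Q) :
    Continuous (projectionPath Q hs hQ) := by
  refine continuous_induced_rng.2 ?_
  have : Continuous fun t : ℝ => (1 + (Complex.exp (t * Complex.I) - 1) • Q : BlockAlgebra r) := by
    fun_prop
  exact this

theorem projectionPath_zero (Q : BlockAlgebra r) (hs : star Q = Q) (hQ : Q * Q = Q) :
    projectionPath Q hs hQ 0 = 1 := by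
  ext1
  simp [projectionPath]

/-- The projections on `e₀ - e_last` in all blocks. -/
def antisymmetricProjection (r : κ → ℕ) : BlockAlgebra r := fun i =>
  (1 / 2 : ℂ) • Matrix.vecMulVec (Pi.single 0 1 - Pi.single (Fin.last (r i)) 1)
    (Pi.single 0 1 - Pi.single (Fin.last (r i)) 1)

theorem star_antisymmetricProjection :
    star (antisymmetricProjection r) = antisymmetricProjection r := by
  funext i
  have : star (Pi.single 0 1 - Pi.single (Fin.last (r i)) 1 : Fin (r i + 1) → ℂ) =
      Pi.single 0 1 - Pi.single (Fin.last (r i)) 1 := by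
    rw [star_sub, ← Pi.single_star, ← Pi.single_star, star_one]
  simp [antisymmetricProjection, Matrix.star_eq_conjTranspose,
    Matrix.conjTranspose_vecMulVec, this]

theorem antisymmetricProjection_mul_self (hr : ∀ i, r i ≠ 0) :
    antisymmetricProjection r * antisymmetricProjection r = antisymmetricProjection r := by
  funext i
  have h : (0 : Fin (r i + 1)) ≠ Fin.last (r i) := by
    intro h
    exact hr i (congrArg Fin.val h).symm
  simp only [antisymmetricProjection, Pi.mul_apply, Matrix.smul_mul, Matrix.mul_smul,
    Matrix.vecMulVec_mul_vecMulVec]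
  have h2 : (Pi.single 0 1 - Pi.single (Fin.last (r i)) 1 : Fin (r i + 1) → ℂ) ⬝ᵥ
      (Pi.single 0 1 - Pi.single (Fin.last (r i)) 1) = 2 := by
    simp [dotProduct_sub, h, h.symm]
    norm_num
  rw [h2, Matrix.vecMulVec_smul]
  simp only [smul_smul]
  norm_num

/-- The exchange of `e₀` and `e_last` in all blocks. -/
theorem projectionPath_pi_mulVec (hr : ∀ i, r i ≠ 0) (i : κ) (x : Fin (r i + 1) → ℂ) :
    ((projectionPath (antisymmetricProjection r) star_antisymmetricProjection
      (antisymmetricProjection_mul_self hr) Real.pi : BlockAlgebra r) i).mulVec x =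
      x - (x 0 - x (Fin.last (r i))) • (Pi.single 0 1 - Pi.single (Fin.last (r i)) 1) := by
  simp only [projectionPath, Complex.exp_pi_mul_I, Pi.add_apply, Pi.one_apply, Pi.smul_apply,
    antisymmetricProjection, Matrix.add_mulVec, Matrix.one_mulVec, Matrix.smul_mulVec,
    Matrix.vecMulVec_mulVec]
  have : (Pi.single 0 1 - Pi.single (Fin.last (r i)) 1 : Fin (r i + 1) → ℂ) ⬝ᵥ x =
      x 0 - x (Fin.last (r i)) := by
    simp [sub_dotProduct]
  rw [this]
  simp only [op_smul_eq_smul]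
  module

/-- Commutators of elements of a group extended by central elements lie in the group. -/
theorem commutator_mem_of_mem_sup_center {M : Type*} [Group M] {G : Subgroup M} {x y : M}
    (hx : x ∈ G ⊔ Subgroup.center M) (hy : y ∈ G ⊔ Subgroup.center M) :
    x * y * x⁻¹ * y⁻¹ ∈ G := by
  rw [Subgroup.mem_sup_of_normal_right] at hx hy
  obtain ⟨a, ha, z, hz, rfl⟩ := hx
  obtain ⟨b, hb, z', hz', rfl⟩ := hy
  rw [Subgroup.mem_center_iff] at hz hz'
  have : a * z * (b * z') * (a * z)⁻¹ * (b * z')⁻¹ = a * b * a⁻¹ * b⁻¹ := by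
    have e1 : a * z * (b * z') = a * b * (z * z') := by
      rw [mul_assoc, ← mul_assoc z, ← hz b]
      group
    have e2 : (b * z') * (a * z) = b * a * (z * z') := by
      rw [mul_assoc, ← mul_assoc z', ← hz' a, mul_assoc a, ← hz z']
      group
    have e3 : (a * z)⁻¹ * (b * z')⁻¹ = (z * z')⁻¹ * (b * a)⁻¹ := by
      rw [← mul_inv_rev, e2, mul_inv_rev]
    rw [mul_assoc, e3, e1]
    group
  rw [this]
  exact G.mul_mem (G.mul_mem (G.mul_mem ha hb) (G.inv_mem ha)) (G.inv_mem hb)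

/-- If pulses and central unitaries generate everything, then arbitrary phases of the first basis
vectors of the blocks are produced by pulses alone: take the commutator of a diagonal unitary with
an exchange of basis vectors. -/
theorem exists_pulses_phases {w : κ → ℕ → ℝ} (hr : ∀ i, r i ≠ 0)
    (h : Submodule.span ℂ (tangentSpace (pulseGroup r w ⊔ Subgroup.center _) :
      Set (BlockAlgebra r)) = ⊤) (θ : κ → ℝ) :
    ∃ u ∈ pulseGroup r w, ∀ i, ((u : BlockAlgebra r) i).mulVec (Pi.single 0 1) =
      Pi.single 0 (Complex.exp (θ i * Complex.I)) := by
  have hG := fun X : BlockAlgebra r => mem_tangentSpace_of_span_eq_top h (K := X)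
  have h0 : ∀ i, (0 : Fin (r i + 1)) ≠ Fin.last (r i) := fun i h => hr i (congrArg Fin.val h).symm
  set D := diagonalPath (r := r) (fun i => Pi.single 0 (θ i)) 1 with hD
  set S := projectionPath (antisymmetricProjection r) star_antisymmetricProjection
      (antisymmetricProjection_mul_self hr) Real.pi with hS
  have hDG := mem_of_continuous_path _ hG (continuous_diagonalPath (r := r) fun i => Pi.single 0 (θ i))
    (diagonalPath_zero _) 1
  have hSG := mem_of_continuous_path _ hG (continuous_projectionPath (antisymmetricProjection r)
    star_antisymmetricProjection (antisymmetricProjection_mul_self hr)) (projectionPath_zero _ _ _)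
    Real.pi
  refine ⟨D * S * D⁻¹ * S⁻¹, commutator_mem_of_mem_sup_center hDG hSG, fun i => ?_⟩
  have s0 : ((S : BlockAlgebra r) i).mulVec (Pi.single 0 1) = Pi.single (Fin.last (r i)) 1 := by
    rw [hS, projectionPath_pi_mulVec hr]
    simp [h0 i]
  have s1 : ((S : BlockAlgebra r) i).mulVec (Pi.single (Fin.last (r i)) 1) = Pi.single 0 1 := by
    rw [hS, projectionPath_pi_mulVec hr]
    simp [h0 i]
  have d0 : ((D : BlockAlgebra r) i).mulVec (Pi.single 0 1) =
      Pi.single 0 (Complex.exp (θ i * Complex.I)) := by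
    simp [hD, diagonalPath]
  have d1 : ((D : BlockAlgebra r) i).mulVec (Pi.single (Fin.last (r i)) 1) =
      Pi.single (Fin.last (r i)) 1 := by
    simp [hD, diagonalPath, (h0 i).symm]
  have hinv : ∀ (u : unitary (BlockAlgebra r)) (x y : Fin (r i + 1) → ℂ),
      ((u : BlockAlgebra r) i).mulVec x = y → (((u⁻¹ : unitary _) : BlockAlgebra r) i).mulVec y = x := by
    rintro u x y rfl
    have h1 := congrFun (congrArg Subtype.val (inv_mul_cancel u)) i
    simp only [Submonoid.coe_mul, Pi.mul_apply, OneMemClass.coe_one, Pi.one_apply] at h1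
    rw [Matrix.mulVec_mulVec, h1, Matrix.one_mulVec]
  simp only [Submonoid.coe_mul, Pi.mul_apply, ← Matrix.mulVec_mulVec]
  rw [hinv S _ _ s1, hinv D _ _ d1, s1, d0]

end ControlGroup

/-! ### Generation by the two halves of the interaction -/

section Generation

variable {κ : Type*} [Fintype κ] [DecidableEq κ] {r : κ → ℕ}

theorem sum_smul_raisingUnit (w : κ → ℕ → ℝ) :
    (∑ k : Σ i, Fin (r i), (w k.1 k.2 : ℂ) • (raisingUnit k : BlockAlgebra r)) = fun i =>
      Matrix.of fun a b : Fin (r i + 1) => if (b : ℕ) = a + 1 then (w i a : ℂ) else 0 := by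
  funext i
  ext a b
  rw [Fintype.sum_sigma, Finset.sum_apply, Matrix.sum_apply, Finset.sum_eq_single i]
  · simp only [Finset.sum_apply, Matrix.sum_apply, Pi.smul_apply, raisingUnit, matrixUnit,
      Pi.single_eq_same, Matrix.smul_apply, Matrix.of_apply, Matrix.single_apply, smul_eq_mul]
    split_ifs with h
    · rw [Finset.sum_eq_single ⟨a, by omega⟩]
      · rw [if_pos ⟨Fin.ext rfl, Fin.ext h.symm⟩, mul_one]
      · intro k _ hk
        rw [if_neg, mul_zero]
        rintro ⟨rfl, -⟩
        exact hk (Fin.ext rfl)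
      · simp
    · refine Finset.sum_eq_zero fun k _ => ?_
      rw [if_neg, mul_zero]
      rintro ⟨rfl, rfl⟩
      exact h rfl
  · intro j _ hj
    simp [raisingUnit, matrixUnit, Pi.single_eq_of_ne hj.symm, Finset.sum_apply]
  · simp

theorem sum_smul_loweringUnit (w : κ → ℕ → ℝ) :
    (∑ k : Σ i, Fin (r i), (w k.1 k.2 : ℂ) • (loweringUnit k : BlockAlgebra r)) = fun i =>
      Matrix.of fun a b : Fin (r i + 1) => if (a : ℕ) = b + 1 then (w i b : ℂ) else 0 := by
  have h : ∀ k : Σ i, Fin (r i), (loweringUnit k : BlockAlgebra r) = fun i => (raisingUnit k i).transpose := by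
    intro k
    funext i
    by_cases hi : i = k.1
    · subst hi
      simp [raisingUnit, loweringUnit, matrixUnit]
    · simp [raisingUnit, loweringUnit, matrixUnit, Pi.single_eq_of_ne hi]
  have h2 := sum_smul_raisingUnit (r := r) w
  funext i
  have h3 := congrArg Matrix.transpose (congrFun h2 i)
  rw [Finset.sum_apply, Matrix.transpose_sum] at h3
  rw [Finset.sum_apply]
  refine Eq.trans ?_ (h3.trans rfl)
  simp [h]

theorem blockInteraction_eq (w : κ → ℕ → ℝ) (φ : ℝ) :
    blockInteraction r w φ =
      Complex.exp (φ * Complex.I) • ∑ k : Σ i, Fin (r i), (w k.1 k.2 : ℂ) • loweringUnit k +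
      Complex.exp (-(φ * Complex.I)) • ∑ k : Σ i, Fin (r i), (w k.1 k.2 : ℂ) • raisingUnit k := by
  rw [sum_smul_raisingUnit, sum_smul_loweringUnit]
  funext i
  ext a b
  simp [blockInteraction, sectorMatrix, mul_comm]

/-- The generators of the centre are tangent to the group extended by it. -/
theorem single_one_mem_tangentSpace (G : Subgroup (unitary (BlockAlgebra r))) (i : κ) :
    Complex.I • (Pi.single i 1 : BlockAlgebra r) ∈ tangentSpace (G ⊔ Subgroup.center _) := by
  let θ : (j : κ) → Fin (r j + 1) → ℝ := fun j _ => if j = i then 1 else 0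
  refine ⟨diagonalPath θ, fun t => ?_, diagonalPath_zero _, ?_⟩
  · refine Subgroup.mem_sup_right (Subgroup.mem_center_iff.2 fun u => ?_)
    ext1
    funext j
    simp only [Submonoid.coe_mul, Pi.mul_apply, diagonalPath, θ]
    rw [← Matrix.smul_one_eq_diagonal]
    simp
  · refine (hasStrictDerivAt_diagonalPath θ 0).congr_deriv ?_
    funext j
    by_cases hj : j = i
    · subst hj
      simp [θ, ← Matrix.smul_one_eq_diagonal]
    · simp [θ, hj]

/-- Pulses and central unitaries generate everything, if the eigenvalues of the bracket with the
commutator of the two halves of the interaction separate the simple roots, up to coincidences which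
are resolved by an already separated root. -/
theorem span_tangentSpace_eq_top {w : κ → ℕ → ℝ} {w2 : (Σ i, Fin (r i)) → ℤ}
    (hw : ∀ k : Σ i, Fin (r i), w k.1 k.2 * w k.1 k.2 = w2 k) (hne : ∀ k, w2 k ≠ 0)
    (hsep : ∀ l, ∃ k : Σ i, Fin (r i),
      (∀ l', ∑ p, w2 p * cartan p l' = ∑ p, w2 p * cartan p k → l' = k) ∧
      ∀ l', ∑ p, w2 p * cartan p l' = ∑ p, w2 p * cartan p l → cartan k l' = cartan k l → l' = l) :
    Submodule.span ℂ (tangentSpace (pulseGroup r w ⊔ Subgroup.center _) :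
      Set (BlockAlgebra r)) = ⊤ := by
  set W := Submodule.span ℂ (tangentSpace (pulseGroup r w ⊔ Subgroup.center _) :
      Set (BlockAlgebra r)) with hWdef
  have hW : ∀ x ∈ W, ∀ y ∈ W, x * y - y * x ∈ W := fun x hx y hy =>
    bracket_mem_span_tangentSpace hx hy
  have hX : ∀ φ, blockInteraction r w φ ∈ W := by
    intro φ
    have h1 : -Complex.I • blockInteraction r w φ ∈
        tangentSpace (pulseGroup r w ⊔ Subgroup.center _) := by
      refine ⟨blockPulse r w φ, fun t => ?_, blockPulse_zero w φ, ?_⟩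
      · exact Subgroup.mem_sup_left (Subgroup.subset_closure ⟨φ, t, rfl⟩)
      · refine (hasStrictDerivAt_blockPulse r w φ 0).congr_deriv ?_
        rw [blockPulse_zero, OneMemClass.coe_one, mul_one]
    have h2 := W.smul_mem Complex.I (Submodule.subset_span h1)
    rw [smul_smul] at h2
    simpa using h2
  have h1 : ∀ i, (Pi.single i 1 : BlockAlgebra r) ∈ W := by
    intro i
    have h2 := W.smul_mem (-Complex.I) (Submodule.subset_span (single_one_mem_tangentSpace
      (pulseGroup r w) i))
    rw [smul_smul] at h2
    simpa using h2
  have e0 := blockInteraction_eq (r := r) w 0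
  have e1 := blockInteraction_eq (r := r) w (Real.pi / 2)
  set E := ∑ k : Σ i, Fin (r i), (w k.1 k.2 : ℂ) • (raisingUnit k : BlockAlgebra r) with hE
  set F := ∑ k : Σ i, Fin (r i), (w k.1 k.2 : ℂ) • (loweringUnit k : BlockAlgebra r) with hF
  have hI : Complex.exp ((Real.pi / 2 : ℝ) * Complex.I) = Complex.I := by
    push_cast
    exact Complex.exp_pi_div_two_mul_I
  rw [Complex.exp_neg, hI, Complex.inv_I] at e1
  simp only [Complex.ofReal_zero, zero_mul, neg_zero, Complex.exp_zero, one_smul] at e0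
  have hEW : E ∈ W := by
    have : E = (1 / 2 : ℂ) • (blockInteraction r w 0 +
        Complex.I • blockInteraction r w (Real.pi / 2)) := by
      rw [e0, e1, smul_add Complex.I, smul_smul, smul_smul, mul_neg, Complex.I_mul_I]
      module
    rw [this]
    exact W.smul_mem _ (W.add_mem (hX _) (W.smul_mem _ (hX _)))
  have hFW : F ∈ W := by
    have : F = (1 / 2 : ℂ) • (blockInteraction r w 0 -
        Complex.I • blockInteraction r w (Real.pi / 2)) := by
      rw [e0, e1, smul_add Complex.I, smul_smul, smul_smul, mul_neg, Complex.I_mul_I]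
      module
    rw [this]
    exact W.smul_mem _ (W.sub_mem (hX _) (W.smul_mem _ (hX _)))
  have hw' : ∀ k : Σ i, Fin (r i), (w k.1 k.2 : ℂ) * (w k.1 k.2 : ℂ) = w2 k := fun k => by
    exact_mod_cast hw k
  have hw0 : ∀ k : Σ i, Fin (r i), (w k.1 k.2 : ℂ) ≠ 0 := by
    intro k h0
    have := hw' k
    rw [h0, zero_mul] at this
    exact hne k (by exact_mod_cast this.symm)
  -- the same argument for the raising and for the lowering root vectors
  have key : ∀ e f : (Σ i, Fin (r i)) → BlockAlgebra r, IsRootSystem e f cartan →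
      (∑ k, (w k.1 k.2 : ℂ) • e k) ∈ W → (∑ k, (w k.1 k.2 : ℂ) • f k) ∈ W → ∀ l, e l ∈ W := by
    intro e f h he hf
    have hu : ∀ e f : (Σ i, Fin (r i)) → BlockAlgebra r, IsRootSystem e f cartan →
      (∑ k, (w k.1 k.2 : ℂ) • e k) ∈ W → (∑ k, (w k.1 k.2 : ℂ) • f k) ∈ W →
        ∀ k, (∀ l', ∑ p, w2 p * cartan p l' = ∑ p, w2 p * cartan p k → l' = k) → e k ∈ W := by
      intro e f h he hf k hk
      have := h.weight_component_mem hW hw' he hf (∑ p, w2 p * cartan p k)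
      rw [Finset.sum_filter, Finset.sum_eq_single k] at this
      · rw [if_pos rfl] at this
        exact (W.smul_mem_iff (hw0 k)).1 this
      · intro l _ hl
        rw [if_neg fun hlk => hl (hk l hlk)]
      · simp
    intro l
    obtain ⟨k, hk, hkl⟩ := hsep l
    have hh := hW _ (hu e f h he hf k hk) _ (hu f e h.symm hf he k hk)
    have hc := h.weight_component_mem hW hw' he hf (∑ p, w2 p * cartan p l)
    have := eigen_component_mem (T := LinearMap.mulLeft ℂ (e k * f k - f k * e k) -
      LinearMap.mulRight ℂ (e k * f k - f k * e k)) (fun x hx => hW _ hh x hx) _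
      (x := fun l => (w l.1 l.2 : ℂ) • e l) (ev := fun l => (cartan k l : ℂ)) (fun l _ => ?_) hc
      (cartan k l)
    · rw [Finset.sum_filter, Finset.sum_filter, Finset.sum_eq_single l] at this
      · rw [if_pos rfl, if_pos rfl] at this
        exact (W.smul_mem_iff (hw0 l)).1 this
      · intro l' _ hl
        split_ifs with h1 h2
        · exact absurd (hkl l' h1 (by exact_mod_cast h2)) hl
        · rfl
        · rfl
      · simp
    · simp only [LinearMap.sub_apply, LinearMap.mulLeft_apply, LinearMap.mulRight_apply,
        smul_mul_assoc, mul_smul_comm]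
      rw [← smul_sub, h.he, smul_comm]
  exact eq_top_of_root_vectors hW (key _ _ isRootSystem_units hEW hFW)
    (key _ _ isRootSystem_units.symm hFW hEW) h1

end Generation

/-- The dimensions, minus one, of the coupled sectors of three qubits: the sector of a pair of spins
`1/2` and one excitation, and the sectors of the spin `3/2` with one, two and three excitations. -/
def sectorRank : Fin 4 → ℕ := ![1, 1, 2, 3]

/-- The squares of the couplings in these sectors. -/
def sectorCouplingSq : Fin 4 → ℕ → ℤ :=
  ![fun j => (j + 1) * (1 - j), fun j => (j + 1) * ((j + 3) * (1 - j)),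
    fun j => (j + 1) * ((j + 2) * (2 - j)), fun j => (j + 1) * ((j + 1) * (3 - j))]

theorem sectorCouplingSq_pos : ∀ k : Σ i, Fin (sectorRank i), 0 < sectorCouplingSq k.1 k.2 := by
  decide

set_option maxRecDepth 10000 in
/-- The bracket with the commutator of the two halves of the interaction has the eigenvalues `2`; `6`;
`2, 8`; `-2, 4, 10` on the simple root vectors of the four sectors. The coincidence is resolved by the
root of eigenvalue `8`. -/
theorem sectorCouplingSq_separates (l : Σ i, Fin (sectorRank i)) : ∃ k : Σ i, Fin (sectorRank i),
      (∀ l', ∑ p : Σ i, Fin (sectorRank i), sectorCouplingSq p.1 p.2 * cartan p l' =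
        ∑ p : Σ i, Fin (sectorRank i), sectorCouplingSq p.1 p.2 * cartan p k → l' = k) ∧
      ∀ l', ∑ p : Σ i, Fin (sectorRank i), sectorCouplingSq p.1 p.2 * cartan p l' =
        ∑ p : Σ i, Fin (sectorRank i), sectorCouplingSq p.1 p.2 * cartan p l →
          cartan k l' = cartan k l → l' = l := by
  revert l
  decide

/-! ### Three qubits -/

theorem update_zero_three (a b c e : Fin 2) : Function.update ![a, b, c] 0 e = ![e, b, c] := by
  ext i; fin_cases i <;> rfl

theorem update_one_three (a b c e : Fin 2) : Function.update ![a, b, c] 1 e = ![a, e, c] := by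
  ext i; fin_cases i <;> rfl

theorem update_two_three (a b c e : Fin 2) : Function.update ![a, b, c] 2 e = ![a, b, e] := by
  ext i; fin_cases i <;> rfl

theorem Jminus_three (a b c : Fin 2) : (Jminus 3).mulVec (Pi.single ![a, b, c] 1) =
    (if a = 0 then Pi.single ![1, b, c] (1 : ℂ) else 0) +
      (if b = 0 then Pi.single ![a, 1, c] (1 : ℂ) else 0) +
      (if c = 0 then Pi.single ![a, b, 1] (1 : ℂ) else 0) := by
  rw [Jminus_mulVec_single, Fin.sum_univ_three, update_zero_three, update_one_three, update_two_three]
  rfl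

theorem Jplus_three (a b c : Fin 2) : (Jplus 3).mulVec (Pi.single ![a, b, c] 1) =
    (if a = 1 then Pi.single ![0, b, c] (1 : ℂ) else 0) +
      (if b = 1 then Pi.single ![a, 0, c] (1 : ℂ) else 0) +
      (if c = 1 then Pi.single ![a, b, 0] (1 : ℂ) else 0) := by
  rw [Jplus_mulVec_single, Fin.sum_univ_three, update_zero_three, update_one_three, update_two_three]
  rfl

theorem Jz_three (a b c : Fin 2) : (Jz 3).mulVec (Pi.single ![a, b, c] 1) =
    ((1 / 2 : ℂ) * ((if a = 0 then 1 else -1) + (if b = 0 then 1 else -1) +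
      (if c = 0 then 1 else -1))) • Pi.single ![a, b, c] (1 : ℂ) := by
  rw [Jz_mulVec_single, Fin.sum_univ_three]
  rfl

/-- The states of spin `3/2`. -/
def quartet : ℕ → Bits 3 → ℂ
  | 0 => Pi.single ![0, 0, 0] 1
  | 1 => ((1 / Real.sqrt 3 : ℝ) : ℂ) •
      (Pi.single ![1, 0, 0] 1 + Pi.single ![0, 1, 0] 1 + Pi.single ![0, 0, 1] 1)
  | 2 => ((1 / Real.sqrt 3 : ℝ) : ℂ) •
      (Pi.single ![0, 1, 1] 1 + Pi.single ![1, 0, 1] 1 + Pi.single ![1, 1, 0] 1)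
  | 3 => Pi.single ![1, 1, 1] 1
  | _ => 0

/-- States of spin `1/2`, if `x + y + z = 0`. -/
def doublet (x y z : ℂ) : ℕ → Bits 3 → ℂ
  | 0 => x • Pi.single ![1, 0, 0] 1 + y • Pi.single ![0, 1, 0] 1 + z • Pi.single ![0, 0, 1] 1
  | 1 => -(x • Pi.single ![0, 1, 1] 1 + y • Pi.single ![1, 0, 1] 1 + z • Pi.single ![1, 1, 0] 1)
  | _ => 0

theorem isLadder_quartet :
    IsLadder 4 quartet (fun j => Real.sqrt ((j + 1) * (3 - j))) (3 / 2) := by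
  have h3 : (Real.sqrt 3 : ℂ) * (Real.sqrt 3 : ℂ) = 3 := by
    exact_mod_cast Real.mul_self_sqrt (by norm_num : (0 : ℝ) ≤ 3)
  have h0 : (Real.sqrt 3 : ℂ) ≠ 0 := by
    intro h; rw [h] at h3; norm_num at h3
  have hi : ((1 / Real.sqrt 3 : ℝ) : ℂ) * 3 = Real.sqrt 3 := by
    push_cast
    field_simp
    linear_combination -h3
  have hi' : (Real.sqrt 3 : ℂ) * ((1 / Real.sqrt 3 : ℝ) : ℂ) = 1 := by
    push_cast
    field_simp
  have a0 : Real.sqrt (((0 : ℕ) + 1) * (3 - (0 : ℕ))) = Real.sqrt 3 := by norm_num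
  have a1 : Real.sqrt (((1 : ℕ) + 1) * (3 - (1 : ℕ))) = 2 := by
    rw [show (((1 : ℕ) + 1) * (3 - (1 : ℕ)) : ℝ) = 2 ^ 2 by norm_num]
    exact Real.sqrt_sq (by norm_num)
  have a2 : Real.sqrt (((2 : ℕ) + 1) * (3 - (2 : ℕ))) = Real.sqrt 3 := by norm_num
  constructor
  · intro j hj
    obtain ⟨k, rfl⟩ : ∃ k, j = k + 4 := ⟨j - 4, by omega⟩
    rfl
  · intro j
    match j with
    | 0 =>
      rw [a0]
      simp only [quartet, Jminus_three, if_true, smul_smul, hi']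
      module
    | 1 =>
      rw [a1]
      simp only [quartet, Matrix.mulVec_smul, Matrix.mulVec_add, Jminus_three, one_ne_zero, if_true,
        if_false, add_zero, zero_add]
      push_cast
      module
    | 2 =>
      rw [a2]
      simp only [quartet, Matrix.mulVec_smul, Matrix.mulVec_add, Jminus_three, one_ne_zero, if_true,
        if_false, add_zero, zero_add]
      rw [← hi]
      module
    | 3 =>
      simp only [quartet, Jminus_three, one_ne_zero, if_false, add_zero, smul_zero]
    | k + 4 => simp [quartet]
  · intro j hj
    match j with
    | 0 =>
      rw [a0]
      simp only [quartet, Matrix.mulVec_smul, Matrix.mulVec_add, Jplus_three, zero_ne_one, if_true,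
        if_false, add_zero, zero_add]
      rw [← hi]
      module
    | 1 =>
      rw [a1]
      simp only [quartet, Matrix.mulVec_smul, Matrix.mulVec_add, Jplus_three, zero_ne_one, if_true,
        if_false, add_zero, zero_add]
      push_cast
      module
    | 2 =>
      rw [a2]
      simp only [quartet, Jplus_three, if_true, smul_smul, hi']
      module
    | k + 3 => omega
  · intro j
    match j with
    | 0 =>
      simp only [quartet, Jz_three, if_true]
      push_cast
      module
    | 1 =>
      simp only [quartet, Matrix.mulVec_smul, Matrix.mulVec_add, Jz_three, if_true, one_ne_zero, if_false]
      push_cast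
      module
    | 2 =>
      simp only [quartet, Matrix.mulVec_smul, Matrix.mulVec_add, Jz_three, if_true, one_ne_zero, if_false]
      push_cast
      module
    | 3 =>
      simp only [quartet, Jz_three, one_ne_zero, if_false]
      push_cast
      module
    | k + 4 => simp [quartet]

theorem isLadder_doublet {x y z : ℂ} (h : x + y + z = 0) :
    IsLadder 2 (doublet x y z) (fun _ => 1) (1 / 2) := by
  obtain rfl : z = -x - y := by linear_combination h
  constructor
  · intro j hj
    obtain ⟨k, rfl⟩ : ∃ k, j = k + 2 := ⟨j - 2, by omega⟩
    rfl
  · intro j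
    match j with
    | 0 =>
      simp only [doublet, Matrix.mulVec_smul, Matrix.mulVec_add, Jminus_three, one_ne_zero, if_true,
        if_false, add_zero, zero_add]
      push_cast
      module
    | 1 =>
      simp only [doublet, Matrix.mulVec_neg, Matrix.mulVec_smul, Matrix.mulVec_add, Jminus_three,
        one_ne_zero, if_true, if_false, add_zero, zero_add]
      module
    | k + 2 => simp [doublet]
  · intro j hj
    match j with
    | 0 =>
      simp only [doublet, Matrix.mulVec_neg, Matrix.mulVec_smul, Matrix.mulVec_add, Jplus_three,
        zero_ne_one, if_true, if_false, add_zero, zero_add]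
      push_cast
      module
    | k + 1 => omega
  · intro j
    match j with
    | 0 =>
      simp only [doublet, Matrix.mulVec_smul, Matrix.mulVec_add, Jz_three, if_true, one_ne_zero, if_false]
      push_cast
      module
    | 1 =>
      simp only [doublet, Matrix.mulVec_neg, Matrix.mulVec_smul, Matrix.mulVec_add, Jz_three, if_true,
        one_ne_zero, if_false]
      push_cast
      module
    | k + 2 => simp [doublet]

theorem bits_three_cases (s : Bits 3) : s = ![0, 0, 0] ∨ s = ![1, 0, 0] ∨ s = ![0, 1, 0] ∨
    s = ![0, 0, 1] ∨ s = ![0, 1, 1] ∨ s = ![1, 0, 1] ∨ s = ![1, 1, 0] ∨ s = ![1, 1, 1] := by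
  have : s = ![s 0, s 1, s 2] := by ext i; fin_cases i <;> rfl
  rw [this]
  generalize s 0 = a
  generalize s 1 = b
  generalize s 2 = c
  fin_cases a <;> fin_cases b <;> fin_cases c <;> simp

theorem span_three_qubits : Submodule.span ℂ {quartet 0, quartet 1, quartet 2, quartet 3,
    doublet 1 (-1) 0 0, doublet 0 1 (-1) 0, doublet 1 (-1) 0 1, doublet 0 1 (-1) 1} = ⊤ := by
  refine span_eq_top_of_single fun b => ?_
  set P := Submodule.span ℂ {quartet 0, quartet 1, quartet 2, quartet 3, doublet 1 (-1) 0 0,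
    doublet 0 1 (-1) 0, doublet 1 (-1) 0 1, doublet 0 1 (-1) 1} with hP
  have m0 : quartet 0 ∈ P := Submodule.subset_span (by simp)
  have m1 : quartet 1 ∈ P := Submodule.subset_span (by simp)
  have m2 : quartet 2 ∈ P := Submodule.subset_span (by simp)
  have m3 : quartet 3 ∈ P := Submodule.subset_span (by simp)
  have m4 : doublet 1 (-1) 0 0 ∈ P := Submodule.subset_span (by simp)
  have m5 : doublet 0 1 (-1) 0 ∈ P := Submodule.subset_span (by simp)
  have m6 : doublet 1 (-1) 0 1 ∈ P := Submodule.subset_span (by simp)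
  have m7 : doublet 0 1 (-1) 1 ∈ P := Submodule.subset_span (by simp)
  have h3 : ((1 / Real.sqrt 3 : ℝ) : ℂ) ≠ 0 := by
    have : (1 / Real.sqrt 3 : ℝ) ≠ 0 := one_div_ne_zero (Real.sqrt_ne_zero'.2 (by norm_num))
    exact_mod_cast this
  replace m1 := (P.smul_mem_iff h3).1 m1
  replace m2 := (P.smul_mem_iff h3).1 m2
  simp only [doublet] at m4 m5 m6 m7
  have key : ∀ x y z w : Bits 3 → ℂ, ∀ a b c : ℂ, x + y + z ∈ P →
      (1 : ℂ) • x + (-1 : ℂ) • y + (0 : ℂ) • z ∈ P → (0 : ℂ) • x + (1 : ℂ) • y + (-1 : ℂ) • z ∈ P →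
      w = (a / 3) • (x + y + z) + (b / 3) • ((1 : ℂ) • x + (-1 : ℂ) • y + (0 : ℂ) • z) +
        (c / 3) • ((0 : ℂ) • x + (1 : ℂ) • y + (-1 : ℂ) • z) → w ∈ P := by
    rintro x y z w a b c h1 h2 h3 rfl
    exact P.add_mem (P.add_mem (P.smul_mem _ h1) (P.smul_mem _ h2)) (P.smul_mem _ h3)
  rw [P.neg_mem_iff] at m6 m7
  rcases bits_three_cases b with rfl | rfl | rfl | rfl | rfl | rfl | rfl | rfl
  · exact m0
  · exact key _ _ _ _ 1 2 1 m1 m4 m5 (by module)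
  · exact key _ _ _ _ 1 (-1) 1 m1 m4 m5 (by module)
  · exact key _ _ _ _ 1 (-1) (-2) m1 m4 m5 (by module)
  · exact key _ _ _ _ 1 2 1 m2 m6 m7 (by module)
  · exact key _ _ _ _ 1 (-1) 1 m2 m6 m7 (by module)
  · exact key _ _ _ _ 1 (-1) (-2) m2 m6 m7 (by module)
  · exact m3

/-- A permutation-invariant operator on three qubits which commutes with `∑ Z_j` acts by scalars on
the collective states. -/
theorem three_qubit_eigenvalues {U : QubitOp 3} (hperm : PermInvariant U) (hZ : Commute U (sumZ 3)) :
    ∃ (a : Fin 4 → ℂ) (b : Fin 2 → ℂ), (∀ k : Fin 4, U.mulVec (quartet k) = a k • quartet k) ∧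
      ∀ (k : Fin 2) (x y z : ℂ), x + y + z = 0 →
        U.mulVec (doublet x y z k) = b k • doublet x y z k := by
  have h01 : ∀ a b c a' b' c' : Fin 2, U ![b, a, c] ![b', a', c'] = U ![a, b, c] ![a', b', c'] := by
    intro a b c a' b' c'
    rw [← hperm.apply_comp (Equiv.swap 0 1) ![a, b, c] ![a', b', c']]
    congr 1 <;> ext k <;> fin_cases k <;> rfl
  have h12 : ∀ a b c a' b' c' : Fin 2, U ![a, c, b] ![a', c', b'] = U ![a, b, c] ![a', b', c'] := by
    intro a b c a' b' c'
    rw [← hperm.apply_comp (Equiv.swap 1 2) ![a, b, c] ![a', b', c']]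
    congr 1 <;> ext k <;> fin_cases k <;> rfl
  have hz : ∀ a b c a' b' c' : Fin 2, (a : ℕ) + b + c ≠ a' + b' + c' →
      U ![a, b, c] ![a', b', c'] = 0 := by
    intro a b c a' b' c' h
    refine apply_eq_zero_of_commute_sumZ hZ ?_
    have hv : ∀ a : Fin 2, (if a = 0 then (1 : ℂ) else -1) = 1 - 2 * ((a : ℕ) : ℂ) := by
      intro a
      fin_cases a <;> norm_num
    simp only [Fin.sum_univ_three, hv]
    intro h2
    refine h ?_
    have h3 : (((a : ℕ) + b + c : ℕ) : ℂ) = ((a' : ℕ) + b' + c' : ℕ) := by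
      push_cast
      simp at h2
      linear_combination (-1 / 2 : ℂ) * h2
    exact_mod_cast h3
  have hcol : ∀ s : Bits 3, U.mulVec (Pi.single s 1) =
      U ![0, 0, 0] s • Pi.single ![0, 0, 0] (1 : ℂ) + U ![1, 0, 0] s • Pi.single ![1, 0, 0] (1 : ℂ) +
      U ![0, 1, 0] s • Pi.single ![0, 1, 0] (1 : ℂ) + U ![0, 0, 1] s • Pi.single ![0, 0, 1] (1 : ℂ) +
      U ![0, 1, 1] s • Pi.single ![0, 1, 1] (1 : ℂ) + U ![1, 0, 1] s • Pi.single ![1, 0, 1] (1 : ℂ) +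
      U ![1, 1, 0] s • Pi.single ![1, 1, 0] (1 : ℂ) +
      U ![1, 1, 1] s • Pi.single ![1, 1, 1] (1 : ℂ) := by
    intro s
    ext t
    rw [Matrix.mulVec_single_one, Matrix.col_apply]
    rcases bits_three_cases t with rfl | rfl | rfl | rfl | rfl | rfl | rfl | rfl <;> simp
  -- the matrix entries between states with one or two excitations
  have p1 := h01 1 0 0 1 0 0
  have p2 := (h12 0 1 0 0 1 0).trans p1
  have q1 := h01 1 0 0 0 1 0
  have q2 := h12 1 0 0 0 1 0
  have q3 := (h12 0 1 0 1 0 0).trans q1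
  have q4 := (h01 1 0 0 0 0 1).trans q2
  have q5 := (h01 0 0 1 1 0 0).trans q3
  have p1' := h01 0 1 1 0 1 1
  have p2' := (h12 1 0 1 1 0 1).trans p1'
  have q1' := h01 0 1 1 1 0 1
  have q2' := h12 0 1 1 1 0 1
  have q3' := (h12 1 0 1 0 1 1).trans q1'
  have q4' := (h01 0 1 1 1 1 0).trans q2'
  have q5' := (h01 1 1 0 0 1 1).trans q3'
  have c0 : U.mulVec (Pi.single ![0, 0, 0] 1) =
      U ![0, 0, 0] ![0, 0, 0] • Pi.single ![0, 0, 0] (1 : ℂ) := by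
    rw [hcol]
    simp [hz]
  have c7 : U.mulVec (Pi.single ![1, 1, 1] 1) =
      U ![1, 1, 1] ![1, 1, 1] • Pi.single ![1, 1, 1] (1 : ℂ) := by
    rw [hcol]
    simp [hz]
  have c1 : U.mulVec (Pi.single ![1, 0, 0] 1) =
      (U ![1, 0, 0] ![1, 0, 0]) • Pi.single ![1, 0, 0] (1 : ℂ) +
      (U ![1, 0, 0] ![0, 1, 0]) • Pi.single ![0, 1, 0] (1 : ℂ) +
      (U ![1, 0, 0] ![0, 1, 0]) • Pi.single ![0, 0, 1] (1 : ℂ) := by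
    rw [hcol]
    simp [hz, q1, q3]
  have c2 : U.mulVec (Pi.single ![0, 1, 0] 1) =
      (U ![1, 0, 0] ![0, 1, 0]) • Pi.single ![1, 0, 0] (1 : ℂ) +
      (U ![1, 0, 0] ![1, 0, 0]) • Pi.single ![0, 1, 0] (1 : ℂ) +
      (U ![1, 0, 0] ![0, 1, 0]) • Pi.single ![0, 0, 1] (1 : ℂ) := by
    rw [hcol]
    simp [hz, p1, q5]
  have c3 : U.mulVec (Pi.single ![0, 0, 1] 1) =
      (U ![1, 0, 0] ![0, 1, 0]) • Pi.single ![1, 0, 0] (1 : ℂ) +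
      (U ![1, 0, 0] ![0, 1, 0]) • Pi.single ![0, 1, 0] (1 : ℂ) +
      (U ![1, 0, 0] ![1, 0, 0]) • Pi.single ![0, 0, 1] (1 : ℂ) := by
    rw [hcol]
    simp [hz, p2, q2, q4]
  have c4 : U.mulVec (Pi.single ![0, 1, 1] 1) =
      (U ![0, 1, 1] ![0, 1, 1]) • Pi.single ![0, 1, 1] (1 : ℂ) +
      (U ![0, 1, 1] ![1, 0, 1]) • Pi.single ![1, 0, 1] (1 : ℂ) +
      (U ![0, 1, 1] ![1, 0, 1]) • Pi.single ![1, 1, 0] (1 : ℂ) := by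
    rw [hcol]
    simp [hz, q1', q3']
  have c5 : U.mulVec (Pi.single ![1, 0, 1] 1) =
      (U ![0, 1, 1] ![1, 0, 1]) • Pi.single ![0, 1, 1] (1 : ℂ) +
      (U ![0, 1, 1] ![0, 1, 1]) • Pi.single ![1, 0, 1] (1 : ℂ) +
      (U ![0, 1, 1] ![1, 0, 1]) • Pi.single ![1, 1, 0] (1 : ℂ) := by
    rw [hcol]
    simp [hz, p1', q5']
  have c6 : U.mulVec (Pi.single ![1, 1, 0] 1) =
      (U ![0, 1, 1] ![1, 0, 1]) • Pi.single ![0, 1, 1] (1 : ℂ) +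
      (U ![0, 1, 1] ![1, 0, 1]) • Pi.single ![1, 0, 1] (1 : ℂ) +
      (U ![0, 1, 1] ![0, 1, 1]) • Pi.single ![1, 1, 0] (1 : ℂ) := by
    rw [hcol]
    simp [hz, p2', q2', q4']
  refine ⟨![U ![0, 0, 0] ![0, 0, 0], U ![1, 0, 0] ![1, 0, 0] + 2 * U ![1, 0, 0] ![0, 1, 0],
    U ![0, 1, 1] ![0, 1, 1] + 2 * U ![0, 1, 1] ![1, 0, 1], U ![1, 1, 1] ![1, 1, 1]],
    ![U ![1, 0, 0] ![1, 0, 0] - U ![1, 0, 0] ![0, 1, 0],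
      U ![0, 1, 1] ![0, 1, 1] - U ![0, 1, 1] ![1, 0, 1]], fun k => ?_, fun k x y z h => ?_⟩
  · fin_cases k
    · exact c0
    · change U.mulVec (quartet 1) =
        (U ![1, 0, 0] ![1, 0, 0] + 2 * U ![1, 0, 0] ![0, 1, 0]) • quartet 1
      simp only [quartet, Matrix.mulVec_smul, Matrix.mulVec_add, c1, c2, c3]
      module
    · change U.mulVec (quartet 2) =
        (U ![0, 1, 1] ![0, 1, 1] + 2 * U ![0, 1, 1] ![1, 0, 1]) • quartet 2
      simp only [quartet, Matrix.mulVec_smul, Matrix.mulVec_add, c4, c5, c6]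
      module
    · exact c7
  · obtain rfl : z = -x - y := by linear_combination h
    fin_cases k
    · change U.mulVec (doublet x y _ 0) =
        (U ![1, 0, 0] ![1, 0, 0] - U ![1, 0, 0] ![0, 1, 0]) • doublet x y _ 0
      simp only [doublet, Matrix.mulVec_smul, Matrix.mulVec_add, c1, c2, c3]
      module
    · change U.mulVec (doublet x y _ 1) =
        (U ![0, 1, 1] ![0, 1, 1] - U ![0, 1, 1] ![1, 0, 1]) • doublet x y _ 1
      simp only [doublet, Matrix.mulVec_neg, Matrix.mulVec_smul, Matrix.mulVec_add, c4, c5, c6]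
      module

/-- The couplings of the four nontrivial sectors of three qubits. -/
def sectorCoupling (i : Fin 4) (j : ℕ) : ℝ := Real.sqrt (sectorCouplingSq i j)

/-- Prescribed phases of the first vectors of the four coupled sectors, produced without affecting
the uncoupled ones. -/
theorem exists_three_qubit_phases {g ω : ℝ} (hg : 0 < g) (hω : ω ≠ 0) (θ : Fin 4 → ℝ) :
    ∃ (V : JointSpace 3 ≃ₗᵢ[ℂ] JointSpace 3) (τ : ℝ), Reachable g ω V τ ∧
      (∀ (i : Fin 4) (v : ℕ → Bits 3 → ℂ) (α : ℕ → ℝ) (m : ℝ), IsLadder (sectorRank i + 1) v α m →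
        (∀ j < sectorRank i, coupling α j = sectorCoupling i j) →
        V (Core.toJoint 3 (ket (v 0) 0)) =
          Complex.exp (θ i * Complex.I) • Core.toJoint 3 (ket (v 0) 0)) ∧
      ∀ (v : ℕ → Bits 3 → ℂ) (α : ℕ → ℝ) (m : ℝ), IsLadder 1 v α m →
        V (Core.toJoint 3 (ket (v 0) 0)) = Core.toJoint 3 (ket (v 0) 0) := by
  have hw : ∀ k : Σ i, Fin (sectorRank i), sectorCoupling k.1 k.2 * sectorCoupling k.1 k.2 =
      sectorCouplingSq k.1 k.2 := fun k =>
    Real.mul_self_sqrt (by exact_mod_cast (sectorCouplingSq_pos k).le)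
  have htop := span_tangentSpace_eq_top hw (fun k => (sectorCouplingSq_pos k).ne')
    sectorCouplingSq_separates
  obtain ⟨u, hu, hθ⟩ := exists_pulses_phases (by decide) htop θ
  obtain ⟨V, τ, hV, h⟩ := exists_implements (n := 3) hg hω hu
  refine ⟨V, τ, hV, fun i v α m hv hα => ?_, h.fixed⟩
  have := h.sector i v α m hv hα (Pi.single 0 1)
  rw [hθ, sectorMap_vacuum, sectorMap_vacuum, one_smul, map_smul] at this
  exact this

theorem realizable_three_qubits {g ω : ℝ} (hg : 0 < g) (hω : ω ≠ 0) {U : QubitOp 3}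
    (hU : U ∈ Matrix.unitaryGroup (Bits 3) ℂ) (hperm : PermInvariant U)
    (hZ : Commute U (sumZ 3)) : ∃ τ, RealizableInTime g ω U τ := by
  obtain ⟨a, b, ha, hb⟩ := three_qubit_eigenvalues hperm hZ
  have hne : ∀ (v : Bits 3 → ℂ) (s : Bits 3), v s ≠ 0 → v ≠ 0 := fun v s hs h => hs (by rw [h]; rfl)
  have na : ∀ k, ‖a k‖ = 1 := by
    intro k
    refine norm_eq_one_of_mulVec_eq_smul hU (hne _ (![![0, 0, 0], ![1, 0, 0], ![0, 1, 1], ![1, 1, 1]] k) ?_)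
      (ha k)
    fin_cases k <;> simp [quartet]
  have nb : ∀ k, ‖b k‖ = 1 := by
    intro k
    refine norm_eq_one_of_mulVec_eq_smul hU (hne _ (![![1, 0, 0], ![0, 1, 1]] k) ?_)
      (hb k 1 (-1) 0 (by ring))
    fin_cases k <;> simp [doublet]
  choose A hA using fun k => exists_exp_eq (na k)
  choose B hB using fun k => exists_exp_eq (nb k)
  -- the two uncoupled sectors determine the global phase `χ` and the final `z` rotation `ζ`
  obtain ⟨ζ, hζ⟩ : ∃ ζ, ζ = A 3 - B 1 := ⟨_, rfl⟩
  obtain ⟨χ, hχ⟩ : ∃ χ, χ = B 1 - ζ / 2 := ⟨_, rfl⟩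
  obtain ⟨V, τ, hV, hs, hf⟩ := exists_three_qubit_phases hg hω
    ![B 0 - χ + ζ / 2, A 2 - χ - ζ / 2, A 1 - χ + ζ / 2, A 0 - χ + 3 * ζ / 2]
  refine ⟨τ, realizable_of_spanning (hV.zRotation ζ) χ span_three_qubits ?_⟩
  have hq := isLadder_quartet
  have finish : ∀ (d : ℕ) (v : ℕ → Bits 3 → ℂ) (α : ℕ → ℝ) (m θ η : ℝ), IsLadder (d + 1) v α m →
      V (Core.toJoint 3 (ket (v 0) 0)) =
        Complex.exp (θ * Complex.I) • Core.toJoint 3 (ket (v 0) 0) →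
      U.mulVec (v 0) = Complex.exp (η * Complex.I) • v 0 → χ + θ - ζ * m = η →
      Complex.exp (χ * Complex.I) • (V.trans (zRotation 3 g ω ζ)) (Core.toJoint 3 (ket (v 0) 0)) =
        Core.toJoint 3 (ket (U.mulVec (v 0)) 0) := by
    rintro d v α m θ η hv hV hUv rfl
    rw [LinearIsometryEquiv.trans_apply, hV, hUv, map_smul, zRotation_ket hv g hω, smul_smul,
      smul_smul, ket_smul, map_smul]
    simp only [← Complex.exp_add]
    congr 2
    push_cast
    ring
  have hf' : ∀ (v : ℕ → Bits 3 → ℂ) (α : ℕ → ℝ) (m : ℝ), IsLadder 1 v α m →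
      V (Core.toJoint 3 (ket (v 0) 0)) =
        Complex.exp ((0 : ℝ) * Complex.I) • Core.toJoint 3 (ket (v 0) 0) := by
    intro v α m hv
    rw [hf v α m hv]
    simp
  have hd0 : ∀ x y z : ℂ, x + y + z = 0 → Complex.exp (χ * Complex.I) •
      (V.trans (zRotation 3 g ω ζ)) (Core.toJoint 3 (ket (doublet x y z 0) 0)) =
        Core.toJoint 3 (ket (U.mulVec (doublet x y z 0)) 0) := by
    intro x y z h
    have hl := isLadder_doublet h
    refine finish 1 (doublet x y z) _ _ _ (B 0) hl (hs 0 (doublet x y z) _ _ hl ?_) ?_ ?_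
    · intro j hj
      have : j < 1 := hj
      interval_cases j
      simp [coupling, sectorCoupling, sectorCouplingSq]
    · rw [hB]
      exact hb 0 x y z h
    · simp
      ring
  have hd1 : ∀ x y z : ℂ, x + y + z = 0 → Complex.exp (χ * Complex.I) •
      (V.trans (zRotation 3 g ω ζ)) (Core.toJoint 3 (ket (doublet x y z 1) 0)) =
        Core.toJoint 3 (ket (U.mulVec (doublet x y z 1)) 0) := by
    intro x y z h
    have hl := (isLadder_doublet h).tail
    refine finish 0 (fun j => doublet x y z (j + 1)) _ _ _ (B 1) hl (hf' (fun j => doublet x y z (j + 1)) _ _ hl) ?_ ?_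
    · rw [hB]
      exact hb 1 x y z h
    · rw [hχ]
      ring
  simp only [Set.mem_insert_iff, Set.mem_singleton_iff]
  rintro ψ (rfl | rfl | rfl | rfl | rfl | rfl | rfl | rfl)
  · refine finish 3 quartet _ _ _ (A 0) hq (hs 3 quartet _ _ hq ?_) ?_ ?_
    · intro j _
      simp only [coupling, sectorCoupling]
      rw [mul_comm, ← Real.sqrt_mul (by positivity)]
      simp [sectorCouplingSq]
    · rw [hA]
      exact ha 0
    · simp
      ring
  · have hl := hq.tail
    refine finish 2 (fun j => quartet (j + 1)) _ _ _ (A 1) hl (hs 2 (fun j => quartet (j + 1)) _ _ hl ?_) ?_ ?_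
    · intro j _
      simp only [coupling, sectorCoupling]
      rw [mul_comm, ← Real.sqrt_mul (by positivity)]
      congr 1
      change _ = (((j + 1) * ((j + 2) * (2 - j)) : ℤ) : ℝ)
      push_cast
      ring
    · rw [hA]
      exact ha 1
    · simp
      ring
  · have hl := hq.tail.tail
    refine finish 1 (fun j => quartet (j + 1 + 1)) _ _ _ (A 2) hl (hs 1 (fun j => quartet (j + 1 + 1)) _ _ hl ?_) ?_ ?_
    · intro j _
      simp only [coupling, sectorCoupling]
      rw [mul_comm, ← Real.sqrt_mul (by positivity)]
      congr 1
      change _ = (((j + 1) * ((j + 3) * (1 - j)) : ℤ) : ℝ)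
      push_cast
      ring
    · rw [hA]
      exact ha 2
    · simp
      ring
  · have hl := hq.tail.tail.tail
    refine finish 0 (fun j => quartet (j + 1 + 1 + 1)) _ _ _ (A 3) hl
      (hf' (fun j => quartet (j + 1 + 1 + 1)) _ _ hl) ?_ ?_
    · rw [hA]
      exact ha 3
    · rw [hχ, hζ]
      ring
  · exact hd0 _ _ _ (by ring)
  · exact hd0 _ _ _ (by ring)
  · exact hd1 _ _ _ (by ring)
  · exact hd1 _ _ _ (by ring)

end TavisCummings

end

theorem theorem3 (g ω : ℝ) (hg : 0 < g) (hω : ω ≠ 0) :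
    (∀ n : ℕ, n = 2 ∨ n = 3 →
      ∀ U : TavisCummings.QubitOp n, U ∈ Matrix.unitaryGroup (TavisCummings.Bits n) ℂ →
        TavisCummings.PermInvariant U → Commute U (TavisCummings.sumZ n) →
        ∃ τ : ℝ, TavisCummings.RealizableInTime g ω U τ) ∧
    (∀ U : TavisCummings.QubitOp 2, U ∈ Matrix.unitaryGroup (TavisCummings.Bits 2) ℂ →
        TavisCummings.PermInvariant U → Commute U (TavisCummings.sumZ 2) →
        ∃ τ : ℝ, τ ≤ 3.92 * (2 * Real.pi / g) ∧
          TavisCummings.RealizableInTime g ω U τ) := by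
  refine ⟨?_, fun U hU hperm hZ => ?_⟩
  · rintro n (rfl | rfl) U hU hperm hZ
    · exact ⟨_, TavisCummings.realizable_two_qubits hg hω hU hperm hZ⟩
    · exact TavisCummings.realizable_three_qubits hg hω hU hperm hZ
  · exact ⟨_, TavisCummings.eighteen_mul_piTime_le hg,
      TavisCummings.realizable_two_qubits hg hω hU hperm hZ⟩
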